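/- Let $k$ be a field of characteristic $0$, let $(X,\mathcal O_X)$ be a (small) site equipped with a sheaf of commutative $k$-algebras, and let $\mathcal L$ be a Lie algebroid on $X$ (a sheaf of $\mathcal O_X$-modules and of Lie $k$-algebras acting on $\mathcal O_X$ by derivations, $\mathcal O_X$-linearly in $\mathcal L$, with $[x,ay]=a[x,y]+x(a)y$), locally free of constant finite rank $d$ as an $\mathcal O_X$-module. We use the following notation. * $\mathrm U_X\mathcal L$ is the sheaf of universal enveloping algebras of $\mathcal L$: the sheafification of the presheaf of $k$-algebras generated by the algebra $\mathcal O_X$ (with the same unit) and by $\mathcal L$, subject to $a\cdot x=ax$, $x\cdot y-y\cdot x=[x,y]$ and $x\cdot a-a\cdot x=x(a)$. It is a cocommutative coalgebra for its left $\mathcal O_X$-module structure, with $\Delta(D)=D\cdot(1\otimes 1)$ (functions acting by scalars, sections of $\mathcal L$ by the Leibniz rule) and $\epsilon(D)=D(1)$. * $\mathrm{HC}^\bullet_{\mathcal L,X}=T_{\mathcal O_X}(\mathrm U_X\mathcal L)$ is the Hochschild cochain complex, $\mathrm{HC}^p=(\mathrm U_X\mathcal L)^{\otimes_{\mathcal O_X}p}$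 (tensor products for the left module structures), with differential $\mathrm d_{\mathrm H}=0$ on $\mathrm{HC}^0=\mathcal O_X$ and $\mathrm d_{\mathrm H}(D)=D\otimes1-\Delta_p(D)+\Delta_{p-1}(D)-\cdots+(-1)^{p+1}1\otimes D$ for $D\in \mathrm{HC}^p$, $p>0$, where $\Delta_i$ is $\Delta$ applied to the $i$-th factor. It is a DG-algebra for the cup product $D\cup E=(-1)^{pq}D\otimes E$ ($D\in\mathrm{HC}^p$, $E\in \mathrm{HC}^q$). In the opposite algebra the product of $D$ and $E$ is $(-1)^{pq}E\cup D$. * $J=\mathrm J_X\mathcal L=\mathcal Hom_{\mathcal O_X}(\mathrm U_X\mathcal L,\mathcal O_X)$ is the sheaf of jets, with the product $(\alpha\beta)(D)=\sum\alpha(D_{(1)})\beta(D_{(2)})$, the unit map $\mathcal O_X\to J$, $a\mapsto a\,\epsilon$, the counit $\epsilon:J\to\mathcal O_X$, $\epsilon(\alpha)=\alpha(1)$, and $J^c=\ker\epsilon$. For $E\in \mathrm U_X\mathcal L$ put $({}^2\nabla_E\alpha)(D)=\alpha(DE)$. * $\mathcal B_n=J^{\widehat\otimes (n+1)}=\varprojlim_q\,(J/(J^c)^q)^{\otimes_{\mathcal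 O_X}(n+1)}$ for $n\ge 0$, with the topology given by the kernels of the projections to the terms of the limit; it is a $J$-module through the first factor, and $\mathcal B_\bullet=\mathcal B^{\mathcal L}_{X,\bullet}$ is a complex with $$\mathrm b'(\alpha_0\otimes\cdots\otimes\alpha_{n+1})=\sum_{i=0}^{n}(-1)^i\alpha_0\otimes\cdots\otimes\alpha_i\alpha_{i+1}\otimes\cdots\otimes\alpha_{n+1}+(-1)^{n+1}\alpha_0\otimes\cdots\otimes\alpha_n\,\epsilon(\alpha_{n+1}).$$ * $\mathcal Hom^{\mathrm{cont}}_J(\mathcal B_\bullet,\mathcal B_\bullet)$ is the complex of sheaves, and DG-algebra under composition, whose part of degree $p\in\mathbb Z$ is the product over all $n,m\ge 0$ with $n=m+p$ of the sheaves of $J$-linear continuous maps $\mathcal B_n\to\mathcal B_m$ (a map is continuous if, for every $r$, locally there is a $q$ such that it sends sections that vanish at level $q$ to sections that vanish at level $r$), with differential $\varphi\mapsto \mathrm b'\varphi-(-1)^{p}\varphi\,\mathrm b'$. Then there is a map of DG-algebras (a morphism of complexes of sheaves, compatible with units and products) $$\Phi:(\mathrm{HC}^\bullet_{\mathcal L,X})^{\mathrm{opp}}\longrightarrow\mathcal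 Hom^{\mathrm{cont}}_{J}(\mathcal B_\bullet,\mathcal B_\bullet)$$ given by the cap product: for $D=D_1\otimes\cdots\otimes D_p$ and $\alpha=\alpha_0\otimes\cdots\otimes\alpha_n$, $$\Phi(D)(\alpha)=D\cap\alpha=\begin{cases}\bigl(\alpha_0\,{}^2\nabla_{D_1}\alpha_1\cdots{}^2\nabla_{D_p}\alpha_p\bigr)\otimes\alpha_{p+1}\otimes\cdots\otimes\alpha_n&\text{if } n\ge p,\\0&\text{otherwise}\end{cases}$$ for $p>0$, and $\Phi(f)(\alpha)=({}^2\nabla_f\alpha_0)\otimes\alpha_1\otimes\cdots\otimes\alpha_n$ for $f\in\mathrm{HC}^0=\mathcal O_X$. The map $\Phi$ is a quasi-isomorphism. -/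

import Mathlib

open CategoryTheory Opposite TensorProduct
open scoped LieRinehartAlgebra

universe u

noncomputable section

namespace LieAlgd

/-! ### The enveloping algebra of a Lie–Rinehart pair -/

section Envel

variable (k R L : Type u) [CommRing k] [CommRing R] [Algebra k R] [LieRing L] [Module R L]
  [LieRingModule L R]

/-- The defining relations of the enveloping algebra of a Lie–Rinehart pair `(R, L)` on generators
`a ∈ R` and `x ∈ L`: `R` is a unital `k`-subalgebra, `a • x = a x`, and brackets (of elements of
`L`, and of `x ∈ L` with `a ∈ R`) are commutators. -/
inductive EnvelRel : FreeAlgebra k (R ⊕ L) → FreeAlgebra k (R ⊕ L) → Prop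
  | smulR (c : k) (a : R) : EnvelRel (FreeAlgebra.ι k (Sum.inl (c • a)))
      (c • FreeAlgebra.ι k (Sum.inl a))
  | addR (a b : R) : EnvelRel (FreeAlgebra.ι k (Sum.inl (a + b)))
      (FreeAlgebra.ι k (Sum.inl a) + FreeAlgebra.ι k (Sum.inl b))
  | oneR : EnvelRel (FreeAlgebra.ι k (Sum.inl 1)) 1
  | mulR (a b : R) : EnvelRel (FreeAlgebra.ι k (Sum.inl (a * b)))
      (FreeAlgebra.ι k (Sum.inl a) * FreeAlgebra.ι k (Sum.inl b))
  | addL (x y : L) : EnvelRel (FreeAlgebra.ι k (Sum.inr (x + y)))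
      (FreeAlgebra.ι k (Sum.inr x) + FreeAlgebra.ι k (Sum.inr y))
  | smulL (a : R) (x : L) : EnvelRel (FreeAlgebra.ι k (Sum.inr (a • x)))
      (FreeAlgebra.ι k (Sum.inl a) * FreeAlgebra.ι k (Sum.inr x))
  | lieL (x y : L) : EnvelRel (FreeAlgebra.ι k (Sum.inr ⁅x, y⁆))
      (FreeAlgebra.ι k (Sum.inr x) * FreeAlgebra.ι k (Sum.inr y)
        - FreeAlgebra.ι k (Sum.inr y) * FreeAlgebra.ι k (Sum.inr x))
  | lieR (x : L) (a : R) : EnvelRel (FreeAlgebra.ι k (Sum.inl ⁅x, a⁆))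
      (FreeAlgebra.ι k (Sum.inr x) * FreeAlgebra.ι k (Sum.inl a)
        - FreeAlgebra.ι k (Sum.inl a) * FreeAlgebra.ι k (Sum.inr x))

/-- The universal enveloping algebra of a Lie–Rinehart pair `(R, L)` over `k`. -/
def Envel : Type u := RingQuot (EnvelRel k R L)

namespace Envel

instance : Ring (Envel k R L) := inferInstanceAs (Ring (RingQuot (EnvelRel k R L)))
instance : Algebra k (Envel k R L) := inferInstanceAs (Algebra k (RingQuot (EnvelRel k R L)))

/-- The canonical map from the free algebra. -/
def mk : FreeAlgebra k (R ⊕ L) →ₐ[k] Envel k R L := RingQuot.mkAlgHom k (EnvelRel k R L)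

variable {k R L}

theorem mk_rel {a b : FreeAlgebra k (R ⊕ L)} (h : EnvelRel k R L a b) :
    mk k R L a = mk k R L b := RingQuot.mkAlgHom_rel k h

theorem mk_surjective : Function.Surjective (mk k R L) := RingQuot.mkAlgHom_surjective k _

variable (k R L)

/-- The inclusion of functions in the enveloping algebra. -/
def incl : R →ₐ[k] Envel k R L :=
  AlgHom.ofLinearMap
    { toFun := fun a => mk k R L (FreeAlgebra.ι k (Sum.inl a))
      map_add' := fun a b => by rw [mk_rel (EnvelRel.addR a b), map_add]
      map_smul' := fun c a => by rw [mk_rel (EnvelRel.smulR c a), map_smul, RingHom.id_apply] }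
    (by
      change mk k R L _ = 1
      rw [mk_rel EnvelRel.oneR, map_one])
    (fun a b => by
      change mk k R L _ = mk k R L _ * mk k R L _
      rw [mk_rel (EnvelRel.mulR a b), map_mul])

/-- The canonical map from the Lie algebra to the enveloping algebra. -/
def lie : L →+ Envel k R L where
  toFun x := mk k R L (FreeAlgebra.ι k (Sum.inr x))
  map_zero' := by
    have h := mk_rel (EnvelRel.addL (k := k) (R := R) (0 : L) 0)
    rw [add_zero, map_add] at h
    exact left_eq_add.mp h
  map_add' x y := by rw [mk_rel (EnvelRel.addL x y), map_add]

variable {k R L}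

theorem lie_smul (a : R) (x : L) : lie k R L (a • x) = incl k R L a * lie k R L x :=
  (mk_rel (EnvelRel.smulL a x)).trans (map_mul _ _ _)

theorem lie_lie (x y : L) : lie k R L ⁅x, y⁆
    = lie k R L x * lie k R L y - lie k R L y * lie k R L x :=
  (mk_rel (EnvelRel.lieL x y)).trans (by rw [map_sub, map_mul, map_mul]; rfl)

theorem incl_lie (x : L) (a : R) : incl k R L ⁅x, a⁆
    = lie k R L x * incl k R L a - incl k R L a * lie k R L x :=
  (mk_rel (EnvelRel.lieR x a)).trans (by rw [map_sub, map_mul, map_mul]; rfl)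

theorem lie_mul_incl (x : L) (a : R) : lie k R L x * incl k R L a
    = incl k R L a * lie k R L x + incl k R L ⁅x, a⁆ := by
  rw [incl_lie]; abel

/-- The universal property of the enveloping algebra. -/
def lift {E : Type*} [Ring E] [Algebra k E] (φ : R →ₐ[k] E) (ψ : L →+ E)
    (h₁ : ∀ (a : R) (x : L), ψ (a • x) = φ a * ψ x)
    (h₂ : ∀ x y : L, ψ ⁅x, y⁆ = ψ x * ψ y - ψ y * ψ x)
    (h₃ : ∀ (x : L) (a : R), φ ⁅x, a⁆ = ψ x * φ a - φ a * ψ x) : Envel k R L →ₐ[k] E :=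
  RingQuot.liftAlgHom k ⟨FreeAlgebra.lift k (Sum.elim φ ψ), fun a b h => by
    cases h <;> simp [h₁, h₂, h₃]⟩

section lift
variable {E : Type*} [Ring E] [Algebra k E] (φ : R →ₐ[k] E) (ψ : L →+ E)
    (h₁ : ∀ (a : R) (x : L), ψ (a • x) = φ a * ψ x)
    (h₂ : ∀ x y : L, ψ ⁅x, y⁆ = ψ x * ψ y - ψ y * ψ x)
    (h₃ : ∀ (x : L) (a : R), φ ⁅x, a⁆ = ψ x * φ a - φ a * ψ x)

@[simp] theorem lift_incl (a : R) : lift φ ψ h₁ h₂ h₃ (incl k R L a) = φ a :=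
  (RingQuot.liftAlgHom_mkAlgHom_apply k _ _ _).trans (by simp)

@[simp] theorem lift_lie (x : L) : lift φ ψ h₁ h₂ h₃ (lie k R L x) = ψ x :=
  (RingQuot.liftAlgHom_mkAlgHom_apply k _ _ _).trans (by simp)

end lift

/-- `Envel k R L` is spanned additively by `1` under left multiplication by generators. -/
theorem induction_left {p : Envel k R L → Prop} (one : p 1)
    (add : ∀ D E, p D → p E → p (D + E)) (incl_mul : ∀ a D, p D → p (incl k R L a * D))
    (lie_mul : ∀ x D, p D → p (lie k R L x * D)) (D : Envel k R L) : p D := by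
  have key : ∀ w : FreeAlgebra k (R ⊕ L), ∀ E, p E → p (mk k R L w * E) := by
    intro w
    induction w using FreeAlgebra.induction with
    | grade0 r =>
      intro E hE
      have := incl_mul (algebraMap k R r) E hE
      rwa [AlgHom.commutes, ← AlgHom.commutes (mk k R L)] at this
    | grade1 x =>
      intro E hE
      cases x with
      | inl a => exact incl_mul a E hE
      | inr x => exact lie_mul x E hE
    | mul a b ha hb => intro E hE; rw [map_mul, mul_assoc]; exact ha _ (hb _ hE)
    | add a b ha hb => intro E hE; rw [map_add, add_mul]; exact add _ _ (ha _ hE) (hb _ hE)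
  obtain ⟨w, rfl⟩ := mk_surjective D
  simpa using key w 1 one

/-- The enveloping algebra is an `R`-module through left multiplication. -/
instance : Module R (Envel k R L) := Module.compHom _ (incl k R L).toRingHom

theorem smul_def (a : R) (D : Envel k R L) : a • D = incl k R L a * D := rfl

instance : IsScalarTower k R (Envel k R L) where
  smul_assoc c a D := by simp [smul_def]

instance : SMulCommClass R k (Envel k R L) where
  smul_comm a c D := by simp [smul_def]

instance : SMulCommClass k R (Envel k R L) where
  smul_comm a c D := by simp [smul_def]

/-- Right multiplication in the enveloping algebra, which is `R`-linear. -/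
def mulRight (E : Envel k R L) : Envel k R L →ₗ[R] Envel k R L where
  toFun D := D * E
  map_add' D D' := add_mul D D' E
  map_smul' a D := mul_assoc (incl k R L a) D E

@[simp] theorem mulRight_apply (E D : Envel k R L) : mulRight E D = D * E := rfl

/-! The coalgebra structure. -/

/-- The Leibniz rule on a tensor product over `R`: if `s`, `t` are additive endomorphisms of `M`,
`N` that satisfy the Leibniz rule over the same additive `δ : R → R`, this is
`m ⊗ n ↦ s m ⊗ n + m ⊗ t n`. -/
def leibniz {M N : Type*} [AddCommGroup M] [Module R M] [AddCommGroup N] [Module R N]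
    (δ : R → R) (s : M →+ M) (t : N →+ N) (hs : ∀ (a : R) m, s (a • m) = a • s m + δ a • m)
    (ht : ∀ (a : R) n, t (a • n) = a • t n + δ a • n) : M ⊗[R] N →+ M ⊗[R] N :=
  TensorProduct.liftAddHom
    { toFun := fun m =>
        { toFun := fun n => s m ⊗ₜ[R] n + m ⊗ₜ[R] t n
          map_zero' := by simp
          map_add' := fun n n' => by simp only [map_add, tmul_add]; abel }
      map_zero' := by ext; simp
      map_add' := fun m m' => by
        ext n
        simp only [map_add, add_tmul, AddMonoidHom.coe_mk, ZeroHom.coe_mk, AddMonoidHom.add_apply]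
        abel }
    (fun a m n => by
      simp only [AddMonoidHom.coe_mk, ZeroHom.coe_mk, hs, ht, tmul_add, add_tmul, smul_tmul]
      abel)

@[simp] theorem leibniz_tmul {M N : Type*} [AddCommGroup M] [Module R M] [AddCommGroup N]
    [Module R N] (δ : R → R) (s : M →+ M) (t : N →+ N) (hs ht) (m : M) (n : N) :
    leibniz δ s t hs ht (m ⊗ₜ[R] n) = s m ⊗ₜ[R] n + m ⊗ₜ[R] t n := rfl

theorem lie_mul_smul (x : L) (a : R) (D : Envel k R L) :
    AddMonoidHom.mulLeft (lie k R L x) (a • D)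
      = a • AddMonoidHom.mulLeft (lie k R L x) D + ⁅x, a⁆ • D := by
  simp only [smul_def, AddMonoidHom.coe_mulLeft, ← mul_assoc, lie_mul_incl, add_mul]

/-- Left multiplication by `x ∈ L` on `U ⊗[R] U`, that is `D ⊗ E ↦ x D ⊗ E + D ⊗ x E`. -/
def lieTensor (x : L) : Envel k R L ⊗[R] Envel k R L →+ Envel k R L ⊗[R] Envel k R L :=
  leibniz (fun a => ⁅x, a⁆) (AddMonoidHom.mulLeft (lie k R L x))
    (AddMonoidHom.mulLeft (lie k R L x)) (lie_mul_smul x) (lie_mul_smul x)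

@[simp] theorem lieTensor_tmul (x : L) (D E : Envel k R L) :
    lieTensor x (D ⊗ₜ[R] E) = (lie k R L x * D) ⊗ₜ[R] E + D ⊗ₜ[R] (lie k R L x * E) := rfl

/-- `lieTensor` as a `k`-linear map. -/
def lieTensorₗ (x : L) : Module.End k (Envel k R L ⊗[R] Envel k R L) where
  toFun := lieTensor x
  map_add' := map_add _
  map_smul' c z := by
    induction z with
    | zero => simp
    | tmul D E => simp [smul_tmul']
    | add z w hz hw => simp only [smul_add, map_add, hz, hw]

variable (k R L) in
/-- The action of the enveloping algebra on `U ⊗[R] U` (the tensor product of the two flat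
connections on `U`): functions act `R`-linearly and `x ∈ L` acts by
`D ⊗ E ↦ x D ⊗ E + D ⊗ x E`. -/
def tensorAct : Envel k R L →ₐ[k] Module.End k (Envel k R L ⊗[R] Envel k R L) :=
  lift (Algebra.lsmul k k (Envel k R L ⊗[R] Envel k R L))
    { toFun := lieTensorₗ
      map_zero' := by
        ext z
        change lieTensor 0 z = 0
        induction z with
        | zero => simp
        | tmul D E => simp
        | add z w hz hw => simp only [map_add, hz, hw, add_zero]
      map_add' := fun x y => by
        ext z
        change lieTensor (x + y) z = lieTensor x z + lieTensor y z
        induction z with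
        | zero => simp
        | tmul D E => simp [add_mul, add_tmul, tmul_add]; abel
        | add z w hz hw => simp only [map_add, hz, hw]; abel }
    (fun a x => by
      ext z
      change lieTensor (a • x) z = a • lieTensor x z
      induction z with
      | zero => simp
      | tmul D E => 
        have h : ∀ E : Envel k R L, incl k R L a * lie k R L x * E = a • (lie k R L x * E) :=
          fun E => mul_assoc _ _ _
        rw [lieTensor_tmul, lieTensor_tmul, lie_smul, h, h, smul_add, tmul_smul, smul_tmul',
          smul_tmul']
      | add z w hz hw => simp only [map_add, hz, hw, smul_add])
    (fun x y => by
      ext z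
      change lieTensor ⁅x, y⁆ z = lieTensor x (lieTensor y z) - lieTensor y (lieTensor x z)
      induction z with
      | zero => simp
      | tmul D E =>
        simp only [lieTensor_tmul, lie_lie, sub_mul, sub_tmul, tmul_sub, mul_assoc, map_add]; abel
      | add z w hz hw => simp only [map_add, hz, hw]; abel)
    (fun x a => by
      ext z
      change ⁅x, a⁆ • z = lieTensor x (a • z) - a • lieTensor x z
      induction z with
      | zero => simp
      | tmul D E =>
        have := lie_mul_smul (k := k) x a D
        simp only [AddMonoidHom.coe_mulLeft] at this
        simp only [smul_tmul', lieTensor_tmul, this, smul_add, add_tmul]; abel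
      | add z w hz hw => simp only [map_add, hz, hw, smul_add]; abel)

theorem tensorAct_incl (a : R) (z : Envel k R L ⊗[R] Envel k R L) :
    tensorAct k R L (incl k R L a) z = a • z := by
  rw [tensorAct, lift_incl]; rfl

theorem tensorAct_lie (x : L) (z : Envel k R L ⊗[R] Envel k R L) :
    tensorAct k R L (lie k R L x) z = lieTensor x z := by
  rw [tensorAct, lift_lie]; rfl

theorem lieTensor_smul (x : L) (a : R) (z : Envel k R L ⊗[R] Envel k R L) :
    lieTensor x (a • z) = a • lieTensor x z + ⁅x, a⁆ • z := by
  rw [← tensorAct_lie, ← tensorAct_incl, ← Module.End.mul_apply, ← map_mul, lie_mul_incl,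
    map_add, map_mul, LinearMap.add_apply, Module.End.mul_apply, tensorAct_incl, tensorAct_incl,
    tensorAct_lie]

section coalgebra

variable [LieAlgebra k L] [LieRinehartRing R L] [LieRinehartAlgebra k R L]

variable (k R L) in
/-- The action of the enveloping algebra on functions, extending the multiplication of `R` and the
anchor of `L`. -/
def act : Envel k R L →ₐ[k] Module.End k R :=
  lift (Algebra.lsmul k k R)
    { toFun := fun x => LieModule.toEnd k L R x
      map_zero' := by simp
      map_add' := by simp }
    (fun a x => by ext b; simp)
    (fun x y => by ext b; simp)
    (fun x a => by ext b; simp)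

theorem act_incl (a b : R) : act k R L (incl k R L a) b = a * b := by
  rw [act, lift_incl]; rfl

theorem act_lie (x : L) (b : R) : act k R L (lie k R L x) b = ⁅x, b⁆ := by
  rw [act, lift_lie]; rfl

/-- The comultiplication is `D ↦ D · (1 ⊗ 1)` and the counit is `D ↦ D(1)`. -/
instance : CoalgebraStruct R (Envel k R L) where
  comul :=
    { toFun := fun D => tensorAct k R L D (1 ⊗ₜ 1)
      map_add' := fun D E => by simp
      map_smul' := fun a D => by
        rw [smul_def, map_mul, Module.End.mul_apply, tensorAct_incl, RingHom.id_apply] }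
  counit :=
    { toFun := fun D => act k R L D 1
      map_add' := fun D E => by simp
      map_smul' := fun a D => by
        rw [smul_def, map_mul, Module.End.mul_apply, act_incl, RingHom.id_apply, smul_eq_mul] }

open Coalgebra

theorem comul_def (D : Envel k R L) : comul (R := R) D = tensorAct k R L D (1 ⊗ₜ 1) := rfl

theorem counit_def (D : Envel k R L) : counit (R := R) D = act k R L D 1 := rfl

@[simp] theorem comul_one : comul (R := R) (1 : Envel k R L) = 1 ⊗ₜ 1 := by simp [comul_def]

@[simp] theorem counit_one : counit (R := R) (1 : Envel k R L) = 1 := by simp [counit_def]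

theorem comul_incl_mul (a : R) (D : Envel k R L) :
    comul (R := R) (incl k R L a * D) = a • comul (R := R) D := by
  rw [comul_def, map_mul, Module.End.mul_apply, tensorAct_incl]; rfl

theorem comul_lie_mul (x : L) (D : Envel k R L) :
    comul (R := R) (lie k R L x * D) = lieTensor x (comul (R := R) D) := by
  rw [comul_def, map_mul, Module.End.mul_apply, tensorAct_lie]; rfl

theorem counit_incl_mul (a : R) (D : Envel k R L) :
    counit (R := R) (incl k R L a * D) = a * counit (R := R) D := by
  rw [counit_def, map_mul, Module.End.mul_apply, act_incl]; rfl

theorem counit_lie_mul (x : L) (D : Envel k R L) :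
    counit (R := R) (lie k R L x * D) = ⁅x, counit (R := R) D⁆ := by
  rw [counit_def, map_mul, Module.End.mul_apply, act_lie]; rfl

/-- Left multiplication by `x ∈ L` on the triple tensor product. -/
def lieTensor₃ (x : L) : Envel k R L ⊗[R] (Envel k R L ⊗[R] Envel k R L) →+
    Envel k R L ⊗[R] (Envel k R L ⊗[R] Envel k R L) :=
  leibniz (fun a => ⁅x, a⁆) (AddMonoidHom.mulLeft (lie k R L x)) (lieTensor x)
    (lie_mul_smul x) (lieTensor_smul x)

@[simp] theorem lieTensor₃_tmul (x : L) (D : Envel k R L) (z : Envel k R L ⊗[R] Envel k R L) :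
    lieTensor₃ x (D ⊗ₜ[R] z) = (lie k R L x * D) ⊗ₜ[R] z + D ⊗ₜ[R] lieTensor x z := rfl

theorem comul_coassoc (D : Envel k R L) :
    TensorProduct.assoc R _ _ _ ((comul (R := R) (A := Envel k R L)).rTensor _ (comul (R := R) D))
      = (comul (R := R) (A := Envel k R L)).lTensor _ (comul (R := R) D) := by
  induction D using induction_left with
  | one => simp
  | add D E hD hE => simp only [map_add, hD, hE]
  | incl_mul a D hD => simp only [comul_incl_mul, map_smul, hD]
  | lie_mul x D hD =>
    have h₁ : ∀ z : Envel k R L ⊗[R] Envel k R L,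
        (comul (R := R) (A := Envel k R L)).lTensor (Envel k R L) (lieTensor x z)
          = lieTensor₃ x ((comul (R := R) (A := Envel k R L)).lTensor _ z) := by
      intro z
      induction z with
      | zero => simp
      | tmul D E => simp [comul_lie_mul]
      | add z w hz hw => simp only [map_add, hz, hw]
    have h₂ : ∀ z : Envel k R L ⊗[R] Envel k R L,
        TensorProduct.assoc R _ _ _
          ((comul (R := R) (A := Envel k R L)).rTensor (Envel k R L) (lieTensor x z))
          = lieTensor₃ x (TensorProduct.assoc R _ _ _
            ((comul (R := R) (A := Envel k R L)).rTensor _ z)) := by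
      intro z
      induction z with
      | zero => simp
      | tmul D E =>
        simp only [lieTensor_tmul, map_add, LinearMap.rTensor_tmul, comul_lie_mul]
        generalize comul (R := R) D = w
        induction w with
        | zero => simp
        | tmul F G => simp [add_tmul, tmul_add, add_assoc]
        | add w w' hw hw' =>
          simp only [map_add, add_tmul] at hw hw' ⊢
          rw [← hw, ← hw']; abel
      | add z w hz hw => simp only [map_add, hz, hw]
    rw [comul_lie_mul, h₁, h₂, hD]

theorem comm_comul (D : Envel k R L) :
    TensorProduct.comm R _ _ (comul (R := R) D) = comul (R := R) D := by
  induction D using induction_left with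
  | one => simp
  | add D E hD hE => simp only [map_add, hD, hE]
  | incl_mul a D hD => simp only [comul_incl_mul, map_smul, hD]
  | lie_mul x D hD =>
    have h : ∀ z : Envel k R L ⊗[R] Envel k R L,
        TensorProduct.comm R _ _ (lieTensor x z) = lieTensor x (TensorProduct.comm R _ _ z) := by
      intro z
      induction z with
      | zero => simp
      | tmul D E => simp [add_comm]
      | add z w hz hw => simp only [map_add, hz, hw]
    rw [comul_lie_mul, h, hD]

theorem rTensor_counit (D : Envel k R L) :
    TensorProduct.lid R _ ((counit (R := R) (A := Envel k R L)).rTensor _ (comul (R := R) D))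
      = D := by
  induction D using induction_left with
  | one => simp
  | add D E hD hE => simp only [map_add, hD, hE]
  | incl_mul a D hD => simp only [comul_incl_mul, map_smul, hD, smul_def]
  | lie_mul x D hD =>
    have h : ∀ z : Envel k R L ⊗[R] Envel k R L,
        TensorProduct.lid R _
          ((counit (R := R) (A := Envel k R L)).rTensor (Envel k R L) (lieTensor x z))
          = lie k R L x * TensorProduct.lid R _
            ((counit (R := R) (A := Envel k R L)).rTensor _ z) := by
      intro z
      induction z with
      | zero => simp
      | tmul D E =>
        have := lie_mul_smul (k := k) x (counit (R := R) D) E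
        simp only [AddMonoidHom.coe_mulLeft] at this
        simp [counit_lie_mul, this, add_comm]
      | add z w hz hw => simp only [map_add, hz, hw, mul_add]
    rw [comul_lie_mul, h, hD]

instance : Coalgebra R (Envel k R L) where
  coassoc := LinearMap.ext comul_coassoc
  rTensor_counit_comp_comul := LinearMap.ext fun D =>
    (TensorProduct.lid R _).injective (by simpa using rTensor_counit D)
  lTensor_counit_comp_comul := LinearMap.ext fun D =>
    (TensorProduct.rid R _).injective (by
      have h : ∀ z : Envel k R L ⊗[R] Envel k R L,
          TensorProduct.rid R _ ((counit (R := R) (A := Envel k R L)).lTensor (Envel k R L) z)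
            = TensorProduct.lid R _ ((counit (R := R) (A := Envel k R L)).rTensor _
              (TensorProduct.comm R _ _ z)) := by
        intro z
        induction z with
        | zero => simp
        | tmul D E => simp
        | add z w hz hw => simp only [map_add, hz, hw]
      rw [LinearMap.comp_apply, h, comm_comul, rTensor_counit]
      simp)

instance : IsCocomm R (Envel k R L) where
  comm_comp_comul := LinearMap.ext comm_comul

end coalgebra

section map

variable {R' L' : Type u} [CommRing R'] [Algebra k R'] [LieRing L'] [Module R' L']
  [LieRingModule L' R'] [LieAlgebra k L] [LieAlgebra k L']

/-- Functoriality of the enveloping algebra. -/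
def map (σ : R →ₐ[k] R') (F : L →ₗ⁅σ⁆ L') : Envel k R L →ₐ[k] Envel k R' L' :=
  lift ((incl k R' L').comp σ) ((lie k R' L').comp (F.toLieHom : L →+ L'))
    (fun a x => by
      change lie k R' L' (F (a • x)) = incl k R' L' (σ a) * lie k R' L' (F x)
      rw [F.map_smul_apply, lie_smul])
    (fun x y => by
      change lie k R' L' (F.toLieHom ⁅x, y⁆) = _
      rw [LieHom.map_lie, lie_lie]; rfl)
    (fun x a => by
      change incl k R' L' (σ ⁅x, a⁆) = lie k R' L' (F x) * incl k R' L' (σ a) - _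
      rw [F.apply_lie, incl_lie]; rfl)

variable (σ : R →ₐ[k] R') (F : L →ₗ⁅σ⁆ L')

@[simp] theorem map_incl (a : R) : map σ F (incl k R L a) = incl k R' L' (σ a) := by
  rw [map, lift_incl]; rfl

@[simp] theorem map_lie (x : L) : map σ F (lie k R L x) = lie k R' L' (F x) := by
  rw [map, lift_lie]; rfl

/-- Functoriality of the enveloping algebra, as a semilinear map. -/
def mapₛₗ : Envel k R L →ₛₗ[(σ : R →+* R')] Envel k R' L' where
  toFun := map σ F
  map_add' := map_add _
  map_smul' a D := by
    simp only [smul_def, map_mul, map_incl]; rfl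

@[simp] theorem mapₛₗ_apply (D : Envel k R L) : mapₛₗ σ F D = map σ F D := rfl

variable [LieRinehartRing R L] [LieRinehartAlgebra k R L] [LieRinehartRing R' L']
  [LieRinehartAlgebra k R' L']

open Coalgebra

theorem comul_map (D : Envel k R L) : comul (R := R') (map σ F D)
    = TensorProduct.map (mapₛₗ σ F) (mapₛₗ σ F) (comul (R := R) D) := by
  induction D using induction_left with
  | one => simp
  | add D E hD hE => simp only [map_add, hD, hE]
  | incl_mul a D hD =>
    rw [map_mul, map_incl, comul_incl_mul, comul_incl_mul, hD, LinearMap.map_smulₛₗ]; rfl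
  | lie_mul x D hD =>
    have h : ∀ z : Envel k R L ⊗[R] Envel k R L,
        TensorProduct.map (mapₛₗ σ F) (mapₛₗ σ F) (lieTensor x z)
          = lieTensor (F x) (TensorProduct.map (mapₛₗ σ F) (mapₛₗ σ F) z) := by
      intro z
      induction z with
      | zero => simp
      | tmul D E => simp
      | add z w hz hw => simp only [map_add, hz, hw]
    rw [map_mul, map_lie, comul_lie_mul, comul_lie_mul, hD, h]

theorem counit_map (D : Envel k R L) : counit (R := R') (map σ F D)
    = σ (counit (R := R) D) := by
  induction D using induction_left with
  | one => simp
  | add D E hD hE => simp only [map_add, hD, hE]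
  | incl_mul a D hD => rw [map_mul, map_incl, counit_incl_mul, counit_incl_mul, hD, map_mul]
  | lie_mul x D hD => rw [map_mul, map_lie, counit_lie_mul, counit_lie_mul, hD, F.apply_lie]

end map

end Envel

end Envel

/-! ### Tensor powers: semilinear functoriality, coHochschild and bar differentials -/

section TensorPowers

/-- The map induced on tensor powers by a semilinear map. -/
def tensMap {ι R R' M M' : Type*} [CommRing R] [CommRing R'] [AddCommGroup M] [Module R M]
    [AddCommGroup M'] [Module R' M'] {σ : R →+* R'} (g : M →ₛₗ[σ] M') :
    (⨂[R] _ : ι, M) →ₛₗ[σ] (⨂[R'] _ : ι, M') :=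
  letI : Module R (⨂[R'] _ : ι, M') := Module.compHom _ σ
  { toFun := PiTensorProduct.lift (R := R) (s := fun _ : ι => M)
      { toFun := fun m => PiTensorProduct.tprod R' (fun i => g (m i))
        map_update_add' := fun m i x y => by
          have h : ∀ z, (fun j => g (Function.update m i z j))
            = Function.update (fun j => g (m j)) i (g z) := fun z => Function.comp_update g m i z
          simp only [h, map_add, MultilinearMap.map_update_add]
        map_update_smul' := fun m i c x => by
          have h : ∀ z, (fun j => g (Function.update m i z j))
            = Function.update (fun j => g (m j)) i (g z) := fun z => Function.comp_update g m i z
          simp only [h, LinearMap.map_smulₛₗ, MultilinearMap.map_update_smul]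
          rfl }
    map_add' := map_add _
    map_smul' := fun c x => LinearMap.map_smul _ c x }

@[simp] theorem tensMap_tprod {ι R R' M M' : Type*} [CommRing R] [CommRing R'] [AddCommGroup M]
    [Module R M] [AddCommGroup M'] [Module R' M'] {σ : R →+* R'} (g : M →ₛₗ[σ] M') (m : ι → M) :
    tensMap g (PiTensorProduct.tprod R m) = PiTensorProduct.tprod R' (fun i => g (m i)) := by
  let : Module R (⨂[R'] _ : ι, M') := Module.compHom _ σ
  exact PiTensorProduct.lift.tprod (R := R) (s := fun _ : ι => M) m

/-- Semilinear maps out of a tensor power agree if they agree on pure tensors. -/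
theorem tens_ext {ι R R' M N : Type*} [CommRing R] [CommRing R'] [AddCommGroup M]
    [Module R M] [AddCommGroup N] [Module R' N] {σ : R →+* R'}
    {F G : (⨂[R] _ : ι, M) →ₛₗ[σ] N} (h : ∀ m, F (PiTensorProduct.tprod R m) = G (PiTensorProduct.tprod R m)) : F = G := by
  ext x
  induction x using PiTensorProduct.induction_on with
  | smul_tprod r m => rw [LinearMap.map_smulₛₗ, LinearMap.map_smulₛₗ, h]
  | add x y hx hy => rw [map_add, map_add, hx, hy]

section coHochschild

variable (R : Type*) {A : Type*} [CommRing R] [AddCommGroup A] [Module R A]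

/-- The `p`-th tensor power of an `R`-module. -/
abbrev TPow (R A : Type*) [CommRing R] [AddCommGroup A] [Module R A] (p : ℕ) : Type _ :=
  ⨂[R] _ : Fin p, A

/-- For `i : Fin (n + 1)`, the map sending `D₀ ⊗ ⋯ ⊗ (omitting Dᵢ) ⊗ ⋯ ⊗ Dₙ` and `a ⊗ b` to
`D₀ ⊗ ⋯ ⊗ Dᵢ₋₁ ⊗ a ⊗ b ⊗ Dᵢ₊₁ ⊗ ⋯ ⊗ Dₙ`. -/
def insertTwo {n : ℕ} (i : Fin (n + 1)) :
    A ⊗[R] A →ₗ[R] MultilinearMap R (fun _ : Fin n => A) (TPow R A (n + 2)) :=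
  TensorProduct.lift <| LinearMap.flip <|
    LinearMap.comp
      (MultilinearMap.curryMidLinearEquiv R (fun _ : Fin (n + 1) => A)
        (TPow R A (n + 2)) i).toLinearMap
      ((PiTensorProduct.tprod R (s := fun _ : Fin (n + 2) => A)).curryMid i.succ)

theorem insertTwo_tmul {n : ℕ} (i : Fin (n + 1)) (a b : A) (m : Fin n → A) :
    insertTwo R i (a ⊗ₜ[R] b) m = PiTensorProduct.tprod R (i.succ.insertNth b (i.insertNth a m)) := rfl

variable [CoalgebraStruct R A] [One A]

/-- `Δᵢ` applies the comultiplication to the `i`-th factor of `D₀ ⊗ ⋯ ⊗ Dₙ`. -/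
def comulAt {n : ℕ} (i : Fin (n + 1)) : TPow R A (n + 1) →ₗ[R] TPow R A (n + 2) :=
  PiTensorProduct.lift ((insertTwo R i ∘ₗ CoalgebraStruct.comul).uncurryMid i)

theorem comulAt_tprod {n : ℕ} (i : Fin (n + 1)) (D : Fin (n + 1) → A) :
    comulAt R i (PiTensorProduct.tprod R D)
      = insertTwo R i (CoalgebraStruct.comul (R := R) (D i)) (i.removeNth D) :=
  PiTensorProduct.lift.tprod D

/-- `D₁ ⊗ ⋯ ⊗ Dₚ ↦ 1 ⊗ D₁ ⊗ ⋯ ⊗ Dₚ`. -/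
def oneTens (p : ℕ) : TPow R A p →ₗ[R] TPow R A (p + 1) :=
  PiTensorProduct.lift ((PiTensorProduct.tprod R (s := fun _ : Fin (p + 1) => A)).curryMid 0 1)

/-- `D₁ ⊗ ⋯ ⊗ Dₚ ↦ D₁ ⊗ ⋯ ⊗ Dₚ ⊗ 1`. -/
def tensOne (p : ℕ) : TPow R A p →ₗ[R] TPow R A (p + 1) :=
  PiTensorProduct.lift ((PiTensorProduct.tprod R (s := fun _ : Fin (p + 1) => A)).curryMid (Fin.last p) 1)

theorem oneTens_tprod (p : ℕ) (D : Fin p → A) :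
    oneTens R p (PiTensorProduct.tprod R D) = PiTensorProduct.tprod R (Fin.cons 1 D) := by
  rw [oneTens, PiTensorProduct.lift.tprod, MultilinearMap.curryMid_apply_apply,
    Fin.insertNth_zero']

theorem tensOne_tprod (p : ℕ) (D : Fin p → A) :
    tensOne R p (PiTensorProduct.tprod R D) = PiTensorProduct.tprod R (Fin.snoc D 1) := by
  rw [tensOne, PiTensorProduct.lift.tprod, MultilinearMap.curryMid_apply_apply,
    Fin.insertNth_last']

/-- The differential of the Hochschild cochain complex: zero in degree `0`, and
`D ↦ D ⊗ 1 - Δₚ D + Δₚ₋₁ D - ⋯ + (-1)ᵖ⁺¹ 1 ⊗ D` in degree `p > 0`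
(the factors are numbered `0, …, p - 1` here). -/
def coHoch : (p : ℕ) → TPow R A p →ₗ[R] TPow R A (p + 1)
  | 0 => 0
  | n + 1 => tensOne R (n + 1) + (∑ i : Fin (n + 1), (-1 : R) ^ (n + 1 - (i : ℕ)) • comulAt R i)
      + (-1 : R) ^ (n + 2) • oneTens R (n + 1)

end coHochschild

theorem comp_insertNth {A B : Type*} (g : A → B) {n : ℕ} (i : Fin (n + 1)) (b : A)
    (m : Fin n → A) : (fun j => g (i.insertNth (α := fun _ => A) b m j))
      = i.insertNth (α := fun _ => B) (g b) (fun j => g (m j)) := by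
  funext j
  refine Fin.succAboveCases i ?_ (fun j => ?_) j <;> simp

section coHochschildMap

variable {R R' A A' : Type*} [CommRing R] [CommRing R'] [AddCommGroup A] [Module R A]
  [AddCommGroup A'] [Module R' A'] [CoalgebraStruct R A] [One A] [CoalgebraStruct R' A'] [One A']
  {σ : R →+* R'} (g : A →ₛₗ[σ] A')

theorem coHoch_tensMap (h₁ : g 1 = 1)
    (h₂ : ∀ a, CoalgebraStruct.comul (R := R') (g a)
      = TensorProduct.map g g (CoalgebraStruct.comul (R := R) a)) (p : ℕ) (x : TPow R A p) :
    tensMap g (coHoch R p x) = coHoch R' p (tensMap g x) := by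
  have key : (tensMap g).comp (coHoch R p) = (coHoch R' p).comp (tensMap (ι := Fin p) g) := by
    apply tens_ext
    intro m
    cases p with
    | zero => simp [coHoch]
    | succ n =>
      have hc : ∀ (i : Fin (n + 1)) (z : A ⊗[R] A) (m : Fin n → A),
          tensMap g (insertTwo R i z m)
            = insertTwo R' i (TensorProduct.map g g z) (fun j => g (m j)) := by
        intro i z m
        induction z with
        | zero => simp
        | tmul a b =>
          rw [TensorProduct.map_tmul, insertTwo_tmul, insertTwo_tmul, tensMap_tprod]
          congr 1
          simp only [comp_insertNth]
        | add z w hz hw => simp only [map_add, add_apply, hz, hw]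
      have h1 : tensMap g (tensOne R (n + 1) (PiTensorProduct.tprod R m))
          = tensOne R' (n + 1) (tensMap g (PiTensorProduct.tprod R m)) := by
        rw [tensMap_tprod, tensOne_tprod, tensOne_tprod, tensMap_tprod, ← h₁]
        congr 1
        exact Fin.comp_snoc g m 1
      have h2 : tensMap g (oneTens R (n + 1) (PiTensorProduct.tprod R m))
          = oneTens R' (n + 1) (tensMap g (PiTensorProduct.tprod R m)) := by
        rw [tensMap_tprod, oneTens_tprod, oneTens_tprod, tensMap_tprod, ← h₁]
        congr 1
        exact Fin.comp_cons g 1 m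
      have h3 : ∀ i : Fin (n + 1), tensMap g (comulAt R i (PiTensorProduct.tprod R m))
          = comulAt R' i (tensMap g (PiTensorProduct.tprod R m)) := by
        intro i
        rw [tensMap_tprod, comulAt_tprod, comulAt_tprod, hc, h₂]; rfl
      simp only [coHoch, LinearMap.comp_apply, LinearMap.add_apply, LinearMap.sum_apply,
        LinearMap.smul_apply, map_add, map_sum, LinearMap.map_smulₛₗ, h1, h2, h3, map_pow,
        map_neg, map_one]
  exact LinearMap.congr_fun key x

end coHochschildMap

section bar

variable (R : Type*) {A : Type*} [CommRing R] [CommRing A] [Algebra R A]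

/-- `α₀ ⊗ ⋯ ⊗ αₚ₊₁ ↦ α₀ ⊗ ⋯ ⊗ αᵢ αᵢ₊₁ ⊗ ⋯ ⊗ αₚ₊₁`, for `0 ≤ i ≤ p`. -/
def barFace (p : ℕ) (i : Fin (p + 1)) : TPow R A (p + 2) →ₗ[R] TPow R A (p + 1) :=
  PiTensorProduct.lift <|
    (MultilinearMap.mkPiAlgebra R (Fin (p + 2)) (TPow R A (p + 1))).compLinearMap
      (fun j => (PiTensorProduct.singleAlgHom (R := R) (A := fun _ : Fin (p + 1) => A)
        (i.predAbove j)).toLinearMap)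

/-- `α₀ ⊗ ⋯ ⊗ αₚ₊₁ ↦ α₀ ⊗ ⋯ ⊗ αₚ ε(αₚ₊₁)`. -/
def barLast (ε : A →ₐ[R] R) (p : ℕ) : TPow R A (p + 2) →ₗ[R] TPow R A (p + 1) :=
  PiTensorProduct.lift <|
    (MultilinearMap.mkPiAlgebra R (Fin (p + 2)) (TPow R A (p + 1))).compLinearMap
      (Fin.snoc (α := fun _ => A →ₗ[R] TPow R A (p + 1))
        (fun j => (PiTensorProduct.singleAlgHom (R := R) (A := fun _ : Fin (p + 1) => A) j).toLinearMap)
        ((Algebra.ofId R (TPow R A (p + 1))).comp ε).toLinearMap)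

/-- The bar differential
`b'(α₀ ⊗ ⋯ ⊗ αₚ₊₁) = α₀α₁ ⊗ ⋯ - α₀ ⊗ α₁α₂ ⊗ ⋯ + ⋯ + (-1)ᵖ⁺¹ α₀ ⊗ ⋯ ⊗ αₚ ε(αₚ₊₁)`. -/
def barD (ε : A →ₐ[R] R) (p : ℕ) : TPow R A (p + 2) →ₗ[R] TPow R A (p + 1) :=
  (∑ i : Fin (p + 1), (-1 : R) ^ (i : ℕ) • barFace R p i) + (-1 : R) ^ (p + 1) • barLast R ε p

/-- `a` acts on `α₀ ⊗ ⋯ ⊗ αₚ` by `a α₀ ⊗ α₁ ⊗ ⋯ ⊗ αₚ`. -/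
def actFirst (p : ℕ) : A →+* Module.End R (TPow R A (p + 1)) :=
  ((Algebra.lmul R (TPow R A (p + 1))).comp
    (PiTensorProduct.singleAlgHom (R := R) (A := fun _ : Fin (p + 1) => A) 0)).toRingHom

theorem actFirst_tprod (p : ℕ) (a : A) (m : Fin (p + 1) → A) :
    actFirst R p a (PiTensorProduct.tprod R m)
      = PiTensorProduct.tprod R (Pi.mulSingle 0 a * m) :=
  PiTensorProduct.tprod_mul_tprod _ _

theorem barFace_tprod (p : ℕ) (i : Fin (p + 1)) (m : Fin (p + 2) → A) :
    barFace R p i (PiTensorProduct.tprod R m)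
      = PiTensorProduct.tprod R (∏ j, Pi.mulSingle (i.predAbove j) (m j)) := by
  rw [barFace, PiTensorProduct.lift.tprod, PiTensorProduct.tprod_prod]
  rfl

theorem barLast_tprod (ε : A →ₐ[R] R) (p : ℕ) (m : Fin (p + 2) → A) :
    barLast R ε p (PiTensorProduct.tprod R m)
      = ε (m (Fin.last _)) • PiTensorProduct.tprod R (fun j : Fin (p + 1) => m j.castSucc) := by
  have h : (fun j : Fin (p + 1) => m j.castSucc)
      = ∏ j : Fin (p + 1), Pi.mulSingle j (m j.castSucc) :=
    (Finset.univ_prod_mulSingle _).symm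
  rw [barLast, PiTensorProduct.lift.tprod, h, PiTensorProduct.tprod_prod,
    MultilinearMap.compLinearMap_apply, MultilinearMap.mkPiAlgebra_apply, Fin.prod_univ_castSucc,
    Algebra.smul_def, mul_comm]
  simp only [Fin.snoc_last, Fin.snoc_castSucc]
  rfl

theorem barD_actFirst (ε : A →ₐ[R] R) (p : ℕ) (a : A) (x : TPow R A (p + 2)) :
    barD R ε p (actFirst R (p + 1) a x) = actFirst R p a (barD R ε p x) := by
  have hf : ∀ i, (barFace R p i).comp (actFirst R (p + 1) a)
      = (actFirst R p a).comp (barFace R p i) := by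
    intro i
    apply tens_ext
    intro m
    simp only [LinearMap.comp_apply, actFirst_tprod, barFace_tprod]
    congr 1
    simp only [Pi.mul_apply, Pi.mulSingle_mul, Finset.prod_mul_distrib]
    congr 1
    rw [Fin.prod_univ_succ]
    simp
  have hl : (barLast R ε p).comp (actFirst R (p + 1) a)
      = (actFirst R p a).comp (barLast R ε p) := by
    apply tens_ext
    intro m
    simp only [LinearMap.comp_apply, actFirst_tprod, barLast_tprod, map_smul]
    congr 2
    · simp
    · congr 1
      funext j
      refine Fin.cases ?_ (fun j => ?_) j
      · simp
      · have : (j.succ.castSucc : Fin (p + 2)) ≠ 0 := Fin.succ_ne_zero j.castSucc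
        simp [Pi.mulSingle_eq_of_ne this]
  have hf' := fun i => LinearMap.congr_fun (hf i) x
  have hl' := LinearMap.congr_fun hl x
  simp only [LinearMap.comp_apply] at hf' hl'
  simp only [barD, LinearMap.add_apply, LinearMap.sum_apply, LinearMap.smul_apply, map_add,
    map_sum, map_smul, hf', hl']

end bar

section barMap

variable {R R' A A' : Type*} [CommRing R] [CommRing R'] [CommRing A] [Algebra R A]
  [CommRing A'] [Algebra R' A'] {σ : R →+* R'} (g : A →+* A')
  (hg : ∀ r, g (algebraMap R A r) = algebraMap R' A' (σ r))

/-- A ring homomorphism over `σ : R → R'`, as a semilinear map. -/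
def semilin : A →ₛₗ[σ] A' where
  toFun := g
  map_add' := map_add g
  map_smul' r a := by rw [Algebra.smul_def, map_mul, hg, Algebra.smul_def]

@[simp] theorem semilin_apply (a : A) : semilin g hg a = g a := rfl

theorem tensMap_actFirst (p : ℕ) (a : A) (x : TPow R A (p + 1)) :
    tensMap (semilin g hg) (actFirst R p a x)
      = actFirst R' p (g a) (tensMap (semilin g hg) x) := by
  have h : (tensMap (semilin g hg)).comp (actFirst R p a)
      = (actFirst R' p (g a)).comp (tensMap (ι := Fin (p + 1)) (semilin g hg)) := by
    apply tens_ext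
    intro m
    simp only [LinearMap.comp_apply, actFirst_tprod, tensMap_tprod, semilin_apply, Pi.mul_apply,
      map_mul]
    congr 1
    funext j
    simp only [Pi.mul_apply]
    congr 1
    exact (Pi.apply_mulSingle (fun _ => g) (fun _ => map_one g) 0 a j)
  exact LinearMap.congr_fun h x

theorem tensMap_barD (ε : A →ₐ[R] R) (ε' : A' →ₐ[R'] R') (hε : ∀ a, ε' (g a) = σ (ε a))
    (p : ℕ) (x : TPow R A (p + 2)) :
    tensMap (semilin g hg) (barD R ε p x) = barD R' ε' p (tensMap (semilin g hg) x) := by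
  have h : (tensMap (semilin g hg)).comp (barD R ε p)
      = (barD R' ε' p).comp (tensMap (ι := Fin (p + 2)) (semilin g hg)) := by
    apply tens_ext
    intro m
    have hf : ∀ i, tensMap (semilin g hg) (barFace R p i (PiTensorProduct.tprod R m))
        = barFace R' p i (PiTensorProduct.tprod R' (fun j => g (m j))) := by
      intro i
      rw [barFace_tprod, barFace_tprod, tensMap_tprod]
      congr 1
      funext l
      simp only [Finset.prod_apply, semilin_apply, map_prod]
      refine Finset.prod_congr rfl fun j _ => ?_
      exact (Pi.apply_mulSingle (fun _ => g) (fun _ => map_one g) _ _ l)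
    have hl : tensMap (semilin g hg) (barLast R ε p (PiTensorProduct.tprod R m))
        = barLast R' ε' p (PiTensorProduct.tprod R' (fun j => g (m j))) := by
      rw [barLast_tprod, barLast_tprod, LinearMap.map_smulₛₗ, tensMap_tprod, hε]
      rfl
    simp only [barD, LinearMap.comp_apply, LinearMap.add_apply, LinearMap.sum_apply,
      LinearMap.smul_apply, map_add, map_sum, LinearMap.map_smulₛₗ, map_pow, map_neg, map_one, hf,
      hl, tensMap_tprod, semilin_apply]
  exact LinearMap.congr_fun h x

end barMap

end TensorPowers

section Square

variable (R : Type*) {A : Type*} [CommRing R]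

section cons

variable [AddCommGroup A] [Module R A]

/-- `a, D₁ ⊗ ⋯ ⊗ Dₙ ↦ a ⊗ D₁ ⊗ ⋯ ⊗ Dₙ`. -/
def consT (n : ℕ) : A →ₗ[R] TPow R A n →ₗ[R] TPow R A (n + 1) :=
  (PiTensorProduct.lift.toLinearMap).comp
    ((PiTensorProduct.tprod R (s := fun _ : Fin (n + 1) => A)).curryMid 0)

theorem consT_tprod (n : ℕ) (a : A) (m : Fin n → A) :
    consT R n a (PiTensorProduct.tprod R m) = PiTensorProduct.tprod R (Fin.cons a m) := by
  refine (PiTensorProduct.lift.tprod m).trans ?_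
  rw [MultilinearMap.curryMid_apply_apply, Fin.insertNth_zero']

theorem tprod_eq_consT (n : ℕ) (m : Fin (n + 1) → A) :
    PiTensorProduct.tprod R m = consT R n (m 0) (PiTensorProduct.tprod R (Fin.tail m)) := by
  rw [consT_tprod, Fin.cons_self_tail]

/-- Linear maps out of a tensor power agree if they agree on `a ⊗ y`. -/
theorem cons_ext {n : ℕ} {N : Type*} [AddCommGroup N] [Module R N] {F G : TPow R A (n + 1) →ₗ[R] N}
    (h : ∀ a y, F (consT R n a y) = G (consT R n a y)) : F = G :=
  tens_ext fun m => by rw [tprod_eq_consT, h]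

end cons

section bar

variable [CommRing A] [Algebra R A] (ε : A →ₐ[R] R)

theorem barD_consT (p : ℕ) (a : A) (y : TPow R A (p + 2)) :
    barD R ε (p + 1) (consT R (p + 2) a y)
      = actFirst R (p + 1) a y - consT R (p + 1) a (barD R ε p y) := by
  have h : (barD R ε (p + 1)).comp (consT R (p + 2) a)
      = actFirst R (p + 1) a - (consT R (p + 1) a).comp (barD R ε p) := by
    apply tens_ext
    intro m
    have h0 : barFace R (p + 1) 0 (PiTensorProduct.tprod R (Fin.cons a m)) = actFirst R (p + 1) a (PiTensorProduct.tprod R m) := by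
      rw [barFace_tprod, actFirst_tprod, Fin.prod_univ_succ]
      congr 2
      exact Finset.univ_prod_mulSingle m
    have hs : ∀ i : Fin (p + 1), barFace R (p + 1) i.succ (PiTensorProduct.tprod R (Fin.cons a m))
        = consT R (p + 1) a (barFace R p i (PiTensorProduct.tprod R m)) := by
      intro i
      rw [barFace_tprod, barFace_tprod, consT_tprod, Fin.prod_univ_succ]
      congr 1
      funext j
      refine Fin.cases ?_ (fun j => ?_) j
      · simp [Finset.prod_apply]
      · simp [Finset.prod_apply, Pi.mulSingle_apply]
    have hl : barLast R ε (p + 1) (PiTensorProduct.tprod R (Fin.cons a m))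
        = consT R (p + 1) a (barLast R ε p (PiTensorProduct.tprod R m)) := by
      rw [barLast_tprod, barLast_tprod, map_smul, consT_tprod]
      congr 2
      funext j
      refine Fin.cases ?_ (fun j => ?_) j <;> rfl
    simp only [LinearMap.comp_apply, LinearMap.sub_apply, consT_tprod, barD, LinearMap.add_apply,
      LinearMap.sum_apply, LinearMap.smul_apply, map_add, map_sum, map_smul]
    rw [Fin.sum_univ_succ]
    simp only [h0, hs, hl, Fin.val_zero, pow_zero, one_smul, Fin.val_succ, pow_succ _ _, mul_neg,
      mul_one, neg_smul, Finset.sum_neg_distrib]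
    abel
  exact LinearMap.congr_fun h y

theorem barD_zero_consT (a : A) (m : Fin 1 → A) :
    barD R ε 0 (consT R 1 a (PiTensorProduct.tprod R m)) = PiTensorProduct.tprod R (fun _ => a * (m 0 - algebraMap R A (ε (m 0)))) := by
  have h : ∀ b : Fin 1 → A, b = fun _ => b 0 := fun b => funext fun j => by rw [Fin.fin_one_eq_zero j]
  have h1 : barFace R 0 0 (PiTensorProduct.tprod R (Fin.cons a m)) = PiTensorProduct.tprod R (fun _ : Fin 1 => a * m 0) := by
    rw [barFace_tprod]
    congr 1
    funext j
    rw [show j = 0 from Fin.fin_one_eq_zero j]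
    simp [Fin.prod_univ_two]
  have h2 : barLast R ε 0 (PiTensorProduct.tprod R (Fin.cons a m))
      = PiTensorProduct.tprod R (fun _ : Fin 1 => a * algebraMap R A (ε (m 0))) := by
    rw [barLast_tprod]
    have := (PiTensorProduct.tprod R (s := fun _ : Fin 1 => A)).map_update_smul (fun _ => a) 0 (ε (m 0)) a
    have h' : ∀ x : A, Function.update (fun _ : Fin 1 => a) 0 x = fun _ => x := fun x => by
      rw [h (Function.update _ _ _), Function.update_self]
    rw [h', h'] at this
    rw [mul_comm a, ← Algebra.smul_def, this]
    congr 2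
    funext j; rw [show j = 0 from Fin.fin_one_eq_zero j]; rfl
  have h3 := (PiTensorProduct.tprod R (s := fun _ : Fin 1 => A)).map_update_sub (fun _ => a) 0 (a * m 0)
    (a * algebraMap R A (ε (m 0)))
  have h' : ∀ x : A, Function.update (fun _ : Fin 1 => a) 0 x = fun _ => x := fun x => by
    rw [h (Function.update _ _ _), Function.update_self]
  rw [h', h', h'] at h3
  rw [consT_tprod, mul_sub, h3, barD]
  simp [h1, h2, sub_eq_add_neg]

theorem barD_barD (p : ℕ) (x : TPow R A (p + 3)) : barD R ε p (barD R ε (p + 1) x) = 0 := by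
  have h : ∀ p, (barD R ε p).comp (barD R ε (p + 1)) = 0 := by
    intro p
    induction p with
    | zero =>
      apply tens_ext
      intro m
      rw [tprod_eq_consT, tprod_eq_consT R 1, LinearMap.comp_apply, barD_consT, map_sub,
        barD_actFirst, barD_zero_consT, barD_zero_consT, actFirst_tprod, LinearMap.zero_apply,
        sub_eq_zero]
      congr 1
      funext j
      rw [show j = 0 from Fin.fin_one_eq_zero j]
      simp [Algebra.algebraMap_eq_smul_one]
    | succ p ih =>
      apply cons_ext
      intro a y
      have := LinearMap.congr_fun ih y
      rw [LinearMap.comp_apply, LinearMap.zero_apply] at this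
      rw [LinearMap.comp_apply, barD_consT, map_sub, barD_actFirst, barD_consT, this, map_zero,
        sub_zero, sub_self, LinearMap.zero_apply]
  exact LinearMap.congr_fun (h p) x

end bar

section coHoch

variable [AddCommGroup A] [Module R A] [Coalgebra R A] [One A]

/-- `(a ⊗ b) ⊗ y ↦ a ⊗ b ⊗ y`. -/
def consTwo (n : ℕ) : A ⊗[R] A →ₗ[R] TPow R A n →ₗ[R] TPow R A (n + 2) :=
  TensorProduct.lift (((LinearMap.llcomp R (TPow R A n) (TPow R A (n + 1)) (TPow R A (n + 2))).comp
    (consT R (n + 1))).compl₂ (consT R n))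

@[simp] theorem consTwo_tmul (n : ℕ) (a b : A) (y : TPow R A n) :
    consTwo R n (a ⊗ₜ b) y = consT R (n + 1) a (consT R n b y) := rfl

/-- The differential of an element of degree one. -/
def coOne : A →ₗ[R] A ⊗[R] A :=
  (TensorProduct.mk R A A).flip 1 - CoalgebraStruct.comul + TensorProduct.mk R A A 1

theorem coHoch_consT (n : ℕ) (a : A) (y : TPow R A n) :
    coHoch R (n + 1) (consT R n a y)
      = consT R (n + 1) a (coHoch R n y) + (-1 : R) ^ n • consTwo R n (coOne R a) y := by
  have h : (coHoch R (n + 1)).comp (consT R n a)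
      = (consT R (n + 1) a).comp (coHoch R n) + (-1 : R) ^ n • consTwo R n (coOne R a) := by
    apply tens_ext
    intro m
    have hone : ∀ (k : ℕ) (m : Fin k → A), oneTens R k (PiTensorProduct.tprod R m) = consT R k 1 (PiTensorProduct.tprod R m) := by
      intro k m; rw [oneTens_tprod, consT_tprod]
    have h1 : tensOne R (n + 1) (PiTensorProduct.tprod R (Fin.cons a m))
        = consT R (n + 1) a (tensOne R n (PiTensorProduct.tprod R m)) := by
      rw [tensOne_tprod, tensOne_tprod, consT_tprod]
      exact congr_arg _ (Fin.cons_snoc_eq_snoc_cons a m 1).symm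
    have h2 : comulAt R 0 (PiTensorProduct.tprod R (Fin.cons a m))
        = consTwo R n (CoalgebraStruct.comul a) (PiTensorProduct.tprod R m) := by
      rw [comulAt_tprod, Fin.cons_zero]
      generalize CoalgebraStruct.comul (R := R) a = z
      have ht : Fin.removeNth 0 (Fin.cons a m : Fin (n + 1) → A) = m := by
        rw [Fin.removeNth_zero, Fin.tail_cons]
      rw [ht]
      induction z with
      | zero => simp
      | tmul b c =>
        rw [insertTwo_tmul, consTwo_tmul, consT_tprod, consT_tprod, Fin.insertNth_zero',
          Fin.insertNth_succ_cons, Fin.insertNth_zero']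
      | add z w hz hw => simp only [map_add, LinearMap.add_apply, add_apply, hz, hw]
    have h4 : (-1 : R) ^ n • consTwo R n (coOne R a) (PiTensorProduct.tprod R m)
        = (-1 : R) ^ n • consT R (n + 1) a (consT R n 1 (PiTensorProduct.tprod R m))
          - (-1 : R) ^ n • consTwo R n (CoalgebraStruct.comul a) (PiTensorProduct.tprod R m)
          + (-1 : R) ^ n • consT R (n + 1) 1 (consT R n a (PiTensorProduct.tprod R m)) := by
      simp [coOne, smul_sub]
    rw [LinearMap.comp_apply, LinearMap.add_apply, LinearMap.comp_apply, LinearMap.smul_apply, h4,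
      consT_tprod R n a m]
    cases n with
    | zero =>
      have h5 : tensOne R 0 (PiTensorProduct.tprod R m)
          = consT R 0 1 (PiTensorProduct.tprod R m) := by
        rw [tensOne_tprod, consT_tprod]
        congr 1
        funext j
        rw [show j = 0 from Fin.fin_one_eq_zero j]
        rfl
      simp only [coHoch, LinearMap.add_apply, LinearMap.sum_apply, LinearMap.smul_apply, h1, h2,
        hone, h5, Fin.sum_univ_succ, Finset.univ_eq_empty, Finset.sum_empty, LinearMap.zero_apply,
        map_zero]
      simp [sub_eq_add_neg]
    | succ n =>
      have h3 : ∀ i : Fin (n + 1), comulAt R i.succ (PiTensorProduct.tprod R (Fin.cons a m))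
          = consT R (n + 2) a (comulAt R i (PiTensorProduct.tprod R m)) := by
        intro i
        have hr : i.succ.removeNth (Fin.cons a m : Fin (n + 2) → A)
            = Fin.cons a (i.removeNth m) := by
          funext j
          refine Fin.cases ?_ (fun j => ?_) j
          · simp [Fin.removeNth]
          · simp [Fin.removeNth]
        rw [comulAt_tprod, comulAt_tprod, Fin.cons_succ, hr]
        generalize CoalgebraStruct.comul (R := R) (m i) = z
        induction z with
        | zero => simp
        | tmul b c =>
          rw [insertTwo_tmul, insertTwo_tmul, consT_tprod, Fin.insertNth_succ_cons,
            Fin.insertNth_succ_cons]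
        | add z w hz hw => simp only [map_add, add_apply, hz, hw]
      rw [coHoch, coHoch]
      simp only [LinearMap.add_apply, LinearMap.sum_apply, LinearMap.smul_apply, h1,
        hone, map_add, map_sum, map_smul]
      rw [Fin.sum_univ_succ]
      simp only [h2, h3, Fin.val_succ, Fin.val_zero, Nat.add_sub_add_right, Nat.sub_zero,
        consT_tprod R (n + 1) a m]
      rw [show (-1 : R) ^ (n + 1 + 1) = - (-1) ^ (n + 1) by ring,
        show (-1 : R) ^ (n + 1 + 2) = (-1) ^ (n + 1) by ring]
      simp only [neg_smul]
      abel
  exact LinearMap.congr_fun h y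

/-- `(a ⊗ (b ⊗ c)) ⊗ y ↦ a ⊗ b ⊗ c ⊗ y`. -/
def consThree (n : ℕ) : A ⊗[R] (A ⊗[R] A) →ₗ[R] TPow R A n →ₗ[R] TPow R A (n + 3) :=
  TensorProduct.lift (((LinearMap.llcomp R (TPow R A n) (TPow R A (n + 2)) (TPow R A (n + 3))).comp
    (consT R (n + 2))).compl₂ (consTwo R n))

theorem consThree_tmul (n : ℕ) (a : A) (z : A ⊗[R] A) (y : TPow R A n) :
    consThree R n (a ⊗ₜ z) y = consT R (n + 2) a (consTwo R n z y) := rfl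

theorem coHoch_coHoch (h₁ : CoalgebraStruct.comul (R := R) (1 : A) = 1 ⊗ₜ 1) (p : ℕ)
    (x : TPow R A p) : coHoch R (p + 1) (coHoch R p x) = 0 := by
  have key : ∀ a : A, (coOne R).lTensor A (coOne R a)
      = TensorProduct.assoc R A A A ((coOne R).rTensor A (coOne R a)) := by
    intro a
    have hc := Coalgebra.coassoc_apply (R := R) a
    have hone : coOne R (1 : A) = 1 ⊗ₜ 1 := by simp [coOne, h₁]
    have e1 : ∀ z : A ⊗[R] A, (coOne R).lTensor A z
        = TensorProduct.assoc R A A A (z ⊗ₜ 1) - (CoalgebraStruct.comul (R := R)).lTensor A z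
          + (TensorProduct.mk R A A 1).lTensor A z := by
      intro z
      induction z with
      | zero => simp
      | tmul b c => simp [coOne, tmul_add, tmul_sub]
      | add z w hz hw => simp only [map_add, hz, hw, add_tmul]; abel
    have e2 : ∀ z : A ⊗[R] A, TensorProduct.assoc R A A A ((coOne R).rTensor A z)
        = (TensorProduct.mk R A A 1).lTensor A z
          - TensorProduct.assoc R A A A ((CoalgebraStruct.comul (R := R)).rTensor A z)
          + 1 ⊗ₜ z := by
      intro z
      induction z with
      | zero => simp
      | tmul b c => simp [coOne, add_tmul, sub_tmul]
      | add z w hz hw => simp only [map_add, hz, hw, tmul_add]; abel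
    have e3 : coOne R a = a ⊗ₜ 1 - CoalgebraStruct.comul (R := R) a + 1 ⊗ₜ a := rfl
    rw [e1, e2, e3]
    simp only [map_add, map_sub, hc, LinearMap.lTensor_tmul, LinearMap.rTensor_tmul, h₁,
      TensorProduct.mk_apply, TensorProduct.assoc_tmul, add_tmul, sub_tmul, tmul_add, tmul_sub]
    abel
  induction p with
  | zero => simp only [coHoch, LinearMap.zero_apply, map_zero]
  | succ n ih =>
    have h : (coHoch R (A := A) (n + 2)).comp (coHoch R (n + 1)) = 0 := by
      apply cons_ext
      intro a y
      have h2 : ∀ z : A ⊗[R] A, coHoch R (n + 2) (consTwo R n z y)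
          = consTwo R (n + 1) z (coHoch R n y)
            + (-1 : R) ^ n • (consThree R n ((coOne R).lTensor A z) y
              - consThree R n (TensorProduct.assoc R A A A ((coOne R).rTensor A z)) y) := by
        intro z
        induction z with
        | zero => simp
        | tmul b c =>
          have h3 : ∀ w : A ⊗[R] A, consTwo R (n + 1) w (consT R n c y)
              = consThree R n (TensorProduct.assoc R A A A (w ⊗ₜ c)) y := by
            intro w
            induction w with
            | zero => simp
            | tmul d e => rfl
            | add w w' hw hw' => simp only [map_add, LinearMap.add_apply, hw, hw', add_tmul]
          rw [consTwo_tmul, coHoch_consT, coHoch_consT, map_add, map_smul, h3,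
            LinearMap.lTensor_tmul, LinearMap.rTensor_tmul, consThree_tmul, consTwo_tmul,
            pow_succ, mul_neg, mul_one, neg_smul, smul_sub]
          abel
        | add z w hz hw =>
          simp only [map_add, LinearMap.add_apply, hz, hw, smul_sub, smul_add]; abel
      rw [LinearMap.comp_apply, coHoch_consT, map_add, map_smul, coHoch_consT, ih, h2, key,
        sub_self, smul_zero, add_zero, map_zero, zero_add, ← add_smul, pow_succ]
      simp
    exact LinearMap.congr_fun h x

end coHoch

end Square

/-! ### Lie algebroids on ringed sites and their jets -/

section Algebroids

variable {C : Type u} [SmallCategory C] {T : GrothendieckTopology C} {k : Type u} [Field k]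

/-- The `k`-algebra of sections over `U` of a sheaf of commutative `k`-algebras. -/
abbrev fn (O : Sheaf T (CommAlgCat.{u} k)) (U : C) : CommAlgCat.{u} k := O.obj.obj (op U)

/-- The restriction of sections. -/
abbrev fnRes (O : Sheaf T (CommAlgCat.{u} k)) {U V : C} (f : V ⟶ U) : fn O U →ₐ[k] fn O V :=
  (O.obj.map f.op).hom

theorem fnRes_id (O : Sheaf T (CommAlgCat.{u} k)) (U : C) (a : fn O U) :
    fnRes O (𝟙 U) a = a := by
  simp [fnRes]

theorem fnRes_comp (O : Sheaf T (CommAlgCat.{u} k)) {U V W : C} (f : V ⟶ U) (g : W ⟶ V)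
    (a : fn O U) : fnRes O (g ≫ f) a = fnRes O g (fnRes O f a) := by
  simp [fnRes]

/-- A presheaf of Lie algebras `L` acting on the structure sheaf `O`, which is also a presheaf of
`O`-modules, such that over every object the pair `(O(U), L(U))` is a Lie–Rinehart algebra. -/
structure PreLieAlgebroid (O : Sheaf T (CommAlgCat.{u} k)) where
  /-- the sections -/
  sec : C → Type u
  [lieRing : ∀ U, LieRing (sec U)]
  [lieAlgebra : ∀ U, LieAlgebra k (sec U)]
  [module : ∀ U, Module (fn O U) (sec U)]
  [lieRingModule : ∀ U, LieRingModule (sec U) (fn O U)]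
  [lieRinehartRing : ∀ U, LieRinehartRing (fn O U) (sec U)]
  [lieRinehartAlgebra : ∀ U, LieRinehartAlgebra k (fn O U) (sec U)]
  /-- the restriction maps, which are morphisms of Lie–Rinehart algebras -/
  res : ∀ {U V : C} (f : V ⟶ U), sec U →ₗ⁅fnRes O f⁆ sec V
  res_id : ∀ (U : C) (x : sec U), res (𝟙 U) x = x
  res_comp : ∀ {U V W : C} (f : V ⟶ U) (g : W ⟶ V) (x : sec U), res (g ≫ f) x = res g (res f x)

attribute [instance] PreLieAlgebroid.lieRing PreLieAlgebroid.lieAlgebra PreLieAlgebroid.module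
  PreLieAlgebroid.lieRingModule PreLieAlgebroid.lieRinehartRing
  PreLieAlgebroid.lieRinehartAlgebra

/-- The underlying presheaf of sets. -/
def PreLieAlgebroid.toPresheaf {O : Sheaf T (CommAlgCat.{u} k)} (L : PreLieAlgebroid O) :
    Cᵒᵖ ⥤ Type u where
  obj U := L.sec U.unop
  map f := TypeCat.ofHom (fun x => L.res f.unop x)
  map_id U := by ext x; exact L.res_id _ x
  map_comp f g := by ext x; exact L.res_comp _ _ x

/-- A Lie algebroid on the ringed site `(C, T, O)`. -/
structure LieAlgebroid (O : Sheaf T (CommAlgCat.{u} k)) extends PreLieAlgebroid O where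
  isSheaf : Presieve.IsSheaf T toPreLieAlgebroid.toPresheaf

variable {O : Sheaf T (CommAlgCat.{u} k)}

namespace LieAlgebroid

/-- `L` is locally free of rank `d` over `O`: every object has a covering by objects `V` over which
`L` has a basis of `d` sections. -/
def IsLocallyFreeOfRank (L : LieAlgebroid O) (d : ℕ) : Prop :=
  ∀ U : C, ∃ S ∈ T U, ∀ ⦃V : C⦄ (f : V ⟶ U), S f →
    ∃ e : Fin d → L.sec V, ∀ ⦃W : C⦄ (g : W ⟶ V),
      LinearIndependent (fn O W) (fun i => L.res g (e i)) ∧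
      Submodule.span (fn O W) (Set.range fun i => L.res g (e i)) = ⊤

variable (L : LieAlgebroid O)

/-- The enveloping algebra of `(O(U), L(U))`. The sheaf `U_X L` is the sheafification of this
presheaf. -/
abbrev Env (U : C) : Type u := Envel k (fn O U) (L.sec U)

/-- Restriction of sections of the presheaf of enveloping algebras. -/
def envRes {U V : C} (f : V ⟶ U) : L.Env U →ₐ[k] L.Env V := Envel.map (fnRes O f) (L.res f)

theorem envRes_id (U : C) (D : L.Env U) : L.envRes (𝟙 U) D = D := by
  induction D using Envel.induction_left with
  | one => simp
  | add D E hD hE => rw [map_add, hD, hE]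
  | incl_mul a D hD => rw [map_mul, hD, envRes, Envel.map_incl, fnRes_id]
  | lie_mul x D hD => rw [map_mul, hD, envRes, Envel.map_lie, L.res_id]

theorem envRes_comp {U V W : C} (f : V ⟶ U) (g : W ⟶ V) (D : L.Env U) :
    L.envRes (g ≫ f) D = L.envRes g (L.envRes f D) := by
  induction D using Envel.induction_left with
  | one => simp
  | add D E hD hE => simp only [map_add, hD, hE]
  | incl_mul a D hD =>
    rw [map_mul, map_mul, map_mul, hD]
    simp only [envRes, Envel.map_incl, fnRes_comp]
  | lie_mul x D hD =>
    rw [map_mul, map_mul, map_mul, hD]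
    simp only [envRes, Envel.map_lie, L.res_comp]

/-- Restriction of sections of the presheaf of enveloping algebras, as a semilinear map. -/
abbrev envResₛₗ {U V : C} (f : V ⟶ U) :
    L.Env U →ₛₗ[(fnRes O f : fn O U →+* fn O V)] L.Env V := Envel.mapₛₗ (fnRes O f) (L.res f)

/-- The sections over `U` of the sheaf `J = Hom_O(U_X L, O)` of jets, as compatible families of
`O(V)`-linear maps indexed by the `V ⟶ U`, with the product
`(α β)(D) = ∑ α(D₍₁₎) β(D₍₂₎)`. -/
def jetSubring (U : C) :
    Subring (∀ (V : C) (_ : V ⟶ U), WithConv (L.Env V →ₗ[fn O V] fn O V)) where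
  carrier := {α | ∀ ⦃V W : C⦄ (f : V ⟶ U) (g : W ⟶ V) (D : L.Env V),
    (α W (g ≫ f)).ofConv (L.envRes g D) = fnRes O g ((α V f).ofConv D)}
  one_mem' V W f g D := by
    change Coalgebra.counit (R := fn O W) (L.envRes g D)
      = fnRes O g (Coalgebra.counit (R := fn O V) D)
    rw [envRes, Envel.counit_map]
  zero_mem' V W f g D := (map_zero (fnRes O g)).symm
  add_mem' {α β} hα hβ V W f g D :=
    (congr_arg₂ (· + ·) (hα f g D) (hβ f g D)).trans (map_add (fnRes O g) _ _).symm
  neg_mem' {α} hα V W f g D :=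
    (congr_arg (- ·) (hα f g D)).trans (map_neg (fnRes O g) _).symm
  mul_mem' {α β} hα hβ V W f g D := by
    change LinearMap.mul' _ _ (TensorProduct.map (α W (g ≫ f)).ofConv (β W (g ≫ f)).ofConv
        (Coalgebra.comul (R := fn O W) (L.envRes g D)))
      = fnRes O g (LinearMap.mul' _ _ (TensorProduct.map (α V f).ofConv (β V f).ofConv
        (Coalgebra.comul (R := fn O V) D)))
    rw [envRes, Envel.comul_map]
    generalize Coalgebra.comul (R := fn O V) D = z
    induction z with
    | zero => simp
    | tmul D E =>
      have h₁ := hα f g D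
      have h₂ := hβ f g E
      rw [envRes] at h₁ h₂
      simp [h₁, h₂]
    | add z w hz hw => simp only [map_add, hz, hw]

/-- The sections over `U` of the sheaf of jets. -/
def Jet (U : C) : Type u := L.jetSubring U

instance (U : C) : CommRing (L.Jet U) := inferInstanceAs (CommRing (L.jetSubring U))

namespace Jet

variable {L}

/-- The value of a jet over `U` on a section of the enveloping algebra over `V ⟶ U`. -/
def eval {U V : C} (α : L.Jet U) (f : V ⟶ U) : L.Env V →ₗ[fn O V] fn O V := (α.1 V f).ofConv

theorem eval_res {U V W : C} (α : L.Jet U) (f : V ⟶ U) (g : W ⟶ V) (D : L.Env V) :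
    α.eval (g ≫ f) (L.envRes g D) = fnRes O g (α.eval f D) := α.2 f g D

/-- The jet given by a compatible family. -/
def ofFamily {U : C} (φ : ∀ (V : C) (_ : V ⟶ U), L.Env V →ₗ[fn O V] fn O V)
    (h : ∀ ⦃V W : C⦄ (f : V ⟶ U) (g : W ⟶ V) (D : L.Env V),
      φ W (g ≫ f) (L.envRes g D) = fnRes O g (φ V f D)) : L.Jet U :=
  ⟨fun V f => WithConv.toConv (φ V f), h⟩

@[simp] theorem eval_ofFamily {U V : C} (φ : ∀ (V : C) (_ : V ⟶ U), L.Env V →ₗ[fn O V] fn O V)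
    (h) (f : V ⟶ U) : (ofFamily φ h : L.Jet U).eval f = φ V f := rfl

theorem ext {U : C} {α β : L.Jet U} (h : ∀ (V : C) (f : V ⟶ U) (D : L.Env V),
    α.eval f D = β.eval f D) : α = β :=
  Subtype.ext (funext fun V => funext fun f => WithConv.ofConv_injective
    (LinearMap.ext fun D => h V f D))

theorem eval_add {U V : C} (α β : L.Jet U) (f : V ⟶ U) (D : L.Env V) :
    (α + β).eval f D = α.eval f D + β.eval f D := rfl

theorem eval_one {U V : C} (f : V ⟶ U) (D : L.Env V) :
    (1 : L.Jet U).eval f D = Coalgebra.counit (R := fn O V) D := rfl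

theorem eval_mul {U V : C} (α β : L.Jet U) (f : V ⟶ U) (D : L.Env V) :
    (α * β).eval f D = LinearMap.mul' (fn O V) (fn O V) (TensorProduct.map (α.eval f) (β.eval f)
      (Coalgebra.comul (R := fn O V) D)) := rfl

/-- The `O(U)`-algebra structure: `a` is sent to `a • 1`, that is, to `D ↦ a ε(D)`. -/
def unit (U : C) : fn O U →+* L.Jet U where
  toFun a := ofFamily
    (fun V f => (fnRes O f a) • (Coalgebra.counit (R := fn O V) (A := L.Env V)))
    (fun V W f g D => by
      rw [fnRes_comp, LinearMap.smul_apply, LinearMap.smul_apply, smul_eq_mul, smul_eq_mul,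
        map_mul, envRes, Envel.counit_map])
  map_one' := ext fun V f D => by
    rw [eval_ofFamily, eval_one, map_one, one_smul]
  map_zero' := ext fun V f D => by
    rw [eval_ofFamily, map_zero, zero_smul]; rfl
  map_add' a b := ext fun V f D => by
    rw [eval_add, eval_ofFamily, eval_ofFamily, eval_ofFamily, map_add, add_smul,
      LinearMap.add_apply]
  map_mul' a b := ext fun V f D => by
    rw [eval_mul, eval_ofFamily, eval_ofFamily, eval_ofFamily, TensorProduct.map_smul_left,
      TensorProduct.map_smul_right, map_mul, mul_smul]
    have h := eval_mul (1 : L.Jet U) 1 f D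
    rw [mul_one, eval_one] at h
    simp only [LinearMap.smul_apply, map_smul, h]
    rfl

instance (U : C) : Algebra (fn O U) (L.Jet U) := (unit U).toAlgebra

theorem algebraMap_eval {U V : C} (a : fn O U) (f : V ⟶ U) (D : L.Env V) :
    (algebraMap (fn O U) (L.Jet U) a).eval f D
      = fnRes O f a * Coalgebra.counit (R := fn O V) D := rfl

/-- Restriction of jets. -/
def res {U V : C} (f : V ⟶ U) : L.Jet U →+* L.Jet V where
  toFun α := ofFamily (fun _ g => α.eval (g ≫ f))
    (fun _ _ g h D => by rw [Category.assoc]; exact α.eval_res (g ≫ f) h D)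
  map_one' := rfl
  map_zero' := rfl
  map_add' _ _ := rfl
  map_mul' _ _ := rfl

@[simp] theorem res_eval {U V W : C} (f : V ⟶ U) (g : W ⟶ V) (α : L.Jet U) :
    (res f α).eval g = α.eval (g ≫ f) := rfl

theorem res_id (U : C) (α : L.Jet U) : res (𝟙 U) α = α :=
  ext fun V f D => by rw [res_eval, Category.comp_id]

theorem res_comp {U V W : C} (f : V ⟶ U) (g : W ⟶ V) (α : L.Jet U) :
    res (g ≫ f) α = res g (res f α) :=
  ext fun V h D => by rw [res_eval, res_eval, res_eval, Category.assoc]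

theorem res_algebraMap {U V : C} (f : V ⟶ U) (a : fn O U) :
    res f (algebraMap (fn O U) (L.Jet U) a) = algebraMap (fn O V) (L.Jet V) (fnRes O f a) :=
  ext fun W g D => by rw [res_eval, algebraMap_eval, algebraMap_eval, fnRes_comp]

/-- The counit `ε : J → O`, `α ↦ α(1)`. -/
def counit (U : C) : L.Jet U →ₐ[fn O U] fn O U where
  toFun α := α.eval (𝟙 U) 1
  map_one' := by rw [eval_one, Envel.counit_one]
  map_zero' := rfl
  map_add' _ _ := rfl
  map_mul' α β := by rw [eval_mul, Envel.comul_one]; simp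
  commutes' a := by rw [algebraMap_eval, Envel.counit_one, mul_one, fnRes_id]; rfl

theorem counit_res {U V : C} (f : V ⟶ U) (α : L.Jet U) :
    counit V (res f α) = fnRes O f (counit U α) := by
  have h := α.eval_res (𝟙 U) f 1
  rw [map_one, Category.comp_id] at h
  change α.eval (𝟙 V ≫ f) 1 = _
  rw [Category.id_comp]
  exact h

/-- The action `²∇` of the enveloping algebra on jets: `(²∇_E α)(D) = α(D E)`. -/
def nabla {U : C} (E : L.Env U) (α : L.Jet U) : L.Jet U :=
  ofFamily
    (fun V f => (α.eval f).comp (Envel.mulRight (L.envRes f E)))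
    (fun V W f g D => by
      simp only [LinearMap.comp_apply, Envel.mulRight_apply]
      rw [envRes_comp, ← map_mul, eval_res])

theorem nabla_eval {U V : C} (E : L.Env U) (α : L.Jet U) (f : V ⟶ U) (D : L.Env V) :
    (nabla E α).eval f D = α.eval f (D * L.envRes f E) := rfl

/-- The sections over `U` of the ideal `Jᶜ`, the kernel of the counit. -/
def augIdeal (L : LieAlgebroid O) (U : C) : Ideal (L.Jet U) := RingHom.ker (counit (L := L) U)

end Jet

end LieAlgebroid

end Algebroids

/-! ### Sheaves of abelian groups -/

section Sheaves

variable {C : Type u} [SmallCategory C] (T : GrothendieckTopology C)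

/-- Restriction of sections of a presheaf of abelian groups. -/
abbrev rs (F : Cᵒᵖ ⥤ AddCommGrpCat.{u}) {U V : C} (f : V ⟶ U) :
    F.obj (op U) →+ F.obj (op V) := (F.map f.op).hom

/-- The sheafification of a presheaf of abelian groups. -/
abbrev shf (P : Cᵒᵖ ⥤ AddCommGrpCat.{u}) : Sheaf T AddCommGrpCat.{u} :=
  (presheafToSheaf T AddCommGrpCat.{u}).obj P

/-- The canonical map from sections of a presheaf to sections of its sheafification. -/
def toShf (P : Cᵒᵖ ⥤ AddCommGrpCat.{u}) (U : C) : P.obj (op U) →+ (shf T P).obj.obj (op U) :=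
  ((toSheafify T P).app (op U)).hom

variable {T}

theorem rs_id (F : Cᵒᵖ ⥤ AddCommGrpCat.{u}) (U : C) (x : F.obj (op U)) : rs F (𝟙 U) x = x := by
  simp [rs]

theorem rs_comp (F : Cᵒᵖ ⥤ AddCommGrpCat.{u}) {U V W : C} (f : V ⟶ U) (g : W ⟶ V)
    (x : F.obj (op U)) : rs F (g ≫ f) x = rs F g (rs F f x) := by
  simp [rs]

theorem rs_nat {F G : Cᵒᵖ ⥤ AddCommGrpCat.{u}} (φ : F ⟶ G) {U V : C} (f : V ⟶ U)
    (x : F.obj (op U)) : rs G f ((φ.app (op U)).hom x) = (φ.app (op V)).hom (rs F f x) :=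
  (ConcreteCategory.congr_hom (φ.naturality f.op) x).symm

theorem rs_toShf (P : Cᵒᵖ ⥤ AddCommGrpCat.{u}) {U V : C} (f : V ⟶ U) (a : P.obj (op U)) :
    rs (shf T P).obj f (toShf T P U a) = toShf T P V (rs P f a) :=
  rs_nat (toSheafify T P) f a

theorem isSheafType (F : Sheaf T AddCommGrpCat.{u}) :
    Presieve.IsSheaf T (F.obj ⋙ forget AddCommGrpCat.{u}) :=
  (isSheaf_iff_isSheaf_of_type _ _).1 ((Presheaf.isSheaf_iff_isSheaf_forget T F.obj
    (forget AddCommGrpCat.{u})).1 F.property)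

theorem sep (F : Sheaf T AddCommGrpCat.{u}) {U : C} {S : Sieve U} (hS : S ∈ T U)
    {x y : F.obj.obj (op U)} (h : ∀ ⦃V : C⦄ (f : V ⟶ U), S f → rs F.obj f x = rs F.obj f y) :
    x = y :=
  ((isSheafType F).isSeparated S hS).ext h

theorem toShf_locally (P : Cᵒᵖ ⥤ AddCommGrpCat.{u}) {U : C} (x : (shf T P).obj.obj (op U)) :
    ∃ S ∈ T U, ∀ ⦃V : C⦄ (f : V ⟶ U), S f → ∃ a, toShf T P V a = rs (shf T P).obj f x := by
  have := Presheaf.isLocallySurjective_toSheafify' T P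
  exact ⟨_, Presheaf.imageSieve_mem T (toSheafify T P) x, fun V f hf => hf⟩

theorem toShf_locally_inj (P : Cᵒᵖ ⥤ AddCommGrpCat.{u}) {U : C} {a b : P.obj (op U)}
    (h : toShf T P U a = toShf T P U b) :
    ∃ S ∈ T U, ∀ ⦃V : C⦄ (f : V ⟶ U), S f → rs P f a = rs P f b := by
  have := Presheaf.isLocallyInjective_toSheafify' T P
  exact ⟨_, Presheaf.equalizerSieve_mem T (toSheafify T P) a b h, fun V f hf => hf⟩

theorem exists_glue (F : Sheaf T AddCommGrpCat.{u}) {U : C} {S : Sieve U} (hS : S ∈ T U)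
    (s : ∀ ⦃V : C⦄ (f : V ⟶ U), S f → F.obj.obj (op V))
    (hs : ∀ ⦃V W : C⦄ (f : V ⟶ U) (hf : S f) (g : W ⟶ V),
      s (g ≫ f) (S.downward_closed hf g) = rs F.obj g (s f hf)) :
    ∃ z : F.obj.obj (op U), ∀ ⦃V : C⦄ (f : V ⟶ U) (hf : S f), rs F.obj f z = s f hf := by
  obtain ⟨z, hz, -⟩ := isSheafType F S hS s
    ((Presieve.compatible_iff_sieveCompatible _).2 fun V W f g hf => hs f hf g)
  exact ⟨z, fun V f hf => hz f hf⟩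

section biext

variable {P Q : Cᵒᵖ ⥤ AddCommGrpCat.{u}} {F : Sheaf T AddCommGrpCat.{u}}
  (μ : ∀ U : C, P.obj (op U) →+ Q.obj (op U) →+ F.obj.obj (op U))

theorem biext_aux (hμ : ∀ ⦃U V : C⦄ (f : V ⟶ U) (a : P.obj (op U)) (b : Q.obj (op U)),
    rs F.obj f (μ U a b) = μ V (rs P f a) (rs Q f b))
    {U : C} {a a' : P.obj (op U)} {b b' : Q.obj (op U)}
    (ha : toShf T P U a = toShf T P U a') (hb : toShf T Q U b = toShf T Q U b') :
    μ U a b = μ U a' b' := by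
  obtain ⟨S, hS, h⟩ := toShf_locally_inj P ha
  obtain ⟨S', hS', h'⟩ := toShf_locally_inj Q hb
  exact sep F (T.intersection_covering hS hS') fun V f hf => by
    rw [hμ, hμ, h f hf.1, h' f hf.2]

theorem biext_exists (hμ : ∀ ⦃U V : C⦄ (f : V ⟶ U) (a : P.obj (op U)) (b : Q.obj (op U)),
    rs F.obj f (μ U a b) = μ V (rs P f a) (rs Q f b))
    {U : C} (x : (shf T P).obj.obj (op U)) (y : (shf T Q).obj.obj (op U)) :
    ∃ z : F.obj.obj (op U), ∀ ⦃V : C⦄ (f : V ⟶ U) a b, toShf T P V a = rs (shf T P).obj f x →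
      toShf T Q V b = rs (shf T Q).obj f y → rs F.obj f z = μ V a b := by
  obtain ⟨S, hS, h⟩ := toShf_locally P x
  obtain ⟨S', hS', h'⟩ := toShf_locally Q y
  choose! a ha using h
  choose! b hb using h'
  have hSS := T.intersection_covering hS hS'
  obtain ⟨z, hz⟩ := exists_glue F hSS (fun V f _ => μ V (a f) (b f)) (fun V W f hf g => by
    rw [hμ]
    apply biext_aux μ hμ
    · rw [ha _ (S.downward_closed hf.1 g), rs_comp, ← ha _ hf.1, rs_toShf]
    · rw [hb _ (S'.downward_closed hf.2 g), rs_comp, ← hb _ hf.2, rs_toShf])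
  refine ⟨z, fun V f a' b' ha' hb' => sep F (T.pullback_stable f hSS) fun W g hg => ?_⟩
  rw [← rs_comp, hz _ hg, hμ]
  apply biext_aux μ hμ
  · rw [ha _ hg.1, rs_comp, ← ha', rs_toShf]
  · rw [hb _ hg.2, rs_comp, ← hb', rs_toShf]

/-- The unique extension to sheafifications of a biadditive map with values in a sheaf. -/
def biext (hμ : ∀ ⦃U V : C⦄ (f : V ⟶ U) (a : P.obj (op U)) (b : Q.obj (op U)),
    rs F.obj f (μ U a b) = μ V (rs P f a) (rs Q f b))
    (U : C) : (shf T P).obj.obj (op U) →+ (shf T Q).obj.obj (op U) →+ F.obj.obj (op U) :=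
  AddMonoidHom.mk' (fun x => AddMonoidHom.mk' (fun y => (biext_exists μ hμ x y).choose)
    (fun y y' => by
      obtain ⟨S, hS, hx⟩ := toShf_locally P x
      obtain ⟨S₁, hS₁, hy⟩ := toShf_locally Q y
      obtain ⟨S₂, hS₂, hy'⟩ := toShf_locally Q y'
      refine sep F (T.intersection_covering hS (T.intersection_covering hS₁ hS₂)) fun V f hf => ?_
      obtain ⟨a, ha⟩ := hx f hf.1
      obtain ⟨b, hb⟩ := hy f hf.2.1
      obtain ⟨b', hb'⟩ := hy' f hf.2.2
      rw [map_add, (biext_exists μ hμ x y).choose_spec f a b ha hb,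
        (biext_exists μ hμ x y').choose_spec f a b' ha hb',
        (biext_exists μ hμ x (y + y')).choose_spec f a (b + b') ha (by rw [map_add, map_add, hb, hb']),
        map_add]))
    (fun x x' => by
      ext y
      obtain ⟨S, hS, hy⟩ := toShf_locally Q y
      obtain ⟨S₁, hS₁, hx⟩ := toShf_locally P x
      obtain ⟨S₂, hS₂, hx'⟩ := toShf_locally P x'
      refine sep F (T.intersection_covering hS (T.intersection_covering hS₁ hS₂)) fun V f hf => ?_
      obtain ⟨b, hb⟩ := hy f hf.1
      obtain ⟨a, ha⟩ := hx f hf.2.1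
      obtain ⟨a', ha'⟩ := hx' f hf.2.2
      rw [AddMonoidHom.add_apply, map_add]
      simp only [AddMonoidHom.mk'_apply]
      rw [(biext_exists μ hμ x y).choose_spec f a b ha hb,
        (biext_exists μ hμ x' y).choose_spec f a' b ha' hb,
        (biext_exists μ hμ (x + x') y).choose_spec f (a + a') b
          (by rw [map_add, map_add, ha, ha']) hb, map_add, AddMonoidHom.add_apply])

theorem biext_spec (hμ : ∀ ⦃U V : C⦄ (f : V ⟶ U) (a : P.obj (op U)) (b : Q.obj (op U)),
    rs F.obj f (μ U a b) = μ V (rs P f a) (rs Q f b))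
    {U V : C} (f : V ⟶ U) (x : (shf T P).obj.obj (op U))
    (y : (shf T Q).obj.obj (op U)) {a b} (ha : toShf T P V a = rs (shf T P).obj f x)
    (hb : toShf T Q V b = rs (shf T Q).obj f y) :
    rs F.obj f (biext μ hμ U x y) = μ V a b :=
  (biext_exists μ hμ x y).choose_spec f a b ha hb

theorem biext_toShf (hμ : ∀ ⦃U V : C⦄ (f : V ⟶ U) (a : P.obj (op U)) (b : Q.obj (op U)),
    rs F.obj f (μ U a b) = μ V (rs P f a) (rs Q f b))
    (U : C) (a : P.obj (op U)) (b : Q.obj (op U)) :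
    biext μ hμ U (toShf T P U a) (toShf T Q U b) = μ U a b := by
  have h := biext_spec μ hμ (𝟙 U) (toShf T P U a) (toShf T Q U b) (a := a) (b := b)
    (by rw [rs_id]) (by rw [rs_id])
  rwa [rs_id] at h

theorem rs_biext (hμ : ∀ ⦃U V : C⦄ (f : V ⟶ U) (a : P.obj (op U)) (b : Q.obj (op U)),
    rs F.obj f (μ U a b) = μ V (rs P f a) (rs Q f b))
    {U V : C} (f : V ⟶ U) (x : (shf T P).obj.obj (op U))
    (y : (shf T Q).obj.obj (op U)) :
    rs F.obj f (biext μ hμ U x y)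
      = biext μ hμ V (rs (shf T P).obj f x) (rs (shf T Q).obj f y) := by
  obtain ⟨S, hS, hx⟩ := toShf_locally P (rs (shf T P).obj f x)
  obtain ⟨S', hS', hy⟩ := toShf_locally Q (rs (shf T Q).obj f y)
  refine sep F (T.intersection_covering hS hS') fun W g hg => ?_
  obtain ⟨a, ha⟩ := hx g hg.1
  obtain ⟨b, hb⟩ := hy g hg.2
  rw [biext_spec μ hμ g _ _ ha hb, ← rs_comp]
  exact biext_spec μ hμ (g ≫ f) x y (by rw [ha, rs_comp]) (by rw [hb, rs_comp])

end biext

end Sheaves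

/-! ### The completed bar complex -/

namespace LieAlgebroid

section BarComplex

variable {C : Type u} [SmallCategory C] {T : GrothendieckTopology C} {k : Type u} [Field k]
  {O : Sheaf T (CommAlgCat.{u} k)} (L : LieAlgebroid O)

open Jet

/-- Sections over `U` of the presheaf quotient `J / (Jᶜ)^(q + 1)`. -/
abbrev JetQ (q : ℕ) (U : C) : Type u := L.Jet U ⧸ (augIdeal L U) ^ (q + 1)

theorem augIdeal_pow_le {U V : C} (f : V ⟶ U) (q : ℕ) :
    (augIdeal L U) ^ q ≤ ((augIdeal L V) ^ q).comap (Jet.res f) := by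
  have h : augIdeal L U ≤ (augIdeal L V).comap (Jet.res f) := fun α hα => by
    change counit V (Jet.res f α) = 0
    rw [counit_res, show counit U α = 0 from hα, map_zero]
  exact (Ideal.pow_right_mono h q).trans (Ideal.le_comap_pow _ q)

/-- Restriction on `J / (Jᶜ)^(q + 1)`. -/
def jetQRes (q : ℕ) {U V : C} (f : V ⟶ U) : L.JetQ q U →+* L.JetQ q V :=
  Ideal.quotientMap _ (Jet.res f) (L.augIdeal_pow_le f (q + 1))

@[simp] theorem jetQRes_mk (q : ℕ) {U V : C} (f : V ⟶ U) (α : L.Jet U) :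
    L.jetQRes q f (Ideal.Quotient.mk _ α) = Ideal.Quotient.mk _ (Jet.res f α) := rfl

theorem jetQRes_algebraMap (q : ℕ) {U V : C} (f : V ⟶ U) (a : fn O U) :
    L.jetQRes q f (algebraMap (fn O U) (L.JetQ q U) a)
      = algebraMap (fn O V) (L.JetQ q V) ((fnRes O f : fn O U →+* fn O V) a) := by
  change L.jetQRes q f (Ideal.Quotient.mk _ (algebraMap (fn O U) (L.Jet U) a)) = _
  rw [jetQRes_mk, res_algebraMap]; rfl

/-- The projection `J / (Jᶜ)^(q + 2) → J / (Jᶜ)^(q + 1)`. -/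
def jetQProj (q : ℕ) (U : C) : L.JetQ (q + 1) U →+* L.JetQ q U :=
  Ideal.Quotient.factor (Ideal.pow_le_pow_right (Nat.le_succ (q + 1)))

@[simp] theorem jetQProj_mk (q : ℕ) (U : C) (α : L.Jet U) :
    L.jetQProj q U (Ideal.Quotient.mk _ α) = Ideal.Quotient.mk _ α := rfl

/-- The counit `J / (Jᶜ)^(q + 1) → O`. -/
def counitQ (q : ℕ) (U : C) : L.JetQ q U →ₐ[fn O U] fn O U :=
  Ideal.Quotient.liftₐ _ (counit U) fun _ hα => Ideal.pow_le_self (Nat.succ_ne_zero q) hα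

@[simp] theorem counitQ_mk (q : ℕ) (U : C) (α : L.Jet U) :
    L.counitQ q U (Ideal.Quotient.mk _ α) = counit U α := rfl

theorem counitQ_jetQRes (q : ℕ) {U V : C} (f : V ⟶ U) (α : L.JetQ q U) :
    L.counitQ q V (L.jetQRes q f α) = (fnRes O f : fn O U →+* fn O V) (L.counitQ q U α) := by
  obtain ⟨α, rfl⟩ := Ideal.Quotient.mk_surjective α
  rw [jetQRes_mk, counitQ_mk, counitQ_mk, counit_res]; rfl

/-- Restriction on `(J / (Jᶜ)^(q + 1))^{⊗ p + 1}`. -/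
abbrev barRes (p q : ℕ) {U V : C} (f : V ⟶ U) :
    TPow (fn O U) (L.JetQ q U) (p + 1) →ₛₗ[(fnRes O f : fn O U →+* fn O V)]
      TPow (fn O V) (L.JetQ q V) (p + 1) :=
  tensMap (semilin (L.jetQRes q f) (L.jetQRes_algebraMap q f))

theorem barRes_id (p q : ℕ) (U : C) (x : TPow (fn O U) (L.JetQ q U) (p + 1)) :
    L.barRes p q (𝟙 U) x = x := by
  induction x using PiTensorProduct.induction_on with
  | smul_tprod r m =>
    rw [LinearMap.map_smulₛₗ, tensMap_tprod]
    congr 1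
    · exact fnRes_id O U r
    · congr 1; funext i
      obtain ⟨α, hα⟩ := Ideal.Quotient.mk_surjective (m i)
      rw [← hα, semilin_apply, jetQRes_mk, res_id]
  | add x y hx hy => rw [map_add, hx, hy]

theorem barRes_comp (p q : ℕ) {U V W : C} (f : V ⟶ U) (g : W ⟶ V)
    (x : TPow (fn O U) (L.JetQ q U) (p + 1)) :
    L.barRes p q (g ≫ f) x = L.barRes p q g (L.barRes p q f x) := by
  induction x using PiTensorProduct.induction_on with
  | smul_tprod r m =>
    rw [LinearMap.map_smulₛₗ, LinearMap.map_smulₛₗ, LinearMap.map_smulₛₗ, tensMap_tprod,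
      tensMap_tprod, tensMap_tprod]
    congr 1
    · exact fnRes_comp O f g r
    · congr 1; funext i
      obtain ⟨α, hα⟩ := Ideal.Quotient.mk_surjective (m i)
      rw [← hα, semilin_apply, semilin_apply, semilin_apply, jetQRes_mk, jetQRes_mk, jetQRes_mk,
        Jet.res_comp]
  | add x y hx hy => simp only [map_add, hx, hy]

/-- The presheaf `(J / (Jᶜ)^(q + 1))^{⊗ p + 1}`. -/
def barPre (p q : ℕ) : Cᵒᵖ ⥤ AddCommGrpCat.{u} where
  obj U := AddCommGrpCat.of (TPow (fn O U.unop) (L.JetQ q U.unop) (p + 1))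
  map f := AddCommGrpCat.ofHom (L.barRes p q f.unop : _ →+ _)
  map_id U := by ext x; exact L.barRes_id p q U.unop x
  map_comp f g := by ext x; exact L.barRes_comp p q f.unop g.unop x

/-- The projections between the levels `q + 1` and `q`, on presheaf tensors. -/
def tensProj (p q : ℕ) (U : C) : TPow (fn O U) (L.JetQ (q + 1) U) (p + 1) →ₗ[fn O U]
    TPow (fn O U) (L.JetQ q U) (p + 1) :=
  tensMap (σ := RingHom.id (fn O U)) (semilin (L.jetQProj q U) (fun _ => rfl))

/-- The projections between the levels `q + 1` and `q`. -/
def barProj (p q : ℕ) : L.barPre p (q + 1) ⟶ L.barPre p q where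
  app U := AddCommGrpCat.ofHom (L.tensProj p q U.unop).toAddMonoidHom
  naturality U V f := by
    ext x
    change L.tensProj p q V.unop (L.barRes p (q + 1) f.unop x)
      = L.barRes p q f.unop (L.tensProj p q U.unop x)
    induction x using PiTensorProduct.induction_on with
    | smul_tprod r m =>
      simp only [tensProj, LinearMap.map_smulₛₗ, tensMap_tprod, RingHom.id_apply]
      congr 2; funext i
      obtain ⟨α, hα⟩ := Ideal.Quotient.mk_surjective (m i)
      rw [← hα]; rfl
    | add x y hx hy => simp only [map_add, hx, hy]

/-- The bar differential on the level `q`. -/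
def barDPre (p q : ℕ) : L.barPre (p + 1) q ⟶ L.barPre p q where
  app U := AddCommGrpCat.ofHom
    (barD (fn O U.unop) (L.counitQ q U.unop) p : _ →+ _)
  naturality U V f := by
    ext x
    exact (tensMap_barD (L.jetQRes q f.unop) (L.jetQRes_algebraMap q f.unop) _ _
      (L.counitQ_jetQRes q f.unop) p x).symm

theorem counitQ_jetQProj (q : ℕ) (U : C) (α : L.JetQ (q + 1) U) :
    L.counitQ q U (L.jetQProj q U α) = L.counitQ (q + 1) U α := by
  obtain ⟨α, rfl⟩ := Ideal.Quotient.mk_surjective α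
  rw [jetQProj_mk, counitQ_mk, counitQ_mk]

theorem tensProj_barD (p q : ℕ) (U : C) (x : TPow (fn O U) (L.JetQ (q + 1) U) (p + 2)) :
    L.tensProj p q U (barD (fn O U) (L.counitQ (q + 1) U) p x)
      = barD (fn O U) (L.counitQ q U) p (L.tensProj (p + 1) q U x) :=
  tensMap_barD (σ := RingHom.id (fn O U)) (L.jetQProj q U) _
    (L.counitQ (q + 1) U) (L.counitQ q U) (L.counitQ_jetQProj q U) p x

theorem barDPre_proj (p q : ℕ) :
    L.barDPre p (q + 1) ≫ L.barProj p q = L.barProj (p + 1) q ≫ L.barDPre p q := by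
  ext U x
  exact L.tensProj_barD p q U.unop x

/-- The sheaf `(J / (Jᶜ)^(q + 1))^{⊗ p + 1}`. -/
abbrev barLevel (p q : ℕ) : Sheaf T AddCommGrpCat.{u} := shf T (L.barPre p q)

theorem shf_map_toShf {P Q : Cᵒᵖ ⥤ AddCommGrpCat.{u}} (φ : P ⟶ Q) (U : C) (a : P.obj (op U)) :
    (((presheafToSheaf T AddCommGrpCat.{u}).map φ).hom.app (op U)).hom (toShf T P U a)
      = toShf T Q U ((φ.app (op U)).hom a) := by
  have := toSheafify_naturality T φ
  exact (ConcreteCategory.congr_hom (NatTrans.congr_app this (op U)) a).symm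

/-- The canonical map from presheaf tensors to sections of the sheaf. -/
def toLevel (p q : ℕ) (U : C) :
    TPow (fn O U) (L.JetQ q U) (p + 1) →+ (L.barLevel p q).obj.obj (op U) :=
  toShf T (L.barPre p q) U

theorem rs_toLevel (p q : ℕ) {U V : C} (f : V ⟶ U) (x : TPow (fn O U) (L.JetQ q U) (p + 1)) :
    rs (L.barLevel p q).obj f (L.toLevel p q U x) = L.toLevel p q V (L.barRes p q f x) :=
  rs_toShf (L.barPre p q) f x

theorem toLevel_locally (p q : ℕ) {U : C} (x : (L.barLevel p q).obj.obj (op U)) :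
    ∃ S ∈ T U, ∀ ⦃V : C⦄ (f : V ⟶ U), S f →
      ∃ a, L.toLevel p q V a = rs (L.barLevel p q).obj f x :=
  toShf_locally (L.barPre p q) x

/-- The projections between the levels, on sections of the sheaves. -/
def levelProj (p q : ℕ) (U : C) :
    (L.barLevel p (q + 1)).obj.obj (op U) →+ (L.barLevel p q).obj.obj (op U) :=
  (((presheafToSheaf T AddCommGrpCat.{u}).map (L.barProj p q)).hom.app (op U)).hom

theorem levelProj_toLevel (p q : ℕ) (U : C) (x : TPow (fn O U) (L.JetQ (q + 1) U) (p + 1)) :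
    L.levelProj p q U (L.toLevel p (q + 1) U x) = L.toLevel p q U (L.tensProj p q U x) :=
  shf_map_toShf (L.barProj p q) U x

theorem rs_levelProj (p q : ℕ) {U V : C} (f : V ⟶ U) (x) :
    rs (L.barLevel p q).obj f (L.levelProj p q U x)
      = L.levelProj p q V (rs (L.barLevel p (q + 1)).obj f x) :=
  rs_nat ((presheafToSheaf T AddCommGrpCat.{u}).map (L.barProj p q)).hom f x

/-- The bar differential, on sections of the sheaves. -/
def levelD (p q : ℕ) (U : C) :
    (L.barLevel (p + 1) q).obj.obj (op U) →+ (L.barLevel p q).obj.obj (op U) :=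
  (((presheafToSheaf T AddCommGrpCat.{u}).map (L.barDPre p q)).hom.app (op U)).hom

theorem levelD_toLevel (p q : ℕ) (U : C) (x : TPow (fn O U) (L.JetQ q U) (p + 2)) :
    L.levelD p q U (L.toLevel (p + 1) q U x)
      = L.toLevel p q U (barD (fn O U) (L.counitQ q U) p x) :=
  shf_map_toShf (L.barDPre p q) U x

theorem rs_levelD (p q : ℕ) {U V : C} (f : V ⟶ U) (x) :
    rs (L.barLevel p q).obj f (L.levelD p q U x)
      = L.levelD p q V (rs (L.barLevel (p + 1) q).obj f x) :=
  rs_nat ((presheafToSheaf T AddCommGrpCat.{u}).map (L.barDPre p q)).hom f x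

theorem levelD_proj (p q : ℕ) (U : C) (x) :
    L.levelProj p q U (L.levelD p (q + 1) U x) = L.levelD p q U (L.levelProj (p + 1) q U x) := by
  have h := congr_arg (presheafToSheaf T AddCommGrpCat.{u}).map (L.barDPre_proj p q)
  rw [Functor.map_comp, Functor.map_comp] at h
  exact congr_arg (fun φ => (φ.hom.app (op U)).hom x) h

/-- The presheaf of abelian groups underlying the sheaf of jets. -/
def jetPre : Cᵒᵖ ⥤ AddCommGrpCat.{u} where
  obj U := AddCommGrpCat.of (L.Jet U.unop)
  map f := AddCommGrpCat.ofHom (Jet.res (L := L) f.unop).toAddMonoidHom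
  map_id U := by ext x; exact Jet.res_id (L := L) U.unop x
  map_comp f g := by ext x; exact Jet.res_comp (L := L) f.unop g.unop x

/-- The biadditive action of jets on the first factor. -/
def actPre (p q : ℕ) (U : C) :
    L.Jet U →+ TPow (fn O U) (L.JetQ q U) (p + 1) →+ (L.barLevel p q).obj.obj (op U) :=
  AddMonoidHom.mk' (fun j => (L.toLevel p q U).comp
      (actFirst (fn O U) p (Ideal.Quotient.mk _ j : L.JetQ q U)).toAddMonoidHom)
    (fun j j' => AddMonoidHom.ext fun x => by
      change L.toLevel p q U (actFirst (fn O U) p (Ideal.Quotient.mk _ (j + j')) x)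
        = L.toLevel p q U (actFirst (fn O U) p (Ideal.Quotient.mk _ j) x)
          + L.toLevel p q U (actFirst (fn O U) p (Ideal.Quotient.mk _ j') x)
      rw [map_add, map_add, LinearMap.add_apply, map_add])

theorem rs_actPre (p q : ℕ) ⦃U V : C⦄ (f : V ⟶ U) (j : L.Jet U)
    (x : TPow (fn O U) (L.JetQ q U) (p + 1)) :
    rs (L.barLevel p q).obj f (L.actPre p q U j x)
      = L.actPre p q V (Jet.res f j) (L.barRes p q f x) :=
  (L.rs_toLevel p q f _).trans (congr_arg (L.toLevel p q V)
    (tensMap_actFirst (L.jetQRes q f) (L.jetQRes_algebraMap q f) p (Ideal.Quotient.mk _ j) x))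

/-- The action of jets on the first factor. -/
def levelAct (p q : ℕ) (U : C) (j : L.Jet U) :
    (L.barLevel p q).obj.obj (op U) →+ (L.barLevel p q).obj.obj (op U) :=
  biext (P := L.jetPre) (Q := L.barPre p q) (F := L.barLevel p q)
    (L.actPre p q) (L.rs_actPre p q) U (toShf T L.jetPre U j)

theorem levelAct_toLevel (p q : ℕ) (U : C) (j : L.Jet U)
    (x : TPow (fn O U) (L.JetQ q U) (p + 1)) :
    L.levelAct p q U j (L.toLevel p q U x)
      = L.toLevel p q U (actFirst (fn O U) p (Ideal.Quotient.mk _ j : L.JetQ q U) x) :=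
  biext_toShf (P := L.jetPre) (Q := L.barPre p q) (F := L.barLevel p q) _ _ _ _ _

theorem rs_levelAct (p q : ℕ) {U V : C} (f : V ⟶ U) (j : L.Jet U) (x) :
    rs (L.barLevel p q).obj f (L.levelAct p q U j x)
      = L.levelAct p q V (Jet.res f j) (rs (L.barLevel p q).obj f x) :=
  (rs_biext (P := L.jetPre) (Q := L.barPre p q) (F := L.barLevel p q) (L.actPre p q)
    (L.rs_actPre p q) f (toShf T L.jetPre U j) x).trans
    (congr_arg (fun z => biext (P := L.jetPre) (Q := L.barPre p q) (F := L.barLevel p q)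
      (L.actPre p q) (L.rs_actPre p q) V z (rs (L.barLevel p q).obj f x))
      (rs_toShf L.jetPre f j))

theorem levelProj_levelAct (p q : ℕ) (U : C) (j : L.Jet U) (x) :
    L.levelProj p q U (L.levelAct p (q + 1) U j x)
      = L.levelAct p q U j (L.levelProj p q U x) := by
  obtain ⟨S, hS, h⟩ := L.toLevel_locally p (q + 1) x
  refine sep _ hS fun V f hf => ?_
  obtain ⟨a, ha⟩ := h f hf
  rw [rs_levelProj, rs_levelAct, rs_levelAct, rs_levelProj, ← ha, levelAct_toLevel,
    levelProj_toLevel, levelProj_toLevel, levelAct_toLevel]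
  exact congr_arg _ (tensMap_actFirst (σ := RingHom.id (fn O V)) (L.jetQProj q V) (fun _ => rfl) p
    (Ideal.Quotient.mk _ (Jet.res f j)) a)

theorem levelD_levelAct (p q : ℕ) (U : C) (j : L.Jet U) (x) :
    L.levelD p q U (L.levelAct (p + 1) q U j x) = L.levelAct p q U j (L.levelD p q U x) := by
  obtain ⟨S, hS, h⟩ := L.toLevel_locally (p + 1) q x
  refine sep _ hS fun V f hf => ?_
  obtain ⟨a, ha⟩ := h f hf
  rw [rs_levelD, rs_levelAct, rs_levelAct, rs_levelD, ← ha, levelAct_toLevel, levelD_toLevel,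
    levelD_toLevel, levelAct_toLevel, barD_actFirst]

/-- The sections over `U` of `B_p`, the completed tensor power `J^{⊗ p + 1}`: the compatible
sequences of sections of the sheaves `(J / (Jᶜ)^(q + 1))^{⊗ p + 1}`. -/
def Bar (p : ℕ) (U : C) : AddSubgroup (∀ q, (L.barLevel p q).obj.obj (op U)) where
  carrier := {x | ∀ q, L.levelProj p q U (x (q + 1)) = x q}
  zero_mem' q := map_zero _
  add_mem' hx hy q := (map_add _ _ _).trans (congr_arg₂ _ (hx q) (hy q))
  neg_mem' hx q := (map_neg _ _).trans (congr_arg _ (hx q))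

namespace Bar

variable {L}

theorem ext {p : ℕ} {U : C} {x y : L.Bar p U} (h : ∀ q, x.1 q = y.1 q) : x = y :=
  Subtype.ext (funext h)

/-- Restriction of sections of `B_p`. -/
def res {p : ℕ} {U V : C} (f : V ⟶ U) : L.Bar p U →+ L.Bar p V :=
  AddMonoidHom.mk' (fun x => ⟨fun q => rs (L.barLevel p q).obj f (x.1 q), fun q => by
      rw [← rs_levelProj, x.2 q]⟩)
    (fun x y => ext fun q => map_add _ _ _)

theorem res_id {p : ℕ} (U : C) (x : L.Bar p U) : res (𝟙 U) x = x := ext fun _ => rs_id _ _ _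

theorem res_comp {p : ℕ} {U V W : C} (f : V ⟶ U) (g : W ⟶ V) (x : L.Bar p U) :
    res (g ≫ f) x = res g (res f x) := ext fun _ => rs_comp _ _ _ _

/-- The differential `B_{p+1} → B_p`. -/
def d (p : ℕ) (U : C) : L.Bar (p + 1) U →+ L.Bar p U :=
  AddMonoidHom.mk' (fun x => ⟨fun q => L.levelD p q U (x.1 q), fun q => by
      rw [levelD_proj, x.2 q]⟩)
    (fun x y => ext fun q => map_add _ _ _)

theorem res_d (p : ℕ) {U V : C} (f : V ⟶ U) (x : L.Bar (p + 1) U) :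
    res f (d p U x) = d p V (res f x) := ext fun _ => L.rs_levelD _ _ _ _

theorem d_d (p : ℕ) {U : C} (x : L.Bar (p + 2) U) : d p U (d (p + 1) U x) = 0 := by
  refine ext fun q => ?_
  change L.levelD p q U (L.levelD (p + 1) q U (x.1 q)) = 0
  obtain ⟨S, hS, h⟩ := L.toLevel_locally (p + 2) q (x.1 q)
  refine sep _ hS fun V f hf => ?_
  obtain ⟨a, ha⟩ := h f hf
  rw [rs_levelD, rs_levelD, ← ha, levelD_toLevel, levelD_toLevel, barD_barD, map_zero, map_zero]

/-- The `J`-module structure of `B_p`, through the first factor. -/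
def act {p : ℕ} {U : C} (j : L.Jet U) : L.Bar p U →+ L.Bar p U :=
  AddMonoidHom.mk' (fun x => ⟨fun q => L.levelAct p q U j (x.1 q), fun q => by
      rw [levelProj_levelAct, x.2 q]⟩)
    (fun x y => ext fun q => map_add _ _ _)

theorem res_act {p : ℕ} {U V : C} (f : V ⟶ U) (j : L.Jet U) (x : L.Bar p U) :
    res f (act j x) = act (Jet.res f j) (res f x) := ext fun _ => L.rs_levelAct _ _ _ _ _

theorem d_act (p : ℕ) {U : C} (j : L.Jet U) (x : L.Bar (p + 1) U) :
    d p U (act j x) = act j (d p U x) := ext fun _ => L.levelD_levelAct _ _ _ _ _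

/-- The pure tensor `α₀ ⊗ ⋯ ⊗ αₚ`. -/
def pure {p : ℕ} {U : C} (α : Fin (p + 1) → L.Jet U) : L.Bar p U :=
  ⟨fun q => L.toLevel p q U
      (PiTensorProduct.tprod (fn O U) fun i => (Ideal.Quotient.mk _ (α i) : L.JetQ q U)),
    fun q => by
      dsimp only
      rw [levelProj_toLevel, tensProj, tensMap_tprod]; rfl⟩

theorem res_pure {p : ℕ} {U V : C} (f : V ⟶ U) (α : Fin (p + 1) → L.Jet U) :
    res f (pure α) = pure fun i => Jet.res f (α i) := ext fun q => by
  change rs (L.barLevel p q).obj f (L.toLevel p q U _) = L.toLevel p q V _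
  rw [rs_toLevel, tensMap_tprod]; rfl

theorem act_pure {p : ℕ} {U : C} (j : L.Jet U) (α : Fin (p + 1) → L.Jet U) :
    act j (pure α) = pure (Pi.mulSingle 0 j * α) := ext fun q => by
  change L.levelAct p q U j (L.toLevel p q U _) = L.toLevel p q U _
  rw [levelAct_toLevel, actFirst_tprod]
  congr 2; funext i
  simp only [Pi.mul_apply, map_mul]
  congr 1
  exact (Pi.apply_mulSingle (fun _ => Ideal.Quotient.mk (augIdeal L U ^ (q + 1)))
    (fun _ => map_one _) 0 j i).symm

theorem separated {p : ℕ} {U : C} {S : Sieve U} (hS : S ∈ T U) {x y : L.Bar p U}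
    (h : ∀ ⦃V : C⦄ (f : V ⟶ U), S f → res f x = res f y) : x = y :=
  ext fun q => sep (L.barLevel p q) hS fun V f hf => congr_arg (fun z => z.1 q) (h f hf)

theorem glue {p : ℕ} {U : C} {S : Sieve U} (hS : S ∈ T U)
    (s : ∀ ⦃V : C⦄ (f : V ⟶ U), S f → L.Bar p V)
    (hs : ∀ ⦃V W : C⦄ (f : V ⟶ U) (hf : S f) (g : W ⟶ V),
      s (g ≫ f) (S.downward_closed hf g) = res g (s f hf)) :
    ∃ z : L.Bar p U, ∀ ⦃V : C⦄ (f : V ⟶ U) (hf : S f), res f z = s f hf := by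
  have h := fun q => exists_glue (L.barLevel p q) hS (fun V f hf => (s f hf).1 q)
    (fun V W f hf g => by rw [hs f hf g]; rfl)
  choose z hz using h
  refine ⟨⟨z, fun q => sep (L.barLevel p q) hS fun V f hf => ?_⟩,
    fun V f hf => ext fun q => hz q f hf⟩
  rw [rs_levelProj, hz (q + 1) f hf, hz q f hf, (s f hf).2 q]

end Bar

end BarComplex

end LieAlgebroid

/-! ### Continuous endomorphisms of the bar complex -/

namespace LieAlgebroid

section HomComplex

variable {C : Type u} [SmallCategory C] {T : GrothendieckTopology C} {k : Type u} [Field k]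
  {O : Sheaf T (CommAlgCat.{u} k)} (L : LieAlgebroid O)

/-- The arrows `V ⟶ U` over which a family of maps `B_n → B_m` is continuous at level `r`: sections
that vanish on some level `q` are sent to sections that vanish on level `r`. -/
def contSieve {n m : ℕ} {U : C} (φ : ∀ (V : C) (_ : V ⟶ U), L.Bar n V →+ L.Bar m V) (r : ℕ) :
    Sieve U where
  arrows V f := ∃ q, ∀ ⦃W : C⦄ (g : W ⟶ V) (x : L.Bar n W), x.1 q = 0 → (φ W (g ≫ f) x).1 r = 0
  downward_closed := by
    rintro V V' f ⟨q, h⟩ f'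
    exact ⟨q, fun W g x hx => by rw [← Category.assoc]; exact h (g ≫ f') x hx⟩

/-- The group of continuous `J`-linear maps `B_n → B_m` over `U`, as compatible families of maps of
sections indexed by the `V ⟶ U`. -/
def homContSubgroup (n m : ℕ) (U : C) :
    AddSubgroup (∀ (V : C) (_ : V ⟶ U), L.Bar n V →+ L.Bar m V) where
  carrier := {φ |
    (∀ ⦃V W : C⦄ (f : V ⟶ U) (g : W ⟶ V) (x : L.Bar n V),
      Bar.res g (φ V f x) = φ W (g ≫ f) (Bar.res g x)) ∧
    (∀ ⦃V : C⦄ (f : V ⟶ U) (j : L.Jet V) (x : L.Bar n V),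
      φ V f (Bar.act j x) = Bar.act j (φ V f x)) ∧
    (∀ r, L.contSieve φ r ∈ T U)}
  zero_mem' := ⟨fun _ _ _ g _ => map_zero _, fun _ _ j _ => (map_zero _).symm, fun r =>
    T.superset_covering (fun _ _ _ => ⟨0, fun _ _ _ _ => rfl⟩) (T.top_mem U)⟩
  add_mem' := by
    rintro φ ψ ⟨h₁, h₂, h₃⟩ ⟨h₁', h₂', h₃'⟩
    refine ⟨fun V W f g x => ?_, fun V f j x => ?_, fun r => ?_⟩
    · exact (map_add _ _ _).trans (congr_arg₂ _ (h₁ f g x) (h₁' f g x))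
    · exact (congr_arg₂ _ (h₂ f j x) (h₂' f j x)).trans (map_add _ _ _).symm
    · refine T.superset_covering ?_ (T.intersection_covering (h₃ r) (h₃' r))
      rintro V f ⟨⟨q, hq⟩, ⟨q', hq'⟩⟩
      have key : ∀ {n : ℕ} {W : C} (x : L.Bar n W) (a b : ℕ), x.1 (a + b) = 0 → x.1 a = 0 := by
        intro n W x a b
        induction b with
        | zero => exact id
        | succ b ih =>
          intro h
          exact ih ((x.2 (a + b)).symm.trans ((congr_arg (L.levelProj n (a + b) W) h).trans
            (map_zero _)))
      refine ⟨q + q', fun W g x hx => ?_⟩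
      change (φ W (g ≫ f) x).1 r + (ψ W (g ≫ f) x).1 r = 0
      rw [hq g x (key x q q' hx), hq' g x (key x q' q (by rw [add_comm]; exact hx)), add_zero]
  neg_mem' := by
    rintro φ ⟨h₁, h₂, h₃⟩
    refine ⟨fun V W f g x => ?_, fun V f j x => ?_, fun r => ?_⟩
    · exact (map_neg _ _).trans (congr_arg _ (h₁ f g x))
    · exact (congr_arg _ (h₂ f j x)).trans (map_neg _ _).symm
    · refine T.superset_covering ?_ (h₃ r)
      rintro V f ⟨q, hq⟩
      refine ⟨q, fun W g x hx => ?_⟩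
      change -(φ W (g ≫ f) x).1 r = 0
      rw [hq g x hx, neg_zero]

/-- The sections over `U` of the sheaf of continuous `J`-linear maps `B_n → B_m`. -/
def HomCont (n m : ℕ) (U : C) : Type u := L.homContSubgroup n m U

instance (n m : ℕ) (U : C) : AddCommGroup (L.HomCont n m U) :=
  inferInstanceAs (AddCommGroup (L.homContSubgroup n m U))

namespace HomCont

variable {L}

/-- The value of a section of the sheaf of continuous maps. -/
def app {n m : ℕ} {U : C} (φ : L.HomCont n m U) {V : C} (f : V ⟶ U) : L.Bar n V →+ L.Bar m V :=
  φ.1 V f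

theorem ext {n m : ℕ} {U : C} {φ ψ : L.HomCont n m U}
    (h : ∀ (V : C) (f : V ⟶ U) (x : L.Bar n V), φ.app f x = ψ.app f x) : φ = ψ :=
  Subtype.ext (funext fun V => funext fun f => AddMonoidHom.ext (h V f))

theorem res_app {n m : ℕ} {U V W : C} (φ : L.HomCont n m U) (f : V ⟶ U) (g : W ⟶ V)
    (x : L.Bar n V) : Bar.res g (φ.app f x) = φ.app (g ≫ f) (Bar.res g x) := φ.2.1 f g x

theorem app_act {n m : ℕ} {U V : C} (φ : L.HomCont n m U) (f : V ⟶ U) (j : L.Jet V)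
    (x : L.Bar n V) : φ.app f (Bar.act j x) = Bar.act j (φ.app f x) := φ.2.2.1 f j x

theorem contSieve_mem {n m : ℕ} {U : C} (φ : L.HomCont n m U) (r : ℕ) :
    L.contSieve φ.1 r ∈ T U := φ.2.2.2 r

/-- Restriction of sections of the sheaf of continuous maps. -/
def res {n m : ℕ} {U V : C} (f : V ⟶ U) : L.HomCont n m U →+ L.HomCont n m V :=
  AddMonoidHom.mk' (fun φ => ⟨fun _ g => φ.app (g ≫ f),
    fun V' W g h x => by dsimp only; rw [φ.res_app, Category.assoc], fun V' g j x => φ.app_act _ j x,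
    fun r => T.superset_covering (by
      rintro W g ⟨q, hq⟩
      exact ⟨q, fun W' h x hx => by
        change (φ.app ((h ≫ g) ≫ f) x).1 r = 0
        rw [Category.assoc]; exact hq h x hx⟩) (T.pullback_stable f (φ.contSieve_mem r))⟩)
    (fun φ ψ => rfl)

theorem app_res {n m : ℕ} {U V W : C} (f : V ⟶ U) (g : W ⟶ V) (φ : L.HomCont n m U) :
    (res f φ).app g = φ.app (g ≫ f) := rfl

theorem res_id {n m : ℕ} {U : C} (φ : L.HomCont n m U) : res (𝟙 U) φ = φ :=
  ext fun V f x => by rw [app_res, Category.comp_id]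

theorem res_comp {n m : ℕ} {U V W : C} (f : V ⟶ U) (g : W ⟶ V) (φ : L.HomCont n m U) :
    res (g ≫ f) φ = res g (res f φ) :=
  ext fun V h x => by rw [app_res, app_res, app_res, Category.assoc]

/-- The identity of `B_n`. -/
def id (n : ℕ) (U : C) : L.HomCont n n U :=
  ⟨fun _ _ => AddMonoidHom.id _, fun _ _ _ _ _ => rfl, fun _ _ _ _ => rfl, fun r =>
    T.superset_covering (fun _ _ _ => ⟨r, fun _ _ _ h => h⟩) (T.top_mem U)⟩

/-- Composition of continuous maps. -/
def comp {n m l : ℕ} {U : C} (φ : L.HomCont m l U) (ψ : L.HomCont n m U) : L.HomCont n l U :=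
  ⟨fun _ f => (φ.app f).comp (ψ.app f),
    fun V W f g x => (φ.res_app f g _).trans (congr_arg _ (ψ.res_app f g x)),
    fun V f j x => (congr_arg (φ.app f) (ψ.app_act f j x)).trans (φ.app_act f j _),
    fun r => T.transitive (φ.contSieve_mem r) _ (by
      rintro V f ⟨q, hq⟩
      refine T.superset_covering ?_ (T.pullback_stable f (ψ.contSieve_mem q))
      rintro W g ⟨q', hq'⟩
      refine ⟨q', fun W' h x hx => ?_⟩
      change (φ.app (h ≫ g ≫ f) (ψ.app (h ≫ g ≫ f) x)).1 r = 0
      rw [← Category.assoc h g f]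
      exact hq (h ≫ g) _ (by rw [Category.assoc]; exact hq' h x hx))⟩

theorem comp_app {n m l : ℕ} {U V : C} (φ : L.HomCont m l U) (ψ : L.HomCont n m U) (f : V ⟶ U)
    (x : L.Bar n V) : (φ.comp ψ).app f x = φ.app f (ψ.app f x) := rfl

theorem comp_add {n m l : ℕ} {U : C} (φ : L.HomCont m l U) (ψ ψ' : L.HomCont n m U) :
    φ.comp (ψ + ψ') = φ.comp ψ + φ.comp ψ' := ext fun _ f _ => map_add (φ.app f) _ _

theorem add_comp {n m l : ℕ} {U : C} (φ φ' : L.HomCont m l U) (ψ : L.HomCont n m U) :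
    (φ + φ').comp ψ = φ.comp ψ + φ'.comp ψ := rfl

theorem res_comp_hom {n m l : ℕ} {U V : C} (f : V ⟶ U) (φ : L.HomCont m l U)
    (ψ : L.HomCont n m U) : res f (φ.comp ψ) = (res f φ).comp (res f ψ) := rfl

/-- The bar differential as a continuous map `B_{n+1} → B_n`. -/
def bar (n : ℕ) (U : C) : L.HomCont (n + 1) n U :=
  ⟨fun V _ => Bar.d n V, fun _ _ _ g x => Bar.res_d n g x, fun _ _ j x => Bar.d_act n j x,
    fun r => T.superset_covering
      (fun _ _ _ => ⟨r, fun W _ _ h =>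
        (congr_arg (L.levelD n r W) h).trans (map_zero _)⟩) (T.top_mem U)⟩

theorem separated {n m : ℕ} {U : C} {S : Sieve U} (hS : S ∈ T U) {φ ψ : L.HomCont n m U}
    (h : ∀ ⦃V : C⦄ (f : V ⟶ U), S f → res f φ = res f ψ) : φ = ψ :=
  ext fun V f x => Bar.separated (T.pullback_stable f hS) fun W g hg => by
    rw [res_app, res_app]
    have := congr_arg (fun χ => χ.app (𝟙 W) (Bar.res g x)) (h (g ≫ f) hg)
    simpa only [app_res, Category.id_comp] using this

theorem glue {n m : ℕ} {U : C} {S : Sieve U} (hS : S ∈ T U)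
    (s : ∀ ⦃V : C⦄ (f : V ⟶ U), S f → L.HomCont n m V)
    (hs : ∀ ⦃V W : C⦄ (f : V ⟶ U) (hf : S f) (g : W ⟶ V),
      s (g ≫ f) (S.downward_closed hf g) = res g (s f hf)) :
    ∃ φ : L.HomCont n m U, ∀ ⦃V : C⦄ (f : V ⟶ U) (hf : S f), res f φ = s f hf := by
  have h : ∀ (V : C) (f : V ⟶ U) (x : L.Bar n V), ∃ z : L.Bar m V, ∀ ⦃W : C⦄ (g : W ⟶ V)
      (hg : S (g ≫ f)), Bar.res g z = (s (g ≫ f) hg).app (𝟙 W) (Bar.res g x) := by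
    intro V f x
    refine Bar.glue (T.pullback_stable f hS)
      (fun W g hg => (s (g ≫ f) hg).app (𝟙 W) (Bar.res g x)) (fun W W' g hg h => ?_)
    have h₁ : s ((h ≫ g) ≫ f) (by rw [Category.assoc]; exact S.downward_closed hg h) = res h (s (g ≫ f) hg) := by
      rw [← hs (g ≫ f) hg h]; simp only [Category.assoc]
    rw [h₁, app_res, res_app, Bar.res_comp, Category.id_comp, Category.comp_id]
  choose z hz using h
  have hz' : ∀ {V : C} (f : V ⟶ U) (hf : S f) {W : C} (g : W ⟶ V) (x : L.Bar n W),
      z W (g ≫ f) x = (s f hf).app g x := by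
    intro V f hf W g x
    have h₁ := hz W (g ≫ f) x (𝟙 W) (by rw [Category.id_comp]; exact S.downward_closed hf g)
    have h₂ : s (𝟙 W ≫ g ≫ f) (by rw [Category.id_comp]; exact S.downward_closed hf g)
        = res g (s f hf) := by
      rw [← hs f hf g]; simp only [Category.id_comp]
    rw [h₂, app_res, Bar.res_id, Bar.res_id, Category.id_comp] at h₁
    exact h₁
  have hnat : ∀ {V W : C} (f : V ⟶ U) (g : W ⟶ V) (x : L.Bar n V),
      Bar.res g (z V f x) = z W (g ≫ f) (Bar.res g x) := by
    intro V W f g x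
    refine Bar.separated (T.pullback_stable (g ≫ f) hS) fun W' h hh => ?_
    have hh' : S ((h ≫ g) ≫ f) := by rw [Category.assoc]; exact hh
    rw [hz W (g ≫ f) _ h hh, ← Bar.res_comp, ← Bar.res_comp, hz V f x (h ≫ g) hh']
    simp only [Category.assoc]
  have hadd : ∀ {V : C} (f : V ⟶ U) (x y : L.Bar n V), z V f (x + y) = z V f x + z V f y := by
    intro V f x y
    refine Bar.separated (T.pullback_stable f hS) fun W g hg => ?_
    rw [map_add, hz V f _ g hg, hz V f _ g hg, hz V f _ g hg, map_add, map_add]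
  refine ⟨⟨fun V f => AddMonoidHom.mk' (z V f) (hadd f), fun V W f g x => hnat f g x,
    fun V f j x => ?_, fun r => ?_⟩, fun V f hf => ext fun W g x => hz' f hf g x⟩
  · refine Bar.separated (T.pullback_stable f hS) fun W g hg => ?_
    change Bar.res g (z V f (Bar.act j x)) = Bar.res g (Bar.act j (z V f x))
    rw [hz V f _ g hg, Bar.res_act, Bar.res_act, app_act, hz V f _ g hg]
  · refine T.transitive hS _ fun V f hf => T.superset_covering ?_ ((s f hf).contSieve_mem r)
    rintro W g ⟨q, hq⟩
    refine ⟨q, fun W' h x hx => ?_⟩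
    change (z W' (h ≫ g ≫ f) x).1 r = 0
    rw [← Category.assoc, hz' f hf]
    exact hq h x hx

end HomCont

/-- The indices `(n, m)` of the components `B_n → B_m` of an endomorphism of `B_•` of cohomological
degree `p`. -/
abbrev DegIdx (p : ℤ) : Type := {i : ℕ × ℕ // (i.1 : ℤ) = i.2 + p}

/-- The sections over `U` of the degree `p` part of the sheaf of continuous endomorphisms of
`B_•`: families of maps `B_n → B_m` with `n = m + p`. -/
abbrev HomDeg (p : ℤ) (U : C) : Type u := ∀ i : DegIdx p, L.HomCont i.1.1 i.1.2 U

variable {L} in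
/-- The component `B_n → B_m` of an endomorphism of `B_•`. -/
abbrev HomDeg.comp {p : ℤ} {U : C} (φ : L.HomDeg p U) (n m : ℕ) (h : (n : ℤ) = m + p) :
    L.HomCont n m U := φ ⟨(n, m), h⟩

/-- The presheaf with sections `HomDeg`. -/
def homPre (p : ℤ) : Cᵒᵖ ⥤ AddCommGrpCat.{u} where
  obj U := AddCommGrpCat.of (L.HomDeg p U.unop)
  map f := AddCommGrpCat.ofHom (AddMonoidHom.mk' (fun (φ : L.HomDeg p _) i =>
    HomCont.res f.unop (φ i)) (fun φ ψ => rfl))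
  map_id U := by
    ext φ i
    exact HomCont.res_id (φ i)
  map_comp f g := by
    ext φ i
    exact HomCont.res_comp f.unop g.unop (φ i)

theorem homPre_isSheaf (p : ℤ) : Presheaf.IsSheaf T (L.homPre p) := by
  rw [Presheaf.isSheaf_iff_isSheaf_forget T _ (forget AddCommGrpCat.{u}),
    isSheaf_iff_isSheaf_of_type]
  intro U S hS s hs
  have hs' := (Presieve.compatible_iff_sieveCompatible _).1 hs
  have h : ∀ i : DegIdx p, ∃ φ : L.HomCont i.1.1 i.1.2 U, ∀ ⦃V : C⦄ (f : V ⟶ U)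
      (hf : S f), HomCont.res f φ = (s f hf : L.HomDeg p V) i := fun i =>
    HomCont.glue hS (fun V f hf => (s f hf : L.HomDeg p V) i) fun V W f hf g =>
      congr_arg (fun φ : L.HomDeg p W => φ i) (hs' f g hf)
  choose φ hφ using h
  refine ⟨φ, fun V f hf => funext fun i => hφ i f hf,
    fun ψ hψ => funext fun i => HomCont.separated hS fun V f hf => ?_⟩
  rw [hφ i f hf]
  exact congr_arg (fun φ : L.HomDeg p V => φ i) (hψ f hf)

/-- The sheaf of continuous endomorphisms of degree `p` of `B_•`. -/
def homSheaf (p : ℤ) : Sheaf T AddCommGrpCat.{u} := ⟨L.homPre p, L.homPre_isSheaf p⟩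

/-- The differential `φ ↦ b' φ - (-1)ᵖ φ b'`. -/
def homD (p : ℤ) {U : C} (φ : L.HomDeg p U) : L.HomDeg (p + 1) U
  | ⟨(0, m), h⟩ => (HomCont.bar m U).comp (φ.comp 0 (m + 1) (by push_cast at h ⊢; omega))
  | ⟨(n + 1, m), h⟩ =>
      (HomCont.bar m U).comp (φ.comp (n + 1) (m + 1) (by push_cast at h ⊢; omega))
        - p.negOnePow • (φ.comp n m (by push_cast at h ⊢; omega)).comp (HomCont.bar n U)

/-- The differential of the complex of continuous endomorphisms, as a map of sheaves. -/
def homSheafD (p : ℤ) : L.homSheaf p ⟶ L.homSheaf (p + 1) where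
  hom :=
    { app := fun U => AddCommGrpCat.ofHom (AddMonoidHom.mk' (L.homD p) (fun φ ψ => by
        funext ⟨⟨n, m⟩, h⟩
        cases n with
        | zero => exact HomCont.comp_add _ _ _
        | succ n =>
          refine (congr_arg₂ (fun a b => a - p.negOnePow • b) (HomCont.comp_add _ _ _)
            (HomCont.add_comp _ _ _)).trans ?_
          rw [smul_add]
          exact add_sub_add_comm _ _ _ _))
      naturality := fun U V f => by
        ext φ
        funext ⟨⟨n, m⟩, h⟩
        cases n with
        | zero => rfl
        | succ n =>
          rfl }

theorem homD_zero (p : ℤ) {U : C} (φ : L.HomDeg p U) (m : ℕ) (h) :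
    (L.homD p φ).comp 0 m h
      = (HomCont.bar m U).comp (φ.comp 0 (m + 1) (by push_cast at h ⊢; omega)) := rfl

theorem homD_succ (p : ℤ) {U : C} (φ : L.HomDeg p U) (n m : ℕ) (h) :
    (L.homD p φ).comp (n + 1) m h
      = (HomCont.bar m U).comp (φ.comp (n + 1) (m + 1) (by push_cast at h ⊢; omega))
        - p.negOnePow • (φ.comp n m (by push_cast at h ⊢; omega)).comp (HomCont.bar n U) := rfl

theorem homD_homD (p : ℤ) {U : C} (φ : L.HomDeg p U) : L.homD (p + 1) (L.homD p φ) = 0 := by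
  funext ⟨⟨n, m⟩, h⟩
  have hb : ∀ {i j : ℕ} (ψ : L.HomCont i (j + 2) U),
      (HomCont.bar j U).comp ((HomCont.bar (j + 1) U).comp ψ) = 0 := fun ψ =>
    HomCont.ext fun V f x => Bar.d_d _ _
  have hb' : ∀ {i j : ℕ} (ψ : L.HomCont i j U),
      (ψ.comp (HomCont.bar i U)).comp (HomCont.bar (i + 1) U) = 0 := fun ψ =>
    HomCont.ext fun V f x =>
      (congr_arg (ψ.app f) (Bar.d_d _ _)).trans (map_zero (ψ.app f))
  have hs : ∀ {i j l : ℕ} (χ : L.HomCont j l U) (ψ ψ' : L.HomCont i j U),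
      χ.comp (ψ - ψ') = χ.comp ψ - χ.comp ψ' := fun χ ψ ψ' =>
    HomCont.ext fun V f x => map_sub (χ.app f) _ _
  have hs' : ∀ {i j l : ℕ} (χ χ' : L.HomCont j l U) (ψ : L.HomCont i j U),
      (χ - χ').comp ψ = χ.comp ψ - χ'.comp ψ := fun χ χ' ψ => rfl
  have hz : ∀ {i j l : ℕ} (c : ℤˣ) (χ : L.HomCont j l U) (ψ : L.HomCont i j U),
      χ.comp (c • ψ) = c • χ.comp ψ := fun c χ ψ =>
    HomCont.ext fun V f x => map_zsmul (χ.app f) (c : ℤ) _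
  have hz' : ∀ {i j l : ℕ} (c : ℤˣ) (χ : L.HomCont j l U) (ψ : L.HomCont i j U),
      (c • χ).comp ψ = c • χ.comp ψ := fun c χ ψ => rfl
  have ha : ∀ {i j l o : ℕ} (χ : L.HomCont l o U) (ψ : L.HomCont j l U) (ψ' : L.HomCont i j U),
      (χ.comp ψ).comp ψ' = χ.comp (ψ.comp ψ') := fun χ ψ ψ' => rfl
  change (L.homD (p + 1) (L.homD p φ)).comp n m h = 0
  match n, h with
  | 0, h => rw [homD_zero, homD_zero, hb]
  | 1, h =>
    rw [homD_succ, homD_succ, homD_zero, hs, hb, hz, ha, Int.negOnePow_succ, Units.neg_smul,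
      zero_sub, sub_neg_eq_add, neg_add_cancel]
  | n + 2, h =>
    rw [homD_succ, homD_succ, homD_succ, hs, hb, hz, hs', hz', hb', ha, Int.negOnePow_succ,
      Units.neg_smul, zero_sub, sub_neg_eq_add, smul_zero, sub_zero, neg_add_cancel]

/-- The complex of sheaves of continuous endomorphisms of `B_•`. -/
def homComplex : CochainComplex (Sheaf T AddCommGrpCat.{u}) ℤ :=
  CochainComplex.of L.homSheaf L.homSheafD fun p => by
    ext U φ
    exact L.homD_homD p φ

/-- The product of endomorphisms of `B_•`, `φ ∘ ψ`. -/
def homMul {p q r : ℤ} (hr : p + q = r) {U : C} (φ : L.HomDeg p U) (ψ : L.HomDeg q U) :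
    L.HomDeg r U :=
  fun ⟨(n, l), h⟩ =>
    if hm : 0 ≤ (l : ℤ) + p then
      (φ.comp (l + p).toNat l (by dsimp only at h; omega)).comp
        (ψ.comp n (l + p).toNat (by dsimp only at h; omega))
    else 0

variable {L} in
/-- The action of endomorphisms of degree `p` on sections of `B_n` with `n = m + p`. -/
abbrev HomDeg.app {p : ℤ} {U V : C} (φ : L.HomDeg p U) (f : V ⟶ U) {n m : ℕ}
    (h : (n : ℤ) = m + p) : L.Bar n V →+ L.Bar m V := (φ.comp n m h).app f

end HomComplex

end LieAlgebroid

/-! ### The Hochschild cochain complex -/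

namespace LieAlgebroid

section Hochschild

variable {C : Type u} [SmallCategory C] {T : GrothendieckTopology C} {k : Type u} [Field k]
  {O : Sheaf T (CommAlgCat.{u} k)} (L : LieAlgebroid O)

/-- The presheaf of `p`-th tensor powers over `O` of the enveloping algebra. -/
def hochPre (p : ℕ) : Cᵒᵖ ⥤ AddCommGrpCat.{u} where
  obj U := AddCommGrpCat.of (TPow (fn O U.unop) (L.Env U.unop) p)
  map f := AddCommGrpCat.ofHom (tensMap (ι := Fin p) (L.envResₛₗ f.unop)).toAddMonoidHom
  map_id U := by
    ext x
    change tensMap (ι := Fin p) (L.envResₛₗ (𝟙 U.unop)) x = x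
    induction x using PiTensorProduct.induction_on with
    | smul_tprod r m =>
      rw [LinearMap.map_smulₛₗ, tensMap_tprod]
      congr 1
      · exact fnRes_id O U.unop r
      · exact congr_arg _ (funext fun i => L.envRes_id U.unop (m i))
    | add x y hx hy => rw [map_add, hx, hy]
  map_comp f g := by
    ext x
    change tensMap (ι := Fin p) (L.envResₛₗ (g.unop ≫ f.unop)) x
      = tensMap (L.envResₛₗ g.unop) (tensMap (L.envResₛₗ f.unop) x)
    induction x using PiTensorProduct.induction_on with
    | smul_tprod r m =>
      rw [LinearMap.map_smulₛₗ, LinearMap.map_smulₛₗ, LinearMap.map_smulₛₗ, tensMap_tprod,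
        tensMap_tprod, tensMap_tprod]
      congr 1
      · exact fnRes_comp O f.unop g.unop r
      · exact congr_arg _ (funext fun i => L.envRes_comp f.unop g.unop (m i))
    | add x y hx hy => simp only [map_add, hx, hy]

/-- The Hochschild differential on presheaf tensors. -/
def hochDPre (p : ℕ) : L.hochPre p ⟶ L.hochPre (p + 1) where
  app U := AddCommGrpCat.ofHom (coHoch (fn O U.unop) (A := L.Env U.unop) p).toAddMonoidHom
  naturality U V f := by
    ext x
    exact (coHoch_tensMap (L.envResₛₗ f.unop) (map_one (L.envRes f.unop))
      (fun D => Envel.comul_map (fnRes O f.unop) (L.res f.unop) D) p x).symm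

theorem hochDPre_comp (p : ℕ) : L.hochDPre p ≫ L.hochDPre (p + 1) = 0 := by
  ext U x
  exact coHoch_coHoch (fn O U.unop) (A := L.Env U.unop) Envel.comul_one p x

/-- The sheaf `HC^p`, the `p`-th tensor power over `O` of the sheaf of enveloping algebras. -/
abbrev hochSheaf (p : ℕ) : Sheaf T AddCommGrpCat.{u} := shf T (L.hochPre p)

/-- The Hochschild cochain complex of sheaves. -/
def hochComplex : CochainComplex (Sheaf T AddCommGrpCat.{u}) ℕ :=
  CochainComplex.of L.hochSheaf
    (fun p => (presheafToSheaf T AddCommGrpCat.{u}).map (L.hochDPre p)) fun p => by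
      rw [← Functor.map_comp, hochDPre_comp, Functor.map_zero]

/-- The section of `HC^p` given by a tensor. -/
def toHoch (p : ℕ) (U : C) :
    TPow (fn O U) (L.Env U) p →+ (L.hochSheaf p).obj.obj (op U) :=
  toShf T (L.hochPre p) U

/-- The product `x, y ↦ (-1)^{pq} x ⊗ y` of tensors. -/
def cupPre (p q : ℕ) (U : C) : TPow (fn O U) (L.Env U) p →+ TPow (fn O U) (L.Env U) q →+
    (L.hochSheaf (p + q)).obj.obj (op U) :=
  AddMonoidHom.mk' (fun x => AddMonoidHom.mk' (fun y =>
      (-1 : ℤ) ^ (p * q) • L.toHoch (p + q) U (TensorPower.mulEquiv (x ⊗ₜ y)))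
    (fun y y' => by rw [tmul_add, map_add, map_add, smul_add]))
    (fun x x' => AddMonoidHom.ext fun y => by
      change (-1 : ℤ) ^ (p * q) • L.toHoch (p + q) U _
        = (-1 : ℤ) ^ (p * q) • L.toHoch (p + q) U _ + (-1 : ℤ) ^ (p * q) • L.toHoch (p + q) U _
      rw [add_tmul, map_add, map_add, smul_add])

theorem tensMap_mulEquiv {R R' M M' : Type*} [CommRing R] [CommRing R'] [AddCommGroup M]
    [Module R M] [AddCommGroup M'] [Module R' M'] {σ : R →+* R'} (g : M →ₛₗ[σ] M') {p q : ℕ}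
    (x : TPow R M p) (y : TPow R M q) :
    tensMap g (TensorPower.mulEquiv (x ⊗ₜ[R] y) : TPow R M (p + q))
      = TensorPower.mulEquiv (tensMap g x ⊗ₜ[R'] tensMap g y) := by
  induction x using PiTensorProduct.induction_on with
  | smul_tprod r m =>
    induction y using PiTensorProduct.induction_on with
    | smul_tprod s n =>
      have h₁ := TensorPower.tprod_mul_tprod R m n
      have h₂ := TensorPower.tprod_mul_tprod R' (fun i => g (m i)) (fun i => g (n i))
      rw [TensorPower.gMul_def] at h₁ h₂
      simp only [LinearMap.map_smulₛₗ, tensMap_tprod, ← smul_tmul', tmul_smul, map_smul, h₁, h₂]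
      congr 3
      funext i
      refine Fin.addCases (fun i => ?_) (fun i => ?_) i <;> simp
    | add y y' hy hy' => simp only [tmul_add, map_add, hy, hy']
  | add x x' hx hx' => simp only [add_tmul, map_add, hx, hx']

theorem rs_cupPre (p q : ℕ) ⦃U V : C⦄ (f : V ⟶ U) (x : TPow (fn O U) (L.Env U) p)
    (y : TPow (fn O U) (L.Env U) q) :
    rs (L.hochSheaf (p + q)).obj f (L.cupPre p q U x y)
      = L.cupPre p q V (tensMap (L.envResₛₗ f) x) (tensMap (L.envResₛₗ f) y) := by
  refine (map_zsmul (rs (L.hochSheaf (p + q)).obj f) ((-1 : ℤ) ^ (p * q)) _).trans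
    (congr_arg (fun z => (-1 : ℤ) ^ (p * q) • z) ?_)
  refine (rs_toShf (L.hochPre (p + q)) f _).trans (congr_arg (L.toHoch (p + q) V) ?_)
  exact tensMap_mulEquiv (L.envResₛₗ f) x y

/-- The cup product on sections of the Hochschild complex. -/
def cup {p q : ℕ} {U : C} (x : (L.hochSheaf p).obj.obj (op U))
    (y : (L.hochSheaf q).obj.obj (op U)) : (L.hochSheaf (p + q)).obj.obj (op U) :=
  biext (P := L.hochPre p) (Q := L.hochPre q) (F := L.hochSheaf (p + q)) (L.cupPre p q)
    (L.rs_cupPre p q) U x y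

theorem cup_toHoch {p q : ℕ} {U : C} (D : Fin p → L.Env U) (E : Fin q → L.Env U) :
    L.cup (L.toHoch p U (PiTensorProduct.tprod (fn O U) D))
        (L.toHoch q U (PiTensorProduct.tprod (fn O U) E))
      = (-1 : ℤ) ^ (p * q) • L.toHoch (p + q) U
        (PiTensorProduct.tprod (fn O U) (Fin.append D E)) := by
  rw [← TensorPower.tprod_mul_tprod, TensorPower.gMul_def]
  exact biext_toShf (P := L.hochPre p) (Q := L.hochPre q) (F := L.hochSheaf (p + q)) _ _ _ _ _

end Hochschild

end LieAlgebroid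

/-! ### The cap product -/

namespace LieAlgebroid

section Cap

variable {C : Type u} [SmallCategory C] {T : GrothendieckTopology C} {k : Type u} [Field k]
  {O : Sheaf T (CommAlgCat.{u} k)} (L : LieAlgebroid O)

/-- The factors of the cap product
`(α₀ ²∇_{D₁}α₁ ⋯ ²∇_{Dₚ}αₚ) ⊗ αₚ₊₁ ⊗ ⋯ ⊗ αₙ` of `D₁ ⊗ ⋯ ⊗ Dₚ` and `α₀ ⊗ ⋯ ⊗ αₙ`,
for `n = m + p`. -/
def capTens {p n m : ℕ} (h : (n : ℤ) = m + p) {U : C} (D : Fin p → L.Env U)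
    (α : Fin (n + 1) → L.Jet U) : Fin (m + 1) → L.Jet U :=
  Fin.cons (α 0 * ∏ i : Fin p, Jet.nabla (D i) (α ⟨i + 1, by omega⟩))
    (fun j : Fin m => α ⟨p + j + 1, by omega⟩)

/-- The Hochschild cochain complex, extended by zero to negative degrees. -/
abbrev hochComplexZ : CochainComplex (Sheaf T AddCommGrpCat.{u}) ℤ :=
  L.hochComplex.extend ComplexShape.embeddingUpNat

variable {L} in
/-- The image of a section of `HC^p` under a morphism to the complex of continuous endomorphisms
of `B_•`. -/
def evalDeg (Φ : L.hochComplexZ ⟶ L.homComplex) (p : ℕ) {U : C}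
    (x : (L.hochSheaf p).obj.obj (op U)) : L.HomDeg p U :=
  (((L.hochComplex.extendXIso ComplexShape.embeddingUpNat (i := p) (i' := (p : ℤ)) rfl).inv
    ≫ Φ.f (p : ℤ)).hom.app (op U)).hom x

end Cap

end LieAlgebroid

end LieAlgd

end

open LieAlgd LieAlgd.LieAlgebroid

set_option linter.unusedSectionVars false

noncomputable section

namespace LieAlgd

/-! ### The Poincaré–Birkhoff–Witt theorem for Lie–Rinehart pairs -/

/-! The bar complex `B_•` is a resolution of `O` by modules which are, topologically, free over `J`:
a continuous `J`-linear map out of `B_n` is determined by its values on the tensors `1 ⊗ y`.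
Replacing the target `B_•` by its augmentation `ε : B_0 → O` should therefore not change the
cohomology of the endomorphism complex, and what remains in degree `p` is the sheaf of continuous
`O`-multilinear functionals of `p` jets with values in `O`. Jets are the dual of `U`, so these
functionals form `U ⊗ ⋯ ⊗ U` with `p` factors, that is `HC^p`. The cap product realizes this
identification, because `ε(D ∩ (1 ⊗ α₁ ⊗ ⋯ ⊗ αₚ)) = α₁(D₁) ⋯ αₚ(Dₚ)` (`capN_val_zero`).

To make this precise without derived categories, let `augSub` be the subcomplex of families whose
component `B_p → B_0` takes values in the kernel of `ε`. In each degree the endomorphism sheaf is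
the direct sum of `augSub` and of the image of the cap product, which is injective
(`capSec_eq_zero`, `exists_sub_capSec_mem`). The projection along `augSub` is then a morphism of
complexes and a retraction `Ψ` of the cap product `Φ`. A cocycle in `augSub` is the coboundary of an
explicit cochain, natural on sections (`homD_rho`), so `1 - ΨΦ` induces zero on homology and `Φ` is
a quasi-isomorphism (`quasiIso_of_retraction`).

The cochain comes from the contraction `s(α₀ ⊗ ⋯) = 1 ⊗ α₀ ⊗ ⋯`. It satisfies `b's + sb' = 1` in
positive degrees and `b's = 1` on the kernel of `ε` in degree `0`. As `s` is not `J`-linear, `sext`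
applies it after a map on `1 ⊗ y` only and extends the result `J`-linearly; `rho` solves the
equation `dρ = φ` by recursion on the degree of the target.

The decomposition is local, over objects where `L` has a frame. There the Poincaré–Birkhoff–Witt
theorem for Lie–Rinehart pairs makes the ordered monomials a basis of `U`: independence comes from a
representation on the free module on multisets (`pbwCurv_eq_zero`), generation from straightening.
Hence a jet is an arbitrary family of functions indexed by multisets. In characteristic zero a jet
that vanishes on all monomials of degree less than `q` lies in the `q`-th power of `J^c`
(`IsFrame.mem_augIdeal_pow`), so a continuous functional only sees a finite Taylor expansion and is
given by finitely many coefficients, that is by a tensor of elements of `U` (`IsFrame.exists_capN`).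
Uniqueness lets the local solutions glue.

That `Φ` respects the differentials reduces to one factor: `d_H D = D ⊗ 1 - Δ D + 1 ⊗ D` acts as
`b'D + Db'`, because `²∇_D` of a product of jets is computed by `Δ D` (`Jet.nabla_mul`,
`capTwo_coOne`). Multiplicativity for the opposite product holds because the first tensor factor
acts first. All maps into the completed complex are defined on tensors of jets, which are dense, and
extended by continuity (`TensFam.toHomCont`). -/

section PBW

variable {k R L : Type u} [CommRing k] [CommRing R] [Algebra k R] [LieRing L] [Module R L]
  [LieRingModule L R] [LieAlgebra k L] [LieRinehartRing R L] [LieRinehartAlgebra k R L]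
  {ι : Type} [LinearOrder ι]

/-- The additive operator on the free module on multisets with symbol `x ∈ L` and with prescribed
values on the basis. -/
def connOp (x : L) (g : Multiset ι → (Multiset ι →₀ R)) :
    (Multiset ι →₀ R) →+ (Multiset ι →₀ R) :=
  Finsupp.liftAddHom fun M =>
    { toFun := fun a => a • g M + Finsupp.single M ⁅x, a⁆
      map_zero' := by simp
      map_add' := fun a b => by simp only [add_smul, lie_add, Finsupp.single_add]; abel }

theorem connOp_single (x : L) (g : Multiset ι → (Multiset ι →₀ R)) (M : Multiset ι) (a : R) :
    connOp x g (Finsupp.single M a) = a • g M + Finsupp.single M ⁅x, a⁆ :=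
  Finsupp.liftAddHom_apply_single _ _ _

theorem lie_one_eq_zero (x : L) : ⁅x, (1 : R)⁆ = 0 := by
  have h := LieRinehartRing.leibniz_mul_right x (1 : R) 1
  simpa using h

theorem connOp_single_one (x : L) (g : Multiset ι → (Multiset ι →₀ R)) (M : Multiset ι) :
    connOp x g (Finsupp.single M 1) = g M := by
  rw [connOp_single, lie_one_eq_zero, Finsupp.single_zero, one_smul, add_zero]

theorem connOp_smul (x : L) (g : Multiset ι → (Multiset ι →₀ R)) (a : R) (p : Multiset ι →₀ R) :
    connOp x g (a • p) = a • connOp x g p + ⁅x, a⁆ • p := by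
  induction p using Finsupp.induction_linear with
  | zero => simp
  | add p q hp hq => simp only [smul_add, map_add, hp, hq]; abel
  | single M b =>
    simp only [Finsupp.smul_single, connOp_single, smul_eq_mul, LieRinehartRing.leibniz_mul_right,
      Finsupp.single_add, smul_add, smul_smul]
    abel

/-- The span of the multisets of cardinality at most `n`. -/
abbrev degLE (R : Type u) [CommRing R] (ι : Type) (n : ℕ) : Submodule R (Multiset ι →₀ R) :=
  Finsupp.supported R R {M : Multiset ι | M.card ≤ n}

theorem degLE_mono {m n : ℕ} (h : m ≤ n) : degLE R ι m ≤ degLE R ι n :=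
  Finsupp.supported_mono fun _ hM => le_trans hM h

/-- The operators below satisfy a Leibniz rule and are not `R`-linear, so stability under scalars is
a case to be checked instead of a consequence of linear extension from the basis. -/
theorem degLE_induction {n : ℕ} {P : (Multiset ι →₀ R) → Prop} (zero : P 0)
    (add : ∀ p q, P p → P q → P (p + q)) (smul : ∀ (a : R) p, P p → P (a • p))
    (single : ∀ M : Multiset ι, M.card ≤ n → P (Finsupp.single M 1))
    {p : Multiset ι →₀ R} (hp : p ∈ degLE R ι n) : P p := by
  rw [degLE, Finsupp.supported_eq_span_single] at hp
  induction hp using Submodule.span_induction with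
  | mem x hx => obtain ⟨M, hM, rfl⟩ := hx; exact single M hM
  | zero => exact zero
  | add x y _ _ hx hy => exact add _ _ hx hy
  | smul a x _ hx => exact smul _ _ hx

theorem connOp_congr {x : L} {g g' : Multiset ι → (Multiset ι →₀ R)} {n : ℕ}
    (h : ∀ M : Multiset ι, M.card ≤ n → g M = g' M) {p : Multiset ι →₀ R} (hp : p ∈ degLE R ι n) :
    connOp x g p = connOp x g' p := by
  refine degLE_induction (P := fun p => connOp x g p = connOp x g' p) (by simp)
    (fun p q hp hq => by rw [map_add, map_add, hp, hq])
    (fun a p hp => by rw [connOp_smul, connOp_smul, hp])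
    (fun M hM => by rw [connOp_single_one, connOp_single_one, h M hM]) hp

theorem connOp_mem {x : L} {g : Multiset ι → (Multiset ι →₀ R)} {n : ℕ}
    (h : ∀ M : Multiset ι, M.card ≤ n → g M ∈ degLE R ι (n + 1)) {p : Multiset ι →₀ R}
    (hp : p ∈ degLE R ι n) : connOp x g p ∈ degLE R ι (n + 1) := by
  -- The Leibniz rule contributes the term `⁅x, a⁆ • p`, so membership of `p` itself has to be
  -- carried along.
  have key : connOp x g p ∈ degLE R ι (n + 1) ∧ p ∈ degLE R ι (n + 1) := by
    refine degLE_induction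
      (P := fun p => connOp x g p ∈ degLE R ι (n + 1) ∧ p ∈ degLE R ι (n + 1))
      ⟨by simp, zero_mem _⟩ ?_ ?_ ?_ hp
    · intro p q hp hq
      exact ⟨by rw [map_add]; exact add_mem hp.1 hq.1, add_mem hp.2 hq.2⟩
    · intro a p hp
      refine ⟨?_, Submodule.smul_mem _ _ hp.2⟩
      rw [connOp_smul]
      exact add_mem (Submodule.smul_mem _ _ hp.1) (Submodule.smul_mem _ _ hp.2)
    · intro M hM
      refine ⟨by rw [connOp_single_one]; exact h M hM, ?_⟩
      exact Finsupp.single_mem_supported R _ (show M.card ≤ n + 1 by omega)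
  exact key.1

theorem exists_cons_min {M : Multiset ι} (hM : M ≠ 0) :
    ∃ (l : ι) (N : Multiset ι), M = l ::ₘ N ∧ ∀ a ∈ N, l ≤ a := by
  have h := Multiset.pairwise_sort M (· ≤ ·)
  rcases hs : M.sort (· ≤ ·) with _ | ⟨l, N⟩
  · exact absurd (by rw [← Multiset.sort_eq M (· ≤ ·), hs]; rfl) hM
  · rw [hs, List.pairwise_cons] at h
    refine ⟨l, N, ?_, fun a ha => h.1 a (by simpa using ha)⟩
    rw [← Multiset.sort_eq M (· ≤ ·), hs]; rfl

/-- Induction on multisets by adding elements that are minimal. -/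
theorem cons_min_induction {P : Multiset ι → Prop} (zero : P 0)
    (cons : ∀ l N, (∀ a ∈ N, l ≤ a) → P N → P (l ::ₘ N)) (M : Multiset ι) : P M := by
  induction h : M.card generalizing M with
  | zero => rw [Multiset.card_eq_zero.1 h]; exact zero
  | succ n ih =>
    obtain ⟨l, N, rfl, hl⟩ := exists_cons_min (M := M) (by rintro rfl; simp at h)
    exact cons l N hl (ih N (by simpa using h))

variable [Fintype ι] (b : Module.Basis ι R L)

/-- The value of the `i`-th operator on the multiset `M`, with recursion depth `n`. -/
def pbwVal : ℕ → ι → Multiset ι → (Multiset ι →₀ R)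
  -- This default is the intended value for `M = 0` only; any depth at least `M.card` gives the
  -- intended value at `M`.
  | 0, i, M => Finsupp.single (i ::ₘ M) 1
  | n + 1, i, M =>
    match M.sort (· ≤ ·) with
    | [] => Finsupp.single (i ::ₘ M) 1
    -- The value is forced by `e_i e_l = e_l e_i + [e_i, e_l]` applied to `N`: since `l` is minimal,
    -- `e_l` sends `i ::ₘ N` to `i ::ₘ M`, and `e_l` still has to be applied to the remainder of
    -- `e_i N`.
    | l :: N => if i ≤ l then Finsupp.single (i ::ₘ M) 1 else
        Finsupp.single (i ::ₘ M) 1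
          + connOp (b l) (pbwVal n l) (pbwVal n i (N : Multiset ι) - Finsupp.single (i ::ₘ N) 1)
          + ∑ j, b.repr ⁅b i, b l⁆ j • pbwVal n j N

theorem pbwVal_zero (n : ℕ) (i : ι) : pbwVal b n i 0 = Finsupp.single {i} 1 := by
  cases n with
  | zero => rfl
  | succ n => rw [pbwVal, Multiset.sort_zero]; rfl

theorem pbwVal_cons_of_le (n : ℕ) {i l : ι} {N : Multiset ι} (hl : ∀ a ∈ N, l ≤ a) (hi : i ≤ l) :
    pbwVal b n i (l ::ₘ N) = Finsupp.single (i ::ₘ l ::ₘ N) 1 := by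
  cases n with
  | zero => rfl
  | succ n => rw [pbwVal, Multiset.sort_cons _ _ _ hl]; simp only [if_pos hi]

theorem pbwVal_cons_of_lt (n : ℕ) {i l : ι} {N : Multiset ι} (hl : ∀ a ∈ N, l ≤ a) (hi : l < i) :
    pbwVal b (n + 1) i (l ::ₘ N) = Finsupp.single (i ::ₘ l ::ₘ N) 1
      + connOp (b l) (pbwVal b n l) (pbwVal b n i N - Finsupp.single (i ::ₘ N) 1)
      + ∑ j, b.repr ⁅b i, b l⁆ j • pbwVal b n j N := by
  rw [pbwVal, Multiset.sort_cons _ _ _ hl]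
  simp only [if_neg (not_le.2 hi), Multiset.sort_eq]

/-- This bound makes the recursion consistent: the element to which `e_l` is applied in `pbwVal` has
degree at most `N.card`, so a depth of `N.card` is enough to compute it. -/
theorem pbwVal_sub_mem (n : ℕ) (i : ι) (M : Multiset ι) (h : M.card ≤ n) :
    pbwVal b n i M - Finsupp.single (i ::ₘ M) 1 ∈ degLE R ι M.card := by
  induction n generalizing i M with
  | zero => rw [pbwVal, sub_self]; exact zero_mem _
  | succ n ih =>
    by_cases hM : M = 0
    · subst hM; rw [pbwVal_zero]; simp
    obtain ⟨l, N, rfl, hl⟩ := exists_cons_min hM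
    rcases le_or_gt i l with hi | hi
    · rw [pbwVal_cons_of_le b _ hl hi, sub_self]; exact zero_mem _
    have hN : N.card ≤ n := by simpa using h
    have h1 : ∀ (j : ι) (K : Multiset ι), K.card ≤ N.card →
        pbwVal b n j K ∈ degLE R ι (N.card + 1) := fun j K hK => by
      have := ih j K (hK.trans hN)
      rw [← sub_add_cancel (pbwVal b n j K) (Finsupp.single (j ::ₘ K) 1)]
      refine add_mem (degLE_mono (by omega) this) (Finsupp.single_mem_supported R _ ?_)
      simpa using hK
    rw [pbwVal_cons_of_lt b n hl hi, add_assoc, add_sub_cancel_left, Multiset.card_cons]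
    refine add_mem (connOp_mem (h1 l) (ih i N hN)) (sum_mem fun j _ => ?_)
    exact Submodule.smul_mem _ _ (h1 j N le_rfl)

/-- Every recursive call that matters is made on multisets of cardinality at most `N.card`, one less
than that of `M`; for the argument of `connOp` this is `pbwVal_sub_mem`. -/
theorem pbwVal_succ (n : ℕ) (i : ι) (M : Multiset ι) (h : M.card ≤ n) :
    pbwVal b (n + 1) i M = pbwVal b n i M := by
  induction n generalizing i M with
  | zero =>
    rw [Multiset.card_eq_zero.1 (Nat.le_zero.1 h), pbwVal_zero, pbwVal_zero]
  | succ n ih =>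
    by_cases hM : M = 0
    · subst hM; rw [pbwVal_zero, pbwVal_zero]
    obtain ⟨l, N, rfl, hl⟩ := exists_cons_min hM
    rcases le_or_gt i l with hi | hi
    · rw [pbwVal_cons_of_le b _ hl hi, pbwVal_cons_of_le b _ hl hi]
    have hN : N.card ≤ n := by simpa using h
    rw [pbwVal_cons_of_lt b _ hl hi, pbwVal_cons_of_lt b _ hl hi, ih i N hN,
      connOp_congr (fun K hK => ih l K (hK.trans hN)) (pbwVal_sub_mem b n i N hN)]
    simp only [fun j => ih j N hN]

theorem pbwVal_eq (n : ℕ) (i : ι) (M : Multiset ι) (h : M.card ≤ n) :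
    pbwVal b n i M = pbwVal b M.card i M := by
  induction n, h using Nat.le_induction with
  | base => rfl
  | succ n h ih => rw [pbwVal_succ b n i M h, ih]

/-- The operator of the `i`-th basis vector on the free module on multisets. -/
def pbwOp (i : ι) : (Multiset ι →₀ R) →+ (Multiset ι →₀ R) :=
  connOp (b i) fun M => pbwVal b M.card i M

theorem pbwOp_of_le {i : ι} {M : Multiset ι} (h : ∀ a ∈ M, i ≤ a) :
    pbwOp b i (Finsupp.single M 1) = Finsupp.single (i ::ₘ M) 1 := by
  rw [pbwOp, connOp_single_one]
  by_cases hM : M = 0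
  · subst hM; exact pbwVal_zero b _ i
  obtain ⟨l, N, rfl, hl⟩ := exists_cons_min hM
  exact pbwVal_cons_of_le b _ hl (h l (Multiset.mem_cons_self l N))

theorem pbwOp_sub_mem (i : ι) (M : Multiset ι) :
    pbwOp b i (Finsupp.single M 1) - Finsupp.single (i ::ₘ M) 1 ∈ degLE R ι M.card := by
  rw [pbwOp, connOp_single_one]
  exact pbwVal_sub_mem b _ i M le_rfl

theorem pbwOp_smul (i : ι) (a : R) (p : Multiset ι →₀ R) :
    pbwOp b i (a • p) = a • pbwOp b i p + ⁅b i, a⁆ • p := connOp_smul _ _ _ _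

/-- The operator of an element of `L` on the free module on multisets. -/
def pbwAct (x : L) : (Multiset ι →₀ R) →+ (Multiset ι →₀ R) :=
  AddMonoidHom.mk' (fun p => ∑ i, b.repr x i • pbwOp b i p)
    (fun p q => by simp only [map_add, smul_add, Finset.sum_add_distrib])

theorem pbwAct_apply (x : L) (p : Multiset ι →₀ R) :
    pbwAct b x p = ∑ i, b.repr x i • pbwOp b i p := rfl

theorem pbwAct_basis (i : ι) (p : Multiset ι →₀ R) : pbwAct b (b i) p = pbwOp b i p := by
  rw [pbwAct_apply, Finset.sum_eq_single i]
  · simp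
  · intro j _ hj; simp [hj.symm]
  · simp

theorem pbwAct_add (x y : L) (p : Multiset ι →₀ R) :
    pbwAct b (x + y) p = pbwAct b x p + pbwAct b y p := by
  simp only [pbwAct_apply, map_add, Finsupp.add_apply, add_smul, Finset.sum_add_distrib]

theorem pbwAct_smul_left (a : R) (x : L) (p : Multiset ι →₀ R) :
    pbwAct b (a • x) p = a • pbwAct b x p := by
  simp only [pbwAct_apply, map_smul, Finsupp.smul_apply, smul_eq_mul, mul_smul, Finset.smul_sum]

theorem lie_eq_sum (x : L) (a : R) : ⁅x, a⁆ = ∑ i, b.repr x i * ⁅b i, a⁆ := by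
  let f : L →ₗ[R] R :=
    { toFun := fun x => ⁅x, a⁆
      map_add' := fun x y => add_lie x y a
      map_smul' := fun c x => LieRinehartRing.lie_smul_eq_mul c a x }
  have h := congr_arg f (b.sum_repr x)
  rw [map_sum] at h
  simp only [map_smul] at h
  exact h.symm

theorem pbwAct_smul (x : L) (a : R) (p : Multiset ι →₀ R) :
    pbwAct b x (a • p) = a • pbwAct b x p + ⁅x, a⁆ • p := by
  simp only [pbwAct_apply, pbwOp_smul, smul_add, Finset.sum_add_distrib]
  congr 1
  · simp only [Finset.smul_sum, smul_smul, mul_comm]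
  · rw [lie_eq_sum b x a, Finset.sum_smul]
    simp only [smul_smul]

/-- The failure of the operators to respect brackets. -/
def pbwCurv (x y : L) (p : Multiset ι →₀ R) : Multiset ι →₀ R :=
  pbwAct b x (pbwAct b y p) - pbwAct b y (pbwAct b x p) - pbwAct b ⁅x, y⁆ p

theorem pbwCurv_add (x y : L) (p q : Multiset ι →₀ R) :
    pbwCurv b x y (p + q) = pbwCurv b x y p + pbwCurv b x y q := by
  simp only [pbwCurv, map_add]; abel

/-- Curvature is tensorial: the second derivatives of `a` cancel because the anchor respects
brackets, and the mixed terms cancel in pairs. Together with `pbwCurv_smul_left` this reduces its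
vanishing to basis vectors and multisets. -/
theorem pbwCurv_smul (x y : L) (a : R) (p : Multiset ι →₀ R) :
    pbwCurv b x y (a • p) = a • pbwCurv b x y p := by
  simp only [pbwCurv, pbwAct_smul, map_add, smul_sub, lie_lie x y a, sub_smul]
  abel

theorem pbwCurv_skew (x y : L) (p : Multiset ι →₀ R) :
    pbwCurv b x y p = - pbwCurv b y x p := by
  have h : pbwAct b ⁅x, y⁆ p = - pbwAct b ⁅y, x⁆ p := by
    rw [eq_neg_iff_add_eq_zero, ← pbwAct_add, ← lie_skew, neg_add_cancel]
    simp [pbwAct_apply]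
  simp only [pbwCurv, h]; abel

theorem pbwCurv_add_left (x x' y : L) (p : Multiset ι →₀ R) :
    pbwCurv b (x + x') y p = pbwCurv b x y p + pbwCurv b x' y p := by
  simp only [pbwCurv, pbwAct_add, add_lie, map_add]; abel

theorem pbwCurv_smul_left (a : R) (x y : L) (p : Multiset ι →₀ R) :
    pbwCurv b (a • x) y p = a • pbwCurv b x y p := by
  have h : ⁅a • x, y⁆ = a • ⁅x, y⁆ + (-⁅y, a⁆) • x := by
    rw [← lie_skew, LieRinehartRing.leibniz_smul_right, ← lie_skew y x, smul_neg, neg_smul]; abel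
  rw [pbwCurv, h, pbwAct_add, pbwAct_smul_left b (-⁅y, a⁆), neg_smul]
  simp only [pbwCurv, pbwAct_smul_left, pbwAct_smul, smul_sub]
  abel

theorem pbwCurv_eq_zero_of_basis {p : Multiset ι →₀ R} (h : ∀ i j, pbwCurv b (b i) (b j) p = 0)
    (x y : L) : pbwCurv b x y p = 0 := by
  have key : ∀ (y : L), (∀ i, pbwCurv b (b i) y p = 0) → ∀ x, pbwCurv b x y p = 0 := by
    intro y hy x
    have hx : x ∈ Submodule.span R (Set.range b) := by rw [b.span_eq]; trivial
    induction hx using Submodule.span_induction with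
    | mem x hx => obtain ⟨i, rfl⟩ := hx; exact hy i
    | zero => simpa using pbwCurv_smul_left b 0 0 y p
    | add x x' _ _ hx hx' => rw [pbwCurv_add_left, hx, hx', add_zero]
    | smul a x _ hx => rw [pbwCurv_smul_left, hx, smul_zero]
  exact key y (fun i => by rw [pbwCurv_skew, key (b i) (fun j => h j i), neg_zero]) x

theorem pbwCurv_eq_zero_of_degLE {n : ℕ}
    (h : ∀ x y (M : Multiset ι), M.card ≤ n → pbwCurv b x y (Finsupp.single M 1) = 0)
    {p : Multiset ι →₀ R} (hp : p ∈ degLE R ι n) (x y : L) : pbwCurv b x y p = 0 :=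
  degLE_induction (P := fun p => pbwCurv b x y p = 0) (by simp [pbwCurv])
    (fun p q hp hq => by rw [pbwCurv_add, hp, hq, add_zero])
    (fun a p hp => by rw [pbwCurv_smul, hp, smul_zero]) (fun M hM => h x y M hM) hp

/-- Here `j` is the minimum of `j ::ₘ N`, and the recursion that defines `e_i` on this multiset is
exactly the commutation relation. -/
theorem pbwCurv_of_le {i j : ι} {N : Multiset ι} (hij : j < i) (hj : ∀ a ∈ N, j ≤ a) :
    pbwCurv b (b i) (b j) (Finsupp.single N 1) = 0 := by
  have h1 : ∀ a ∈ i ::ₘ N, j ≤ a := fun a ha => by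
    rcases Multiset.mem_cons.1 ha with rfl | ha
    · exact hij.le
    · exact hj a ha
  have h2 : pbwOp b i (Finsupp.single (j ::ₘ N) 1) = Finsupp.single (i ::ₘ j ::ₘ N) 1
      + pbwOp b j (pbwOp b i (Finsupp.single N 1) - Finsupp.single (i ::ₘ N) 1)
      + pbwAct b ⁅b i, b j⁆ (Finsupp.single N 1) := by
    have h3 : ∀ l, pbwOp b l (Finsupp.single N (1 : R)) = pbwVal b N.card l N := fun l => by
      rw [pbwOp, connOp_single_one]
    rw [pbwAct_apply, h3, pbwOp, connOp_single_one, Multiset.card_cons,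
      pbwVal_cons_of_lt b _ hj hij]
    simp only [h3]
    congr 2
    -- The recursion uses depth `N.card` throughout, whereas `pbwOp` uses depth `K.card` on `K`.
    exact connOp_congr (fun K hK => pbwVal_eq b _ j K hK) (pbwVal_sub_mem b _ i N le_rfl)
  simp only [pbwCurv, pbwAct_basis]
  rw [pbwOp_of_le b hj, h2, map_sub, pbwOp_of_le b h1, Multiset.cons_swap]
  abel

theorem pbwAct_pbwAct {x y : L} {p : Multiset ι →₀ R} (h : pbwCurv b x y p = 0) :
    pbwAct b x (pbwAct b y p) = pbwAct b y (pbwAct b x p) + pbwAct b ⁅x, y⁆ p := by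
  rwa [pbwCurv, sub_sub, sub_eq_zero] at h

/-- The Jacobi identity: `z` is moved to the left through `x` and `y`, in both orders, and the
brackets left over recombine by `leibniz_lie`. -/
theorem pbwCurv_act {x y z : L} {p : Multiset ι →₀ R} (h : ∀ x y, pbwCurv b x y p = 0)
    (h₁ : pbwCurv b x z (pbwAct b y p) = 0) (h₂ : pbwCurv b y z (pbwAct b x p) = 0) :
    pbwCurv b x y (pbwAct b z p) = 0 := by
  have step : ∀ {x y : L}, pbwCurv b x z (pbwAct b y p) = 0 →
      pbwAct b x (pbwAct b y (pbwAct b z p))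
        = pbwAct b z (pbwAct b x (pbwAct b y p)) + pbwAct b ⁅x, z⁆ (pbwAct b y p)
          + (pbwAct b ⁅y, z⁆ (pbwAct b x p) + pbwAct b ⁅x, ⁅y, z⁆⁆ p) := fun {x y} h' => by
    rw [pbwAct_pbwAct b (h y z), map_add, pbwAct_pbwAct b h', pbwAct_pbwAct b (h x ⁅y, z⁆)]
  rw [pbwCurv, step h₁, step h₂, pbwAct_pbwAct b (h ⁅x, y⁆ z), pbwAct_pbwAct b (h x y),
    leibniz_lie x y z, pbwAct_add, map_add]
  abel

theorem pbwCurv_eq_zero (x y : L) (p : Multiset ι →₀ R) : pbwCurv b x y p = 0 := by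
  have key : ∀ n, ∀ N : Multiset ι, N.card ≤ n → ∀ x y,
      pbwCurv b x y (Finsupp.single N 1) = 0 := by
    intro n
    induction n with
    | zero =>
      intro N hN x y
      rw [Multiset.card_eq_zero.1 (Nat.le_zero.1 hN)]
      refine pbwCurv_eq_zero_of_basis b (fun i j => ?_) x y
      rcases lt_trichotomy i j with h | rfl | h
      · rw [pbwCurv_skew, pbwCurv_of_le b h (by simp), neg_zero]
      · simp [pbwCurv, pbwAct_apply]
      · exact pbwCurv_of_le b h (by simp)
    | succ n ih =>
      intro N hN x y
      have ih' : ∀ {p : Multiset ι →₀ R}, p ∈ degLE R ι n → ∀ x y, pbwCurv b x y p = 0 :=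
        fun hp => pbwCurv_eq_zero_of_degLE b (fun x y M hM => ih M hM x y) hp
      by_cases hN0 : N = 0
      · exact ih N (by simp [hN0]) x y
      obtain ⟨l, Q, rfl, hl⟩ := exists_cons_min hN0
      have hQ : Q.card ≤ n := by simpa using hN
      have hself : ∀ (x : L) (p : Multiset ι →₀ R), pbwCurv b x x p = 0 := fun x p => by
        simp [pbwCurv, pbwAct_apply]
      have hlq : pbwAct b (b l) (Finsupp.single Q 1) = Finsupp.single (l ::ₘ Q) 1 := by
        rw [pbwAct_basis, pbwOp_of_le b hl]
      refine pbwCurv_eq_zero_of_basis b (fun i j => ?_) x y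
      have hle : ∀ {i}, i ≤ l → ∀ a ∈ l ::ₘ Q, i ≤ a := fun hi a ha => by
        rcases Multiset.mem_cons.1 ha with rfl | ha
        · exact hi
        · exact hi.trans (hl a ha)
      -- When both indices exceed the minimum `l`, the multiset is written as `e_l` applied to `Q`,
      -- and the Jacobi identity trades the pair `i, j` for pairs that contain `l`.
      have main : ∀ i j, l < j → l < i →
          pbwCurv b (b i) (b j) (Finsupp.single (l ::ₘ Q) 1) = 0 := fun i j hj hi => by
        -- The vector `e_j Q` is `j ::ₘ Q` plus terms of degree at most `n`. The latter are covered
        -- by induction; on the former `l` is still minimal, so `pbwCurv_of_le` applies.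
        have hll : ∀ i j, l < j → l < i →
            pbwCurv b (b i) (b l) (pbwAct b (b j) (Finsupp.single Q 1)) = 0 := by
          intro i j hj hi
          rw [pbwAct_basis, ← sub_add_cancel (pbwOp b j (Finsupp.single Q 1))
            (Finsupp.single (j ::ₘ Q) 1), pbwCurv_add, ih' (degLE_mono hQ (pbwOp_sub_mem b j Q)),
            pbwCurv_of_le b hi (fun a ha => ?_), add_zero]
          rcases Multiset.mem_cons.1 ha with rfl | ha
          · exact hj.le
          · exact hl a ha
        rw [← hlq]
        exact pbwCurv_act b (ih Q hQ) (hll i j hj hi) (hll j i hi hj)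
      rcases lt_trichotomy i j with hij | rfl | hij
      · rw [pbwCurv_skew, neg_eq_zero]
        rcases le_or_gt i l with hi | hi
        · exact pbwCurv_of_le b hij (hle hi)
        · exact main j i hi (hi.trans hij)
      · exact hself _ _
      · rcases le_or_gt j l with hj | hj
        · exact pbwCurv_of_le b hij (hle hj)
        · exact main i j hj (hj.trans hij)
  induction p using Finsupp.induction_linear with
  | zero => simp [pbwCurv]
  | add p q hp hq => rw [pbwCurv_add, hp, hq, add_zero]
  | single M a =>
    rw [← mul_one a, ← smul_eq_mul, ← Finsupp.smul_single, pbwCurv_smul, key _ M le_rfl, smul_zero]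

end PBW

/-! ### The ordered monomials as a basis of the enveloping algebra, and their comultiplication. -/

section PBWBasis

variable {k R L : Type u} [CommRing k] [CommRing R] [Algebra k R] [LieRing L] [Module R L]
  [LieRingModule L R] [LieAlgebra k L] [LieRinehartRing R L] [LieRinehartAlgebra k R L]
  {ι : Type} [LinearOrder ι]

section action

variable [Fintype ι] (b : Module.Basis ι R L)

variable (k) in
/-- The operator of an element of `L` on the free module on multisets, as a `k`-linear map. -/
def pbwActₗ (x : L) : Module.End k (Multiset ι →₀ R) where
  toFun := pbwAct b x
  map_add' := map_add _
  map_smul' c p := by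
    have h : ⁅x, algebraMap k R c⁆ = 0 := by
      rw [Algebra.algebraMap_eq_smul_one, LieModule.lie_smul c x (1 : R), lie_one_eq_zero, smul_zero]
    rw [← algebraMap_smul R c p, pbwAct_smul, h, zero_smul, add_zero, algebraMap_smul,
      RingHom.id_apply]

/-- The representation of the enveloping algebra on the free module on multisets. -/
def pbwRep : Envel k R L →ₐ[k] Module.End k (Multiset ι →₀ R) :=
  Envel.lift (Algebra.lsmul k k (Multiset ι →₀ R))
    { toFun := pbwActₗ k b
      map_zero' := by
        refine LinearMap.ext fun p => ?_
        change pbwAct b 0 p = 0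
        simp [pbwAct_apply]
      map_add' := fun x y => by
        refine LinearMap.ext fun p => ?_
        change pbwAct b (x + y) p = pbwAct b x p + pbwAct b y p
        exact pbwAct_add b x y p }
    (fun a x => by
      refine LinearMap.ext fun p => ?_
      change pbwAct b (a • x) p = a • pbwAct b x p
      exact pbwAct_smul_left b a x p)
    (fun x y => by
      refine LinearMap.ext fun p => ?_
      change pbwAct b ⁅x, y⁆ p = pbwAct b x (pbwAct b y p) - pbwAct b y (pbwAct b x p)
      have h := pbwCurv_eq_zero b x y p
      rw [pbwCurv, sub_eq_zero] at h
      exact h.symm)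
    (fun x a => by
      refine LinearMap.ext fun p => ?_
      change ⁅x, a⁆ • p = pbwAct b x (a • p) - a • pbwAct b x p
      rw [pbwAct_smul, add_sub_cancel_left])

theorem pbwRep_incl (a : R) (p : Multiset ι →₀ R) : pbwRep (k := k) b (Envel.incl k R L a) p = a • p := by
  rw [pbwRep, Envel.lift_incl]; rfl

theorem pbwRep_lie (x : L) (p : Multiset ι →₀ R) :
    pbwRep b (Envel.lie k R L x) p = pbwAct b x p := by
  rw [pbwRep, Envel.lift_lie]; rfl

/-- The coefficients of an element of the enveloping algebra with respect to ordered monomials. -/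
def pbwCoeff : Envel k R L →ₗ[R] (Multiset ι →₀ R) where
  toFun D := pbwRep b D (Finsupp.single 0 1)
  map_add' D E := by rw [map_add]; rfl
  map_smul' a D := by rw [Envel.smul_def, map_mul, Module.End.mul_apply, pbwRep_incl]; rfl

end action

variable (k) in
/-- The ordered monomials in the enveloping algebra. -/
def monom (e : ι → L) (M : Multiset ι) : Envel k R L :=
  ((M.sort (· ≤ ·)).map fun i => Envel.lie k R L (e i)).prod

theorem monom_zero (e : ι → L) : monom k e 0 = (1 : Envel k R L) := by
  rw [monom, Multiset.sort_zero]; rfl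

theorem monom_cons (e : ι → L) {l : ι} {N : Multiset ι} (h : ∀ a ∈ N, l ≤ a) :
    (monom k e (l ::ₘ N) : Envel k R L) = Envel.lie k R L (e l) * monom k e N := by
  rw [monom, Multiset.sort_cons _ _ _ h]; rfl

theorem map_monom {R' L' : Type u} [CommRing R'] [Algebra k R'] [LieRing L'] [Module R' L']
    [LieRingModule L' R'] [LieAlgebra k L'] (σ : R →ₐ[k] R') (F : L →ₗ⁅σ⁆ L') (e : ι → L)
    (M : Multiset ι) :
    Envel.map σ F (monom k e M) = monom k (fun i => F (e i)) M := by
  rw [monom, monom, map_list_prod, List.map_map]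
  congr 2
  funext i
  exact Envel.map_lie σ F (e i)

/-- An ordered monomial acts on the empty multiset by adding its letters from the largest to the
smallest; each new letter is minimal, so no correction term appears. This is the independence half
of the theorem. -/
theorem pbwCoeff_monom [Fintype ι] (b : Module.Basis ι R L) (M : Multiset ι) :
    pbwCoeff b (monom k b M) = Finsupp.single M 1 := by
  induction M using cons_min_induction with
  | zero => rw [monom_zero]; change pbwRep b 1 _ = _; rw [map_one]; rfl
  | cons l N h ih =>
    rw [monom_cons _ h]
    change pbwRep b (_ * _) _ = _
    rw [map_mul, Module.End.mul_apply, pbwRep_lie, pbwAct_basis]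
    change pbwOp b l (pbwCoeff b _) = _
    rw [ih, pbwOp_of_le b h]

section span

variable [Fintype ι] (b : Module.Basis ι R L)

variable (k) in
/-- The span of the ordered monomials of degree at most `n`. -/
abbrev monomSpan (n : ℕ) : Submodule R (Envel k R L) :=
  Submodule.span R (monom k b '' {M : Multiset ι | M.card ≤ n})

theorem monomSpan_mono {m n : ℕ} (h : m ≤ n) : monomSpan k b m ≤ monomSpan k b n :=
  Submodule.span_mono (Set.image_mono fun _ hM => le_trans hM h)

theorem lie_mul_mem {n : ℕ} {x : L}
    (h : ∀ M : Multiset ι, M.card ≤ n → Envel.lie k R L x * monom k b M ∈ monomSpan k b (n + 1))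
    {D : Envel k R L} (hD : D ∈ monomSpan k b n) :
    Envel.lie k R L x * D ∈ monomSpan k b (n + 1) := by
  induction hD using Submodule.span_induction with
  | mem D hD => obtain ⟨M, hM, rfl⟩ := hD; exact h M hM
  | zero => rw [mul_zero]; exact zero_mem _
  | add D E _ _ hD hE => rw [mul_add]; exact add_mem hD hE
  | smul a D hD' hD =>
    have := Envel.lie_mul_smul (k := k) x a D
    simp only [AddMonoidHom.coe_mulLeft] at this
    rw [this]
    exact add_mem (Submodule.smul_mem _ _ hD)
      (Submodule.smul_mem _ _ (monomSpan_mono b (Nat.le_succ n) hD'))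

theorem lie_eq_sum_lie (x : L) :
    Envel.lie k R L x = ∑ i, b.repr x i • Envel.lie k R L (b i) := by
  conv_lhs => rw [← b.sum_repr x, map_sum]
  exact Finset.sum_congr rfl fun i _ => Envel.lie_smul _ _

/-- Straightening, parallel to the definition of `pbwVal`: if `l` is the minimum and `l < i`, then
`e_i e_l = e_l e_i + [e_i, e_l]`. By induction `e_i` times the monomial of `N` is the ordered
monomial up to degree `N.card`, and multiplication by `e_l` raises this bound by one. -/
theorem lie_mul_monom_sub_mem (i : ι) (M : Multiset ι) :
    Envel.lie k R L (b i) * monom k b M - monom k b (i ::ₘ M) ∈ monomSpan k b M.card := by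
  induction h : M.card using Nat.strong_induction_on generalizing i M with
  | h n ih =>
  subst h
  by_cases hM : M = 0
  · subst hM
    rw [monom_cons _ (by simp), sub_self]; exact zero_mem _
  obtain ⟨l, N, rfl, hl⟩ := exists_cons_min hM
  have hle : ∀ {j}, j ≤ l → ∀ a ∈ l ::ₘ N, j ≤ a := fun hj a ha => by
    rcases Multiset.mem_cons.1 ha with rfl | ha
    · exact hj
    · exact hj.trans (hl a ha)
  rcases le_or_gt i l with hi | hi
  · rw [monom_cons (l := i) _ (hle hi), sub_self]; exact zero_mem _
  have hN : ∀ j, ∀ K : Multiset ι, K.card ≤ N.card →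
      Envel.lie k R L (b j) * monom k b K ∈ monomSpan k b (N.card + 1) := fun j K hK => by
    rw [← sub_add_cancel (Envel.lie k R L (b j) * monom k b K) (monom k b (j ::ₘ K))]
    refine add_mem (monomSpan_mono b (by omega)
      (ih K.card (by rw [Multiset.card_cons]; omega) j K rfl)) (Submodule.subset_span ⟨_, ?_, rfl⟩)
    simpa using hK
  have h1 : monom k b (i ::ₘ l ::ₘ N) = Envel.lie k R L (b l) * monom k b (i ::ₘ N) := by
    rw [Multiset.cons_swap, monom_cons]
    intro a ha
    rcases Multiset.mem_cons.1 ha with rfl | ha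
    · exact hi.le
    · exact hl a ha
  have h2 : Envel.lie k R L (b i) * monom k b (l ::ₘ N) - monom k b (i ::ₘ l ::ₘ N)
      = Envel.lie k R L (b l) * (Envel.lie k R L (b i) * monom k b N - monom k b (i ::ₘ N))
        + Envel.lie k R L ⁅b i, b l⁆ * monom k b N := by
    rw [h1, monom_cons _ hl, Envel.lie_lie, mul_sub, sub_mul]
    simp only [mul_assoc]
    abel
  rw [h2, Multiset.card_cons]
  refine add_mem (lie_mul_mem b (hN l)
    (ih N.card (by rw [Multiset.card_cons]; omega) i N rfl)) ?_
  rw [lie_eq_sum_lie b, Finset.sum_mul]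
  refine sum_mem fun j _ => ?_
  have : b.repr ⁅b i, b l⁆ j • Envel.lie k R L (b j) * monom k b N
      = b.repr ⁅b i, b l⁆ j • (Envel.lie k R L (b j) * monom k b N) := mul_assoc _ _ _
  rw [this]
  exact Submodule.smul_mem _ _ (hN j N le_rfl)

theorem lie_mul_monom_mem (i : ι) (M : Multiset ι) {n : ℕ} (h : M.card ≤ n) :
    Envel.lie k R L (b i) * monom k b M ∈ monomSpan k b (n + 1) := by
  rw [← sub_add_cancel (Envel.lie k R L (b i) * monom k b M) (monom k b (i ::ₘ M))]
  refine add_mem (monomSpan_mono b (by omega) (lie_mul_monom_sub_mem b i M))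
    (Submodule.subset_span ⟨_, ?_, rfl⟩)
  simpa using h

theorem exists_mem_monomSpan (D : Envel k R L) : ∃ n, D ∈ monomSpan k b n := by
  induction D using Envel.induction_left with
  | one => exact ⟨0, Submodule.subset_span ⟨0, by simp, monom_zero b⟩⟩
  | add D E hD hE =>
    obtain ⟨m, hm⟩ := hD
    obtain ⟨n, hn⟩ := hE
    exact ⟨m + n, add_mem (monomSpan_mono b (by omega) hm) (monomSpan_mono b (by omega) hn)⟩
  | incl_mul a D hD => exact hD.imp fun n hn => Submodule.smul_mem _ a hn
  | lie_mul x D hD =>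
    obtain ⟨n, hn⟩ := hD
    refine ⟨n + 1, ?_⟩
    rw [lie_eq_sum_lie b, Finset.sum_mul]
    refine sum_mem fun j _ => ?_
    have : b.repr x j • Envel.lie k R L (b j) * D
        = b.repr x j • (Envel.lie k R L (b j) * D) := mul_assoc _ _ _
    rw [this]
    exact Submodule.smul_mem _ _ (lie_mul_mem b (fun M hM => lie_mul_monom_mem b j M hM) hn)

theorem span_monom_eq_top : Submodule.span R (Set.range (monom k b : Multiset ι → Envel k R L)) = ⊤ :=
  eq_top_iff.2 fun D _ => by
    obtain ⟨n, hn⟩ := exists_mem_monomSpan b D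
    exact Submodule.span_mono (Set.image_subset_range _ _) hn

end span

section comul

open Coalgebra

/-- The comultiplication of ordered monomials. -/
theorem comul_monom (e : ι → L) (M : Multiset ι) :
    comul (R := R) (monom k e M : Envel k R L)
      = (M.antidiagonal.map fun A => monom k e A.1 ⊗ₜ[R] monom k e A.2).sum := by
  induction M using cons_min_induction with
  | zero => simp [monom_zero]
  | cons l N h ih =>
    rw [monom_cons _ h, Envel.comul_lie_mul, ih, map_multiset_sum, Multiset.map_map,
      Multiset.antidiagonal_cons, Multiset.map_add, Multiset.sum_add, Multiset.map_map,
      Multiset.map_map, ← Multiset.sum_map_add]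
    refine congr_arg _ (Multiset.map_congr rfl fun A hA => ?_)
    rw [Multiset.mem_antidiagonal] at hA
    -- A letter that is minimal in `N` is minimal in both parts of a splitting, so prefixing it to
    -- either part gives an ordered monomial again.
    have h1 : ∀ a ∈ A.1, l ≤ a := fun a ha => h a (by rw [← hA]; exact Multiset.mem_add.2 (Or.inl ha))
    have h2 : ∀ a ∈ A.2, l ≤ a := fun a ha => h a (by rw [← hA]; exact Multiset.mem_add.2 (Or.inr ha))
    simp only [Function.comp_apply, Envel.lieTensor_tmul, Prod.map_fst, Prod.map_snd, id,
      monom_cons _ h1, monom_cons _ h2]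
    rw [add_comm]

theorem counit_monom (e : ι → L) (M : Multiset ι) :
    counit (R := R) (monom k e M : Envel k R L) = if M = 0 then 1 else 0 := by
  induction M using cons_min_induction with
  | zero => simp [monom_zero]
  | cons l N h ih =>
    rw [monom_cons _ h, Envel.counit_lie_mul, ih, if_neg (Multiset.cons_ne_zero)]
    split_ifs
    · exact lie_one_eq_zero _
    · exact lie_zero _

end comul

end PBWBasis

/-! ### Jets on an object with a frame -/

theorem antidiagonal_sum_zero {ι A : Type*} [DecidableEq ι] [AddCommMonoid A] (b : Multiset ι → A)
    (M : Multiset ι) : (M.antidiagonal.map fun A => if A.1 = 0 then b A.2 else 0).sum = b M := by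
  induction M using Multiset.induction_on generalizing b with
  | empty => simp
  | cons a M ih =>
    rw [Multiset.antidiagonal_cons, Multiset.map_add, Multiset.sum_add, Multiset.map_map,
      Multiset.map_map]
    simp only [Function.comp_def, Prod.map_fst, Prod.map_snd, id, Multiset.cons_ne_zero, if_false,
      Multiset.map_const', Multiset.sum_replicate, smul_zero, add_zero]
    exact ih fun B => b (a ::ₘ B)

/-- The antidiagonal lists splittings with multiplicity, so `{j}` is split off once for each copy of
`j` in `M`. This integer coefficient is what later has to be inverted. -/
theorem antidiagonal_sum_singleton {ι A : Type*} [DecidableEq ι] [AddCommMonoid A] (j : ι)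
    (b : Multiset ι → A) (M : Multiset ι) :
    (M.antidiagonal.map fun A => if A.1 = {j} then b A.2 else 0).sum
      = M.count j • b (M.erase j) := by
  induction M using Multiset.induction_on generalizing b with
  | empty => simp
  | cons a M ih =>
    have h1 : ∀ A : Multiset ι, (a ::ₘ A = {j}) ↔ (a = j ∧ A = 0) := fun A => by
      rw [← Multiset.cons_zero j, Multiset.cons_eq_cons]
      constructor
      · rintro (h | ⟨-, _, -, h⟩)
        · exact h
        · exact absurd h.symm Multiset.cons_ne_zero
      · exact Or.inl
    rw [Multiset.antidiagonal_cons, Multiset.map_add, Multiset.sum_add, Multiset.map_map,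
      Multiset.map_map]
    simp only [Function.comp_def, Prod.map_fst, Prod.map_snd, id, h1]
    rw [ih fun B => b (a ::ₘ B)]
    by_cases ha : a = j
    · subst ha
      simp only [true_and]
      rw [antidiagonal_sum_zero, Multiset.count_cons_self, Multiset.erase_cons_head, succ_nsmul]
      congr 1
      by_cases hM : a ∈ M
      · rw [Multiset.cons_erase hM]
      · rw [Multiset.count_eq_zero_of_notMem hM, zero_smul, zero_smul]
    · rw [Multiset.count_cons_of_ne (Ne.symm ha), Multiset.erase_cons_tail M ha]
      simp [ha]

namespace LieAlgebroid

section Frame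

variable {C : Type u} [SmallCategory C] {T : GrothendieckTopology C} {k : Type u} [Field k]
  {O : Sheaf T (CommAlgCat.{u} k)} {L : LieAlgebroid O}

/-- `e` is a basis of sections of `L` over `V` and remains so under restriction. -/
def IsFrame {d : ℕ} {V : C} (e : Fin d → L.sec V) : Prop :=
  ∀ ⦃W : C⦄ (g : W ⟶ V), LinearIndependent (fn O W) (fun i => L.res g (e i)) ∧
    Submodule.span (fn O W) (Set.range fun i => L.res g (e i)) = ⊤

variable {d : ℕ} {V : C} {e : Fin d → L.sec V}

/-- The restriction of a frame. -/
def IsFrame.basis (he : IsFrame e) {W : C} (g : W ⟶ V) :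
    Module.Basis (Fin d) (fn O W) (L.sec W) :=
  Module.Basis.mk (he g).1 (he g).2.ge

theorem IsFrame.basis_apply (he : IsFrame e) {W : C} (g : W ⟶ V) :
    (he.basis g : Fin d → L.sec W) = fun i => L.res g (e i) := Module.Basis.coe_mk _ _

variable (e) in
/-- The ordered monomials in a restricted frame. -/
def frameMonom {W : C} (g : W ⟶ V) (M : Multiset (Fin d)) : L.Env W :=
  monom k (fun i => L.res g (e i)) M

theorem envRes_frameMonom {W W' : C} (g : W ⟶ V) (h : W' ⟶ W) (M : Multiset (Fin d)) :
    L.envRes h (frameMonom e g M) = frameMonom e (h ≫ g) M := by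
  rw [frameMonom, envRes, map_monom, frameMonom]
  simp only [L.res_comp]

theorem IsFrame.frameMonom_eq (he : IsFrame e) {W : C} (g : W ⟶ V) (M : Multiset (Fin d)) :
    frameMonom e g M = monom k (he.basis g) M := by
  rw [he.basis_apply, frameMonom]

theorem IsFrame.span_frameMonom (he : IsFrame e) {W : C} (g : W ⟶ V) :
    Submodule.span (fn O W) (Set.range (frameMonom e g : _ → L.Env W)) = ⊤ := by
  rw [← span_monom_eq_top (k := k) (he.basis g)]
  congr 2
  funext M
  exact he.frameMonom_eq g M

/-- The functional on the enveloping algebra with prescribed values on ordered monomials. -/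
def IsFrame.functional (he : IsFrame e) {W : C} (g : W ⟶ V) (c : Multiset (Fin d) → fn O W) :
    L.Env W →ₗ[fn O W] fn O W :=
  (Finsupp.linearCombination (fn O W) c).comp (pbwCoeff (he.basis g))

theorem IsFrame.functional_frameMonom (he : IsFrame e) {W : C} (g : W ⟶ V)
    (c : Multiset (Fin d) → fn O W) (M : Multiset (Fin d)) :
    he.functional g c (frameMonom e g M) = c M := by
  rw [he.frameMonom_eq, functional, LinearMap.comp_apply, pbwCoeff_monom,
    Finsupp.linearCombination_single, one_smul]

/-- The jet with prescribed values on ordered monomials. -/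
def IsFrame.jet (he : IsFrame e) {W : C} (g : W ⟶ V) (c : Multiset (Fin d) → fn O W) : L.Jet W :=
  Jet.ofFamily (fun _ h => he.functional (h ≫ g) fun M => fnRes O h (c M))
    (fun W₁ W₂ f h D => by
      -- Monomials span and restrict to monomials, so compatibility with restriction only has to be
      -- tested on them.
      have hD : D ∈ Submodule.span (fn O W₁) (Set.range (frameMonom e (f ≫ g) : _ → L.Env W₁)) := by
        rw [he.span_frameMonom]; trivial
      induction hD using Submodule.span_induction with
      | mem D hD =>
        obtain ⟨M, rfl⟩ := hD
        rw [he.functional_frameMonom, envRes_frameMonom, ← Category.assoc,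
          he.functional_frameMonom, fnRes_comp]
      | zero => simp only [map_zero]
      | add D E _ _ hD hE => simp only [map_add, hD, hE]
      | smul a D _ hD =>
        have h₁ : L.envRes h (a • D) = fnRes O h a • L.envRes h D :=
          LinearMap.map_smulₛₗ (L.envResₛₗ h) a D
        rw [h₁, LinearMap.map_smul, LinearMap.map_smul, smul_eq_mul, smul_eq_mul, map_mul, hD])

theorem IsFrame.jet_eval (he : IsFrame e) {W W' : C} (g : W ⟶ V) (c : Multiset (Fin d) → fn O W)
    (h : W' ⟶ W) (M : Multiset (Fin d)) :
    (he.jet g c).eval h (frameMonom e (h ≫ g) M) = fnRes O h (c M) := by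
  rw [jet, Jet.eval_ofFamily, functional_frameMonom]

variable (e) in
/-- The values of a jet on ordered monomials. -/
def jetCoeff {W : C} (g : W ⟶ V) (α : L.Jet W) (M : Multiset (Fin d)) : fn O W :=
  α.eval (𝟙 W) (frameMonom e g M)

theorem IsFrame.jetCoeff_jet (he : IsFrame e) {W : C} (g : W ⟶ V)
    (c : Multiset (Fin d) → fn O W) : jetCoeff e g (he.jet g c) = c := by
  funext M
  have h := he.jet_eval g c (𝟙 W) M
  rw [Category.id_comp, fnRes_id] at h
  exact h

theorem jet_eval_frameMonom {W W' : C} (g : W ⟶ V) (α : L.Jet W) (h : W' ⟶ W)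
    (M : Multiset (Fin d)) : α.eval h (frameMonom e (h ≫ g) M) = fnRes O h (jetCoeff e g α M) := by
  have h' := α.eval_res (𝟙 W) h (frameMonom e g M)
  rwa [Category.comp_id, envRes_frameMonom] at h'

theorem jetCoeff_res {W W' : C} (g : W ⟶ V) (α : L.Jet W) (h : W' ⟶ W)
    (M : Multiset (Fin d)) :
    jetCoeff e (h ≫ g) (Jet.res h α) M = fnRes O h (jetCoeff e g α M) := by
  rw [← jet_eval_frameMonom, jetCoeff, Jet.res_eval, Category.id_comp]

/-- A jet is a family indexed by all arrows into `W`, but its values on monomials over those arrows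
are restrictions of its values over `W`. -/
theorem IsFrame.jet_ext (he : IsFrame e) {W : C} (g : W ⟶ V) {α β : L.Jet W}
    (h : ∀ M, jetCoeff e g α M = jetCoeff e g β M) : α = β := by
  refine Jet.ext fun W' f D => ?_
  refine LinearMap.congr_fun (LinearMap.ext_on (he.span_frameMonom (f ≫ g)) ?_) D
  rintro _ ⟨M, rfl⟩
  rw [jet_eval_frameMonom, jet_eval_frameMonom, h]

theorem IsFrame.res_jet (he : IsFrame e) {W W' : C} (g : W ⟶ V) (c : Multiset (Fin d) → fn O W)
    (h : W' ⟶ W) : Jet.res h (he.jet g c) = he.jet (h ≫ g) fun M => fnRes O h (c M) :=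
  he.jet_ext (h ≫ g) fun M => by rw [jetCoeff_res, he.jetCoeff_jet, he.jetCoeff_jet]

/-- By `comul_monom`, jets multiply like the families of derivatives of formal power series in `d`
variables. -/
theorem jetCoeff_mul {W : C} (g : W ⟶ V) (α β : L.Jet W) (M : Multiset (Fin d)) :
    jetCoeff e g (α * β) M
      = (M.antidiagonal.map fun A => jetCoeff e g α A.1 * jetCoeff e g β A.2).sum := by
  rw [jetCoeff, Jet.eval_mul, frameMonom, comul_monom, map_multiset_sum, map_multiset_sum,
    Multiset.map_map, Multiset.map_map]
  rfl

theorem jetCoeff_add {W : C} (g : W ⟶ V) (α β : L.Jet W) (M : Multiset (Fin d)) :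
    jetCoeff e g (α + β) M = jetCoeff e g α M + jetCoeff e g β M := rfl

theorem jetCoeff_sum {W : C} (g : W ⟶ V) {κ : Type*} (s : Finset κ) (α : κ → L.Jet W)
    (M : Multiset (Fin d)) : jetCoeff e g (∑ i ∈ s, α i) M = ∑ i ∈ s, jetCoeff e g (α i) M :=
  map_sum (AddMonoidHom.mk' (fun α => jetCoeff e g α M) fun _ _ => rfl) _ _

theorem jetCoeff_algebraMap_mul {W : C} (g : W ⟶ V) (a : fn O W) (α : L.Jet W)
    (M : Multiset (Fin d)) : jetCoeff e g (algebraMap (fn O W) (L.Jet W) a * α) M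
      = a * jetCoeff e g α M := by
  have h : ∀ B, jetCoeff e g (algebraMap (fn O W) (L.Jet W) a) B = if B = 0 then a else 0 := by
    intro B
    rw [jetCoeff, Jet.algebraMap_eval, fnRes_id, frameMonom, counit_monom]
    split_ifs <;> simp
  simp only [jetCoeff_mul, h, ite_mul, zero_mul]
  exact antidiagonal_sum_zero (fun B => a * jetCoeff e g α B) M

theorem jetCoeff_smul {W : C} (g : W ⟶ V) (a : fn O W) (α : L.Jet W)
    (M : Multiset (Fin d)) : jetCoeff e g (a • α) M = a * jetCoeff e g α M := by
  rw [Algebra.smul_def, jetCoeff_algebraMap_mul]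

/-- The jets that form the dual basis of the ordered monomials. -/
def IsFrame.dual (he : IsFrame e) {W : C} (g : W ⟶ V) (M : Multiset (Fin d)) : L.Jet W :=
  he.jet g fun K => if K = M then 1 else 0

theorem IsFrame.res_dual (he : IsFrame e) {W W' : C} (g : W ⟶ V) (h : W' ⟶ W)
    (M : Multiset (Fin d)) : Jet.res h (he.dual g M) = he.dual (h ≫ g) M := by
  rw [dual, he.res_jet, dual]
  congr 1; funext K
  split_ifs <;> simp

theorem IsFrame.jetCoeff_dual (he : IsFrame e) {W : C} (g : W ⟶ V) (M K : Multiset (Fin d)) :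
    jetCoeff e g (he.dual g M) K = if K = M then 1 else 0 := by
  rw [dual, he.jetCoeff_jet]

theorem jetCoeff_zero {W : C} (g : W ⟶ V) (α : L.Jet W) :
    jetCoeff e g α 0 = Jet.counit W α := by
  rw [jetCoeff, frameMonom, monom_zero]; rfl

/-- The jet `he.dual g {j}` plays the part of the `j`-th coordinate function. -/
theorem IsFrame.jetCoeff_dual_mul (he : IsFrame e) {W : C} (g : W ⟶ V) (j : Fin d) (β : L.Jet W)
    (M : Multiset (Fin d)) : jetCoeff e g (he.dual g {j} * β) M
      = M.count j • jetCoeff e g β (M.erase j) := by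
  simp only [jetCoeff_mul, he.jetCoeff_dual, ite_mul, one_mul, zero_mul]
  exact antidiagonal_sum_singleton j (jetCoeff e g β) M

variable [CharZero k]

/-- A jet that vanishes on monomials of small degree belongs to a power of the augmentation
ideal. -/
theorem IsFrame.mem_augIdeal_pow (he : IsFrame e) {W : C} (g : W ⟶ V) (q : ℕ) (α : L.Jet W)
    (h : ∀ M : Multiset (Fin d), M.card < q → jetCoeff e g α M = 0) :
    α ∈ Jet.augIdeal L W ^ q := by
  induction q generalizing α with
  | zero => rw [pow_zero, Ideal.one_eq_top]; trivial
  | succ q ih =>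
    -- Euler's formula writes `α` as the sum of the coordinates times the `β j`: the coefficient at
    -- `M` is multiplied by the sum of the `M.count j`, which is `M.card`, and divided by `M.card`.
    -- Characteristic zero enters here.
    let β : Fin d → L.Jet W := fun j =>
      he.jet g fun K => ((K.card + 1 : ℕ) : k)⁻¹ • jetCoeff e g α (j ::ₘ K)
    have hα : α = ∑ j, he.dual g {j} * β j := by
      refine he.jet_ext g fun M => ?_
      rw [jetCoeff_sum]
      simp only [he.jetCoeff_dual_mul, β, he.jetCoeff_jet]
      by_cases hM : M = 0
      · subst hM
        rw [h 0 (by simp)]; simp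
      have h0 : ((M.card : ℕ) : k) ≠ 0 := Nat.cast_ne_zero.2 (by simpa using hM)
      have h1 : ∀ j, M.count j • (((M.erase j).card + 1 : ℕ) : k)⁻¹ •
          jetCoeff e g α (j ::ₘ M.erase j) = (M.count j : k) • ((M.card : k)⁻¹ • jetCoeff e g α M) := by
        intro j
        rw [Nat.cast_smul_eq_nsmul]
        by_cases hj : j ∈ M
        · rw [Multiset.cons_erase hj, Multiset.card_erase_add_one hj]
        · rw [Multiset.count_eq_zero_of_notMem hj, zero_smul, zero_smul]
      rw [Finset.sum_congr rfl fun j _ => h1 j, ← Finset.sum_smul, ← Nat.cast_sum,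
        Multiset.sum_count_eq_card (fun _ _ => Finset.mem_univ _), smul_smul, mul_inv_cancel₀ h0,
        one_smul]
    rw [hα, pow_succ']
    refine sum_mem fun j _ => Ideal.mul_mem_mul ?_ (ih _ fun M hM => ?_)
    · change Jet.counit W _ = 0
      rw [← jetCoeff_zero (e := e) g, he.jetCoeff_dual, if_neg (Ne.symm (Multiset.singleton_ne_zero j))]
    · simp only [β, he.jetCoeff_jet]
      rw [h _ (by rw [Multiset.card_cons]; omega), smul_zero]

/-- Taylor expansion of a jet. -/
theorem IsFrame.sub_sum_dual_mem (he : IsFrame e) {W : C} (g : W ⟶ V) (q : ℕ)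
    (s : Finset (Multiset (Fin d))) (hs : ∀ M : Multiset (Fin d), M.card < q → M ∈ s)
    (α : L.Jet W) : α - ∑ M ∈ s, jetCoeff e g α M • he.dual g M ∈ Jet.augIdeal L W ^ q := by
  refine he.mem_augIdeal_pow g q _ fun M hM => ?_
  rw [sub_eq_add_neg, jetCoeff_add, ← neg_one_smul (fn O W), jetCoeff_smul, jetCoeff_sum]
  simp only [jetCoeff_smul, he.jetCoeff_dual, mul_ite, mul_one, mul_zero, Finset.sum_ite_eq,
    if_pos (hs M hM)]
  ring

end Frame

end LieAlgebroid

/-! ### Tensors of jets are dense in the completed bar complex -/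

theorem actFirst_algebraMap {R A : Type*} [CommRing R] [CommRing A] [Algebra R A] (p : ℕ) (r : R)
    (x : TPow R A (p + 1)) : actFirst R p (algebraMap R A r) x = r • x := by
  have h : actFirst R p (algebraMap R A r) x
      = PiTensorProduct.singleAlgHom (R := R) (A := fun _ : Fin (p + 1) => A) 0
        (algebraMap R A r) * x := rfl
  rw [h, AlgHom.commutes, Algebra.smul_def]

/-- Induction on tensors, with pure tensors and sums. -/
theorem tens_induction {R A : Type*} [CommRing R] [CommRing A] [Algebra R A] {p : ℕ}
    {P : TPow R A (p + 1) → Prop} (tprod : ∀ m, P (PiTensorProduct.tprod R m))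
    (add : ∀ x y, P x → P y → P (x + y)) (x : TPow R A (p + 1)) : P x := by
  induction x using PiTensorProduct.induction_on with
  | smul_tprod r m => rw [← actFirst_algebraMap, actFirst_tprod]; exact tprod _
  | add x y hx hy => exact add x y hx hy

/-- The kernel of the map induced on tensor powers by a surjective map is spanned by the pure
tensors one factor of which is in the kernel. -/
theorem mem_span_of_tensMap_eq_zero {R A B : Type*} [CommRing R] [AddCommGroup A] [Module R A]
    [AddCommGroup B] [Module R B] (g : A →ₗ[R] B) (hg : Function.Surjective g) {ι : Type*}
    [Finite ι] {t : ⨂[R] _ : ι, A} (ht : tensMap g t = 0) :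
    t ∈ Submodule.span R {x : ⨂[R] _ : ι, A |
      ∃ (α : ι → A) (i : ι), g (α i) = 0 ∧ x = PiTensorProduct.tprod R α} := by
  classical
  set K := Submodule.span R {x : ⨂[R] _ : ι, A |
      ∃ (α : ι → A) (i : ι), g (α i) = 0 ∧ x = PiTensorProduct.tprod R α}
  -- Modulo `K` a pure tensor depends only on the images of its factors. A choice of preimages
  -- therefore gives a multilinear map on `B`, and its lift composed with `tensMap g` is the
  -- quotient map by `K`.
  let F : MultilinearMap R (fun _ : ι => A) ((⨂[R] _ : ι, A) ⧸ K) :=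
    K.mkQ.compMultilinearMap (PiTensorProduct.tprod R)
  have hF0 : ∀ (α : ι → A) i, g (α i) = 0 → F α = 0 := fun α i h =>
    (Submodule.Quotient.mk_eq_zero K).2 (Submodule.subset_span ⟨α, i, h, rfl⟩)
  have hF1 : ∀ (α : ι → A) i x, g x = g (α i) → F (Function.update α i x) = F α := by
    intro α i x h
    have h2 := hF0 (Function.update α i (x - α i)) i (by simp [h])
    rw [F.map_update_sub, sub_eq_zero, Function.update_eq_self] at h2
    exact h2
  have hF : ∀ α β : ι → A, (∀ i, g (α i) = g (β i)) → F α = F β := by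
    intro α β h
    have := Fintype.ofFinite ι
    -- The factors are exchanged one at a time.
    have key : ∀ s : Finset ι, F (fun i => if i ∈ s then α i else β i) = F β := by
      intro s
      induction s using Finset.induction_on with
      | empty => simp
      | insert a s ha ih =>
        rw [← ih]
        have : (fun i => if i ∈ insert a s then α i else β i)
            = Function.update (fun i => if i ∈ s then α i else β i) a (α a) := by
          funext i
          by_cases hi : i = a
          · subst hi; simp
          · simp [hi]
        rw [this]
        exact hF1 _ _ _ (by simp [ha, h])
    simpa using key Finset.univ
  have hs : ∀ y, g (Function.surjInv hg y) = y := Function.surjInv_eq hg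
  let G : MultilinearMap R (fun _ : ι => B) ((⨂[R] _ : ι, A) ⧸ K) :=
    MultilinearMap.mk' (fun m => F fun i => Function.surjInv hg (m i))
      (fun m i x y => by
        have h : ∀ z, F (fun j => Function.surjInv hg (Function.update m i z j))
            = F (Function.update (fun j => Function.surjInv hg (m j)) i (Function.surjInv hg z)) :=
          fun z => hF _ _ fun j => by
            by_cases hj : j = i
            · subst hj; simp
            · simp [hj]
        rw [h, h, h, ← F.map_update_add]
        exact hF _ _ fun j => by
          by_cases hj : j = i
          · subst hj; simp [hs]
          · simp [hj])
      (fun m i c x => by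
        have h : ∀ z, F (fun j => Function.surjInv hg (Function.update m i z j))
            = F (Function.update (fun j => Function.surjInv hg (m j)) i (Function.surjInv hg z)) :=
          fun z => hF _ _ fun j => by
            by_cases hj : j = i
            · subst hj; simp
            · simp [hj]
        rw [h, h, ← F.map_update_smul]
        exact hF _ _ fun j => by
          by_cases hj : j = i
          · subst hj; simp [hs]
          · simp [hj])
  have h : (PiTensorProduct.lift G).comp (tensMap g) = K.mkQ := by
    apply tens_ext
    intro m
    rw [LinearMap.comp_apply, tensMap_tprod, PiTensorProduct.lift.tprod]
    exact hF _ m fun i => hs _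
  have h2 := LinearMap.congr_fun h t
  rw [LinearMap.comp_apply, ht, map_zero] at h2
  exact (Submodule.Quotient.mk_eq_zero K).1 h2.symm

/-- Used when choices are made in succession, each of them available only after a further
refinement: a bound for continuity, then an approximating tensor. -/
theorem cover_trans {C : Type u} [SmallCategory C] {T : GrothendieckTopology C} {V : C}
    {P : ∀ ⦃W : C⦄, (W ⟶ V) → Prop} {S : Sieve V} (hS : S ∈ T V)
    (h : ∀ ⦃W : C⦄ (g : W ⟶ V), S g → ∃ S' ∈ T W, ∀ ⦃W' : C⦄ (g' : W' ⟶ W), S' g' →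
      P (g' ≫ g)) : ∃ S' ∈ T V, ∀ ⦃W : C⦄ (g : W ⟶ V), S' g → P g := by
  choose! S' hS' h' using h
  refine ⟨Sieve.bind S.arrows fun W g _ => S' g, T.bind_covering hS fun W g hg => hS' g hg, ?_⟩
  rintro W _ ⟨W', g', g, hg, hg', rfl⟩
  exact h' g hg g' hg'

namespace LieAlgebroid

section Dense

variable {C : Type u} [SmallCategory C] {T : GrothendieckTopology C} {k : Type u} [Field k]
  {O : Sheaf T (CommAlgCat.{u} k)} {L : LieAlgebroid O}

/-- The projection of tensors of jets to the level `q`. -/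
abbrev jetTensMk (L : LieAlgebroid O) (p q : ℕ) (U : C) :
    TPow (fn O U) (L.Jet U) (p + 1) →ₗ[fn O U] TPow (fn O U) (L.JetQ q U) (p + 1) :=
  tensMap (σ := RingHom.id (fn O U))
    (semilin (Ideal.Quotient.mk (Jet.augIdeal L U ^ (q + 1))) (fun _ => rfl))

/-- Restriction of tensors of jets. -/
abbrev jetTensRes (L : LieAlgebroid O) (p : ℕ) {U V : C} (f : V ⟶ U) :
    TPow (fn O U) (L.Jet U) (p + 1) →ₛₗ[(fnRes O f : fn O U →+* fn O V)]
      TPow (fn O V) (L.Jet V) (p + 1) :=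
  tensMap (semilin (Jet.res f) (Jet.res_algebraMap f))

theorem jetTensMk_res (p q : ℕ) {U V : C} (f : V ⟶ U) (t : TPow (fn O U) (L.Jet U) (p + 1)) :
    L.barRes p q f (jetTensMk L p q U t) = jetTensMk L p q V (jetTensRes L p f t) := by
  induction t using tens_induction with
  | tprod m => simp only [tensMap_tprod]; rfl
  | add x y hx hy => simp only [map_add, hx, hy]

theorem jetTensMk_surjective (p q : ℕ) (U : C) : Function.Surjective (jetTensMk L p q U) := by
  intro y
  induction y using tens_induction with
  | tprod m =>
    choose α hα using fun i => Ideal.Quotient.mk_surjective (m i)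
    refine ⟨PiTensorProduct.tprod _ α, ?_⟩
    rw [tensMap_tprod]
    exact congr_arg _ (funext hα)
  | add x y hx hy =>
    obtain ⟨a, rfl⟩ := hx
    obtain ⟨b, rfl⟩ := hy
    exact ⟨a + b, map_add _ _ _⟩

namespace Bar

/-- The section of `B_p` given by a tensor of jets. -/
def ofTens (p : ℕ) (U : C) : TPow (fn O U) (L.Jet U) (p + 1) →+ L.Bar p U :=
  AddMonoidHom.mk' (fun t => ⟨fun q => L.toLevel p q U (jetTensMk L p q U t), fun q => by
      rw [levelProj_toLevel]
      congr 1
      induction t using tens_induction with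
      | tprod m => simp only [tensProj, tensMap_tprod]; rfl
      | add x y hx hy => simp only [map_add, hx, hy]⟩)
    (fun x y => ext fun q => by
      change L.toLevel p q U _ = L.toLevel p q U _ + L.toLevel p q U _
      rw [map_add, map_add])

theorem ofTens_val (p q : ℕ) (U : C) (t : TPow (fn O U) (L.Jet U) (p + 1)) :
    (ofTens p U t).1 q = L.toLevel p q U (jetTensMk L p q U t) := rfl

theorem ofTens_tprod {p : ℕ} {U : C} (α : Fin (p + 1) → L.Jet U) :
    ofTens p U (PiTensorProduct.tprod _ α) = pure α := ext fun q => by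
  rw [ofTens_val, tensMap_tprod]; rfl

theorem act_ofTens {p : ℕ} {U : C} (j : L.Jet U) (t : TPow (fn O U) (L.Jet U) (p + 1)) :
    act j (ofTens p U t) = ofTens p U (actFirst (fn O U) p j t) := by
  induction t using tens_induction with
  | tprod m => rw [ofTens_tprod, actFirst_tprod, act_pure, ofTens_tprod]
  | add x y hx hy => simp only [map_add, hx, hy]

theorem res_ofTens {p : ℕ} {U V : C} (f : V ⟶ U) (t : TPow (fn O U) (L.Jet U) (p + 1)) :
    res f (ofTens p U t) = ofTens p V (jetTensRes L p f t) := by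
  induction t using tens_induction with
  | tprod m => rw [ofTens_tprod, tensMap_tprod, res_pure, ofTens_tprod]; rfl
  | add x y hx hy => simp only [map_add, hx, hy]

theorem d_ofTens {p : ℕ} {U : C} (t : TPow (fn O U) (L.Jet U) (p + 2)) :
    d p U (ofTens (p + 1) U t) = ofTens p U (barD (fn O U) (Jet.counit U) p t) := ext fun q => by
  rw [ofTens_val]
  change L.levelD p q U (L.toLevel (p + 1) q U _) = _
  rw [levelD_toLevel]
  congr 1
  exact (tensMap_barD (σ := RingHom.id (fn O U)) (Ideal.Quotient.mk (Jet.augIdeal L U ^ (q + 1)))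
    (fun _ => rfl) (Jet.counit U) (L.counitQ q U) (fun a => L.counitQ_mk q U a) p t).symm

/-- Density of the tensors of jets: a section of the sheafified level comes locally from a tensor
over `J / (Jᶜ)^(q + 1)`, whose factors lift to jets. The covering depends on the level. -/
theorem ofTens_locally {p : ℕ} {U : C} (x : L.Bar p U) (q : ℕ) :
    ∃ S ∈ T U, ∀ ⦃V : C⦄ (f : V ⟶ U), S f → ∃ t, (ofTens p V t).1 q = (res f x).1 q := by
  obtain ⟨S, hS, h⟩ := L.toLevel_locally p q (x.1 q)
  refine ⟨S, hS, fun V f hf => ?_⟩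
  obtain ⟨a, ha⟩ := h f hf
  obtain ⟨t, rfl⟩ := jetTensMk_surjective p q V a
  exact ⟨t, ha⟩

theorem val_eq_zero_of_le {p : ℕ} {U : C} {x : L.Bar p U} {q q' : ℕ} (h : q ≤ q')
    (hx : x.1 q' = 0) : x.1 q = 0 := by
  induction q', h using Nat.le_induction with
  | base => exact hx
  | succ n _ ih => exact ih (by rw [← x.2 n, hx, map_zero])

theorem val_eq_of_le {p : ℕ} {U : C} {x y : L.Bar p U} {q q' : ℕ} (h : q ≤ q')
    (hxy : x.1 q' = y.1 q') : x.1 q = y.1 q := by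
  have := val_eq_zero_of_le (x := x - y) h (sub_eq_zero.2 hxy)
  exact sub_eq_zero.1 this

theorem act_val_eq {p : ℕ} {U : C} (j : L.Jet U) {x y : L.Bar p U} {q : ℕ}
    (h : x.1 q = y.1 q) : (act j x).1 q = (act j y).1 q :=
  congr_arg (L.levelAct p q U j) h

theorem act_one {p : ℕ} {U : C} (x : L.Bar p U) : act 1 x = x := ext fun q => by
  change L.levelAct p q U 1 (x.1 q) = x.1 q
  obtain ⟨S, hS, hx⟩ := L.toLevel_locally p q (x.1 q)
  refine sep _ hS fun V f hf => ?_
  obtain ⟨t, ht⟩ := hx f hf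
  rw [rs_levelAct, ← ht, levelAct_toLevel]
  simp only [map_one]; rfl

theorem act_mul {p : ℕ} {U : C} (j j' : L.Jet U) (x : L.Bar p U) :
    act (j * j') x = act j (act j' x) := ext fun q => by
  change L.levelAct p q U (j * j') (x.1 q) = L.levelAct p q U j (L.levelAct p q U j' (x.1 q))
  obtain ⟨S, hS, hx⟩ := L.toLevel_locally p q (x.1 q)
  refine sep _ hS fun V f hf => ?_
  obtain ⟨t, ht⟩ := hx f hf
  rw [rs_levelAct, rs_levelAct, rs_levelAct, ← ht, levelAct_toLevel, levelAct_toLevel,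
    levelAct_toLevel]
  simp only [map_mul]; rfl

theorem act_add {p : ℕ} {U : C} (j j' : L.Jet U) (x : L.Bar p U) :
    act (j + j') x = act j x + act j' x := ext fun q => by
  change L.levelAct p q U (j + j') (x.1 q)
    = L.levelAct p q U j (x.1 q) + L.levelAct p q U j' (x.1 q)
  obtain ⟨S, hS, hx⟩ := L.toLevel_locally p q (x.1 q)
  refine sep _ hS fun V f hf => ?_
  obtain ⟨t, ht⟩ := hx f hf
  rw [map_add, rs_levelAct, rs_levelAct, rs_levelAct, ← ht, levelAct_toLevel, levelAct_toLevel,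
    levelAct_toLevel]
  simp only [map_add, LinearMap.add_apply]

/-- `B_p` is a module over jets through the first factor. -/
instance (p : ℕ) (U : C) : Module (L.Jet U) (L.Bar p U) where
  smul j x := act j x
  one_smul := act_one
  mul_smul := act_mul
  smul_zero j := map_zero (act j)
  smul_add j := map_add (act j)
  add_smul := act_add
  zero_smul x := by
    have h := act_add (0 : L.Jet U) 0 x
    rw [add_zero] at h
    exact left_eq_add.1 h

theorem smul_eq_act {p : ℕ} {U : C} (j : L.Jet U) (x : L.Bar p U) : j • x = act j x := rfl

instance (p : ℕ) (U : C) : Module (fn O U) (L.Bar p U) :=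
  Module.compHom _ (algebraMap (fn O U) (L.Jet U))

theorem smul_def {p : ℕ} {U : C} (a : fn O U) (x : L.Bar p U) :
    a • x = algebraMap (fn O U) (L.Jet U) a • x := rfl

theorem ofTens_smul {p : ℕ} {U : C} (a : fn O U) (t : TPow (fn O U) (L.Jet U) (p + 1)) :
    ofTens p U (a • t) = a • ofTens p U t := by
  rw [smul_def, smul_eq_act, act_ofTens, actFirst_algebraMap]

end Bar

/-- A tensor of jets that vanishes on the level `q` is locally a combination of pure tensors with a
factor in the power `q + 1` of the augmentation ideal. -/
theorem ofTens_eq_zero_locally {p q : ℕ} {U : C} {t : TPow (fn O U) (L.Jet U) (p + 1)}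
    (h : (Bar.ofTens p U t).1 q = 0) : ∃ S ∈ T U, ∀ ⦃V : C⦄ (f : V ⟶ U), S f →
      jetTensRes L p f t ∈ Submodule.span (fn O V) {x : TPow (fn O V) (L.Jet V) (p + 1) |
        ∃ (α : Fin (p + 1) → L.Jet V) (i : Fin (p + 1)), α i ∈ Jet.augIdeal L V ^ (q + 1) ∧
          x = PiTensorProduct.tprod (fn O V) α} := by
  rw [Bar.ofTens_val, ← map_zero (L.toLevel p q U)] at h
  obtain ⟨S, hS, hS'⟩ := toShf_locally_inj (L.barPre p q) h
  refine ⟨S, hS, fun V f hf => ?_⟩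
  have h1 : jetTensMk L p q V (jetTensRes L p f t) = 0 := by
    rw [← jetTensMk_res]
    exact (hS' f hf).trans (map_zero (L.barRes p q f))
  have h2 := mem_span_of_tensMap_eq_zero _ Ideal.Quotient.mk_surjective h1
  refine Submodule.span_mono ?_ h2
  rintro _ ⟨α, i, hα, rfl⟩
  exact ⟨α, i, Ideal.Quotient.eq_zero_iff_mem.1 hα, rfl⟩

/-- A compatible, continuous, `J`-linear family of maps on tensors of jets. -/
structure TensFam (L : LieAlgebroid O) (n m : ℕ) (U : C) where
  /-- the maps on tensors -/
  map : ∀ {V : C} (_ : V ⟶ U), TPow (fn O V) (L.Jet V) (n + 1) →+ L.Bar m V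
  res_map : ∀ {V W : C} (f : V ⟶ U) (g : W ⟶ V) (t), Bar.res g (map f t)
    = map (g ≫ f) (jetTensRes L n g t)
  map_act : ∀ {V : C} (f : V ⟶ U) (j : L.Jet V) (t), map f (actFirst (fn O V) n j t)
    = Bar.act j (map f t)
  cont : ∀ r : ℕ, ∃ S ∈ T U, ∀ ⦃V : C⦄ (f : V ⟶ U), S f → ∃ q, ∀ ⦃W : C⦄ (g : W ⟶ V)
    (α : Fin (n + 1) → L.Jet W) (i : Fin (n + 1)), α i ∈ Jet.augIdeal L W ^ (q + 1) →
      (map (g ≫ f) (PiTensorProduct.tprod (fn O W) α)).1 r = 0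

/-! ### Extension by continuity from tensors of jets to the completed bar complex. -/

namespace TensFam

variable {n m : ℕ} {U : C} (F : TensFam L n m U)

theorem map_smul {V : C} (f : V ⟶ U) (a : fn O V) (t) :
    F.map f (a • t) = Bar.act (algebraMap _ _ a) (F.map f t) := by
  rw [← F.map_act, actFirst_algebraMap]

/-- `q` bounds the continuity of the family on the level `r` over `V`. -/
def Good {V : C} (f : V ⟶ U) (r q : ℕ) : Prop := ∀ ⦃W : C⦄ (g : W ⟶ V) (t),
  (Bar.ofTens n W t).1 q = 0 → (F.map (g ≫ f) t).1 r = 0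

/-- By `ofTens_eq_zero_locally`, a tensor that vanishes on the level `q` is locally a combination of
pure tensors with a small factor, so continuity has to be checked on these alone. -/
theorem good_of_pure {V : C} (f : V ⟶ U) (r q : ℕ) (h : ∀ ⦃W : C⦄ (g : W ⟶ V)
    (α : Fin (n + 1) → L.Jet W) (i : Fin (n + 1)), α i ∈ Jet.augIdeal L W ^ (q + 1) →
      (F.map (g ≫ f) (PiTensorProduct.tprod (fn O W) α)).1 r = 0) : F.Good f r q := by
  intro W g t ht
  obtain ⟨S, hS, hS'⟩ := ofTens_eq_zero_locally ht
  refine sep _ hS fun W' g' hg' => ?_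
  rw [map_zero]
  change (Bar.res g' (F.map (g ≫ f) t)).1 r = 0
  rw [F.res_map]
  have h2 := hS' g' hg'
  generalize jetTensRes L n g' t = t' at h2 ⊢
  induction h2 using Submodule.span_induction with
  | mem x hx =>
    obtain ⟨α, i, hα, rfl⟩ := hx
    rw [← Category.assoc]
    exact h (g' ≫ g) α i hα
  | zero => rw [map_zero]; rfl
  | add x y _ _ hx hy =>
    rw [map_add]
    change (F.map _ x).1 r + (F.map _ y).1 r = 0
    rw [hx, hy, add_zero]
  | smul a x _ hx =>
    rw [F.map_smul]
    exact (congr_arg (L.levelAct m r W' _) hx).trans (map_zero _)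

theorem exists_good (r : ℕ) : ∃ S ∈ T U, ∀ ⦃V : C⦄ (f : V ⟶ U), S f → ∃ q, F.Good f r q := by
  obtain ⟨S, hS, h⟩ := F.cont r
  refine ⟨S, hS, fun V f hf => ?_⟩
  obtain ⟨q, hq⟩ := h f hf
  exact ⟨q, F.good_of_pure f r q hq⟩

theorem Good.comp {F : TensFam L n m U} {V W : C} {f : V ⟶ U} {r q : ℕ} (h : F.Good f r q)
    (g : W ⟶ V) : F.Good (g ≫ f) r q := fun W' g' t ht => by
  rw [← Category.assoc]; exact h (g' ≫ g) t ht

theorem Good.mono {F : TensFam L n m U} {V : C} {f : V ⟶ U} {r q q' : ℕ} (h : F.Good f r q)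
    (hq : q ≤ q') : F.Good f r q' := fun _ g t ht => h g t (Bar.val_eq_zero_of_le hq ht)

/-- `z` is the component on the level `r` of the value on `x` of the extension of the family. -/
def IsVal {V : C} (f : V ⟶ U) (x : L.Bar n V) (r : ℕ) (z : (L.barLevel m r).obj.obj (op V)) :
    Prop := ∀ ⦃W : C⦄ (g : W ⟶ V) (q : ℕ) (t), F.Good (g ≫ f) r q →
      (Bar.ofTens n W t).1 q = (Bar.res g x).1 q → rs (L.barLevel m r).obj g z
        = (F.map (g ≫ f) t).1 r

/-- The extension can be computed on a fine enough covering. -/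
theorem exists_cover {V : C} (f : V ⟶ U) (x y : L.Bar n V) (r r' : ℕ) : ∃ S ∈ T V,
    ∀ ⦃W : C⦄ (g : W ⟶ V), S g → ∃ q t t', F.Good (g ≫ f) r q ∧ F.Good (g ≫ f) r' q ∧
      (Bar.ofTens n W t).1 q = (Bar.res g x).1 q ∧
      (Bar.ofTens n W t').1 q = (Bar.res g y).1 q := by
  obtain ⟨S, hS, h⟩ := F.exists_good r
  obtain ⟨S', hS', h'⟩ := F.exists_good r'
  refine cover_trans (T.pullback_stable f (T.intersection_covering hS hS')) fun W g hg => ?_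
  obtain ⟨q, hq⟩ := h _ hg.1
  obtain ⟨q', hq'⟩ := h' _ hg.2
  obtain ⟨S₁, hS₁, h₁⟩ := Bar.ofTens_locally (Bar.res g x) (max q q')
  obtain ⟨S₂, hS₂, h₂⟩ := Bar.ofTens_locally (Bar.res g y) (max q q')
  refine ⟨_, T.intersection_covering hS₁ hS₂, fun W' g' hg' => ?_⟩
  obtain ⟨t, ht⟩ := h₁ g' hg'.1
  obtain ⟨t', ht'⟩ := h₂ g' hg'.2
  rw [← Bar.res_comp] at ht ht'
  refine ⟨max q q', t, t', ?_, ?_, ht, ht'⟩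
  · rw [Category.assoc]; exact (hq.comp g').mono (le_max_left _ _)
  · rw [Category.assoc]; exact (hq'.comp g').mono (le_max_right _ _)

theorem IsVal.unique {F : TensFam L n m U} {V : C} {f : V ⟶ U} {x : L.Bar n V} {r : ℕ} {z z'}
    (hz : F.IsVal f x r z) (hz' : F.IsVal f x r z') : z = z' := by
  obtain ⟨S, hS, h⟩ := F.exists_cover f x x r r
  refine sep _ hS fun W g hg => ?_
  obtain ⟨q, t, -, hq, -, ht, -⟩ := h g hg
  rw [hz g q t hq ht, hz' g q t hq ht]

/-- The two approximations may be given to different levels; agreement on the finer level implies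
agreement on the coarser one, which is enough for continuity. -/
theorem map_congr {V : C} {f : V ⟶ U} {r q q' : ℕ} (hq : F.Good f r q) (hq' : F.Good f r q') {t t'}
    {x : L.Bar n V} (ht : (Bar.ofTens n V t).1 q = x.1 q)
    (ht' : (Bar.ofTens n V t').1 q' = x.1 q') : (F.map f t).1 r = (F.map f t').1 r := by
  have key : ∀ {q₀ : ℕ}, F.Good f r q₀ → (Bar.ofTens n V t).1 q₀ = (Bar.ofTens n V t').1 q₀ →
      (F.map f t).1 r = (F.map f t').1 r := fun {q₀} hq₀ h => by
    have h1 := hq₀ (𝟙 V) (t - t') (by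
      rw [map_sub]; exact sub_eq_zero.2 h)
    rw [Category.id_comp, map_sub] at h1
    exact sub_eq_zero.1 h1
  rcases le_total q q' with h | h
  · exact key hq (ht.trans (Bar.val_eq_of_le h ht').symm)
  · exact key hq' ((Bar.val_eq_of_le h ht).trans ht'.symm)

/-- On a fine covering the value is that of any tensor approximating `x` to a level that controls
`r`. By `map_congr` it does not depend on the tensor, so the local values glue. -/
theorem exists_isVal {V : C} (f : V ⟶ U) (x : L.Bar n V) (r : ℕ) : ∃ z, F.IsVal f x r z := by
  obtain ⟨S, hS, h⟩ := F.exists_cover f x x r r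
  choose! q t _ hq _ ht _ using h
  obtain ⟨z, hz⟩ := exists_glue (L.barLevel m r) hS (fun W g _ => (F.map (g ≫ f) (t g)).1 r)
    (fun W W' g hg g' => by
      change _ = (Bar.res g' (F.map (g ≫ f) (t g))).1 r
      rw [F.res_map]
      simp only [Category.assoc]
      refine F.map_congr (q := q (g' ≫ g)) (q' := q g) (x := Bar.res (g' ≫ g) x) ?_ ?_ (ht _ ?_) ?_
      · rw [← Category.assoc]; exact hq _ (S.downward_closed hg g')
      · exact (hq _ hg).comp g'
      · exact S.downward_closed hg g'
      · rw [← Bar.res_ofTens, Bar.res_comp]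
        exact congr_arg (rs (L.barLevel n (q g)).obj g') (ht g hg))
  refine ⟨z, fun W g q' t' hq' ht' => sep _ (T.pullback_stable g hS) fun W' g' hg' => ?_⟩
  rw [← rs_comp, hz _ hg']
  change _ = (Bar.res g' (F.map (g ≫ f) t')).1 r
  rw [F.res_map]
  simp only [Category.assoc]
  refine F.map_congr (q := q (g' ≫ g)) (q' := q') (x := Bar.res (g' ≫ g) x) ?_ ?_ (ht _ hg') ?_
  · rw [← Category.assoc]; exact hq _ hg'
  · exact hq'.comp g'
  · rw [← Bar.res_ofTens, Bar.res_comp]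
    exact congr_arg (rs (L.barLevel n q').obj g') ht'

/-- The component on the level `r` of the extension of the family. -/
def val {V : C} (f : V ⟶ U) (x : L.Bar n V) (r : ℕ) : (L.barLevel m r).obj.obj (op V) :=
  (F.exists_isVal f x r).choose

theorem isVal_val {V : C} (f : V ⟶ U) (x : L.Bar n V) (r : ℕ) : F.IsVal f x r (F.val f x r) :=
  (F.exists_isVal f x r).choose_spec

theorem val_eq {V : C} (f : V ⟶ U) (x : L.Bar n V) (r : ℕ) {z} (h : F.IsVal f x r z) :
    F.val f x r = z := (F.isVal_val f x r).unique h

theorem val_ofTens {V : C} (f : V ⟶ U) (t) (r : ℕ) :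
    F.val f (Bar.ofTens n V t) r = (F.map f t).1 r := F.val_eq _ _ _ fun W g q t' hq ht' => by
  change (Bar.res g (F.map f t)).1 r = _
  rw [F.res_map]
  exact F.map_congr hq hq (x := Bar.ofTens n W t') (by rw [ht', Bar.res_ofTens]) rfl

theorem rs_val {V W : C} (f : V ⟶ U) (g : W ⟶ V) (x : L.Bar n V) (r : ℕ) :
    rs (L.barLevel m r).obj g (F.val f x r) = F.val (g ≫ f) (Bar.res g x) r := by
  refine (F.val_eq _ _ _ fun W' g' q t hq ht => ?_).symm
  rw [← rs_comp, F.isVal_val f x r (g' ≫ g) q t (by rw [Category.assoc]; exact hq)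
    (by rw [Bar.res_comp]; exact ht)]
  simp only [Category.assoc]

theorem val_eq_map {V : C} (f : V ⟶ U) (x : L.Bar n V) {r q : ℕ} (hq : F.Good f r q) {t}
    (ht : (Bar.ofTens n V t).1 q = x.1 q) : F.val f x r = (F.map f t).1 r := by
  have h := F.isVal_val f x r (𝟙 V) q t (by rwa [Category.id_comp]) (by rwa [Bar.res_id])
  rwa [rs_id, Category.id_comp] at h

theorem val_add {V : C} (f : V ⟶ U) (x y : L.Bar n V) (r : ℕ) :
    F.val f (x + y) r = F.val f x r + F.val f y r := by
  obtain ⟨S, hS, h⟩ := F.exists_cover f x y r r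
  refine sep _ hS fun W g hg => ?_
  obtain ⟨q, t, t', hq, -, ht, ht'⟩ := h g hg
  rw [map_add, rs_val, rs_val, rs_val, F.val_eq_map _ _ hq ht, F.val_eq_map _ _ hq ht',
    F.val_eq_map _ _ hq (t := t + t'), map_add]
  · rfl
  · rw [map_add, map_add]; exact congr_arg₂ _ ht ht'

theorem levelProj_val {V : C} (f : V ⟶ U) (x : L.Bar n V) (r : ℕ) :
    L.levelProj m r V (F.val f x (r + 1)) = F.val f x r := by
  obtain ⟨S, hS, h⟩ := F.exists_cover f x x r (r + 1)
  refine sep _ hS fun W g hg => ?_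
  obtain ⟨q, t, -, hq, hq', ht, -⟩ := h g hg
  rw [rs_levelProj, rs_val, rs_val, F.val_eq_map _ _ hq ht, F.val_eq_map _ _ hq' ht]
  exact (F.map _ t).2 r

/-- The extension of the family to the completed bar complex. -/
def toHomCont : L.HomCont n m U :=
  ⟨fun _ f => AddMonoidHom.mk' (fun x => ⟨fun r => F.val f x r, F.levelProj_val f x⟩)
      (fun x y => Bar.ext fun r => F.val_add f x y r),
    fun V W f g x => Bar.ext fun r => F.rs_val f g x r,
    fun V f j x => Bar.ext fun r => by
      change F.val f (Bar.act j x) r = L.levelAct m r V j (F.val f x r)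
      obtain ⟨S, hS, h⟩ := F.exists_cover f x x r r
      refine sep _ hS fun W g hg => ?_
      obtain ⟨q, t, -, hq, -, ht, -⟩ := h g hg
      rw [rs_levelAct, rs_val, rs_val, F.val_eq_map _ _ hq ht,
        F.val_eq_map _ _ hq (t := actFirst (fn O W) n (Jet.res g j) t), F.map_act]
      · rfl
      · rw [← Bar.act_ofTens, Bar.res_act]
        exact Bar.act_val_eq _ ht,
    fun r => by
      obtain ⟨S, hS, h⟩ := F.exists_good r
      refine T.superset_covering (fun V f hf => ?_) hS
      obtain ⟨q, hq⟩ := h f hf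
      refine ⟨q, fun W g x hx => ?_⟩
      change F.val (g ≫ f) x r = 0
      rw [F.val_eq_map _ _ (hq.comp g) (t := 0), map_zero]
      · rfl
      · rw [map_zero, hx]; rfl⟩

theorem toHomCont_ofTens {V : C} (f : V ⟶ U) (t) :
    F.toHomCont.app f (Bar.ofTens n V t) = F.map f t := Bar.ext fun r => F.val_ofTens f t r

end TensFam

namespace HomCont

variable {n m : ℕ} {U : C}

/-- The level `r` of `φ x` depends, locally, only on some level of `x`, where `x` is locally a
tensor of jets. A single level `r` is kept apart because maps into `B_0` are compared later modulo
the augmentation ideal only, which is the case `r = 0`. -/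
theorem app_level_eq {φ : L.HomCont n m U} {r : ℕ}
    (h : ∀ ⦃V : C⦄ (f : V ⟶ U) (α : Fin (n + 1) → L.Jet V), (φ.app f (Bar.pure α)).1 r = 0)
    {V : C} (f : V ⟶ U) (x : L.Bar n V) : (φ.app f x).1 r = 0 := by
  have ht : ∀ ⦃V : C⦄ (f : V ⟶ U) t, (φ.app f (Bar.ofTens n V t)).1 r = 0 := by
    intro V f t
    induction t using tens_induction with
    | tprod α => rw [Bar.ofTens_tprod, h]
    | add x y hx hy =>
      rw [map_add, map_add]
      exact (congr_arg₂ _ hx hy).trans (add_zero _)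
  obtain ⟨S, hS, hx⟩ := cover_trans
    (P := fun W (g : W ⟶ V) => ∃ t, (φ.app (g ≫ f) (Bar.res g x - Bar.ofTens n W t)).1 r = 0)
    (T.pullback_stable f (φ.contSieve_mem r)) (fun W g hg => by
      obtain ⟨q, hq⟩ := hg
      obtain ⟨S', hS', h'⟩ := Bar.ofTens_locally (Bar.res g x) q
      refine ⟨S', hS', fun W' g' hg' => ?_⟩
      obtain ⟨t, ht⟩ := h' g' hg'
      refine ⟨t, ?_⟩
      rw [Category.assoc]
      refine hq g' _ (sub_eq_zero.2 ?_)
      rw [ht, Bar.res_comp])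
  refine sep _ hS fun W g hg => ?_
  obtain ⟨t, htx⟩ := hx g hg
  rw [map_zero]
  change (Bar.res g (φ.app f x)).1 r = 0
  rw [φ.res_app]
  rw [map_sub] at htx
  exact (sub_eq_zero.1 htx).trans (ht _ t)

theorem sub_app {V : C} (φ ψ : L.HomCont n m U) (f : V ⟶ U) (x : L.Bar n V) :
    (φ - ψ).app f x = φ.app f x - ψ.app f x := rfl

theorem add_app {V : C} (φ ψ : L.HomCont n m U) (f : V ⟶ U) (x : L.Bar n V) :
    (φ + ψ).app f x = φ.app f x + ψ.app f x := rfl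

/-- Continuous maps agree if they agree on pure tensors. -/
theorem ext_pure {φ ψ : L.HomCont n m U} (h : ∀ ⦃V : C⦄ (f : V ⟶ U) (α : Fin (n + 1) → L.Jet V),
    φ.app f (Bar.pure α) = ψ.app f (Bar.pure α)) : φ = ψ :=
  ext fun V f x => sub_eq_zero.1 (Bar.ext fun r => app_level_eq (φ := φ - ψ)
    (fun V f α => by rw [sub_app, h, sub_self]; rfl) f x)

/-- Continuous maps agree if they agree on tensors of jets. -/
theorem ext_ofTens {φ ψ : L.HomCont n m U} (h : ∀ ⦃V : C⦄ (f : V ⟶ U) t,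
    φ.app f (Bar.ofTens n V t) = ψ.app f (Bar.ofTens n V t)) : φ = ψ :=
  ext_pure fun V f α => by rw [← Bar.ofTens_tprod, h]

end HomCont

end Dense

end LieAlgebroid

/-! ### The cap product -/

namespace Envel

section mulRight

variable {k R L : Type u} [CommRing k] [CommRing R] [Algebra k R] [LieRing L] [Module R L]
  [LieRingModule L R] [LieAlgebra k L] [LieRinehartRing R L] [LieRinehartAlgebra k R L]

open Coalgebra

/-- Right multiplications commute with the left action of `E`, and `Δ E` is the result of that
action on `1 ⊗ 1`. This yields the product rule for `²∇`. -/
theorem map_mulRight_comul (E F G : Envel k R L) :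
    TensorProduct.map (mulRight F) (mulRight G) (comul (R := R) E)
      = tensorAct k R L E (F ⊗ₜ G) := by
  induction E using induction_left with
  | one => simp
  | add D E hD hE => simp only [map_add, hD, hE, LinearMap.add_apply]
  | incl_mul a D hD =>
    rw [comul_incl_mul, map_smul, hD, map_mul, Module.End.mul_apply, tensorAct_incl]
  | lie_mul x D hD =>
    have h : ∀ z : Envel k R L ⊗[R] Envel k R L,
        TensorProduct.map (mulRight F) (mulRight G) (lieTensor x z)
          = lieTensor x (TensorProduct.map (mulRight F) (mulRight G) z) := by
      intro z
      induction z with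
      | zero => simp
      | tmul D E => simp [mul_assoc]
      | add z w hz hw => simp only [map_add, hz, hw]
    rw [comul_lie_mul, h, hD, map_mul, Module.End.mul_apply, tensorAct_lie]

theorem comul_mul (D E : Envel k R L) :
    comul (R := R) (D * E) = tensorAct k R L D (comul (R := R) E) := by
  rw [comul_def, map_mul, Module.End.mul_apply, comul_def]

theorem comul_incl (a : R) : comul (R := R) (incl k R L a) = incl k R L a ⊗ₜ 1 := by
  have h := comul_incl_mul (k := k) (L := L) a 1
  rw [mul_one, comul_one, smul_tmul', smul_def, mul_one] at h
  exact h

theorem comul_lie (x : L) :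
    comul (R := R) (lie k R L x) = lie k R L x ⊗ₜ 1 + 1 ⊗ₜ lie k R L x := by
  have h := comul_lie_mul (k := k) (R := R) x 1
  rw [mul_one, comul_one, lieTensor_tmul, mul_one] at h
  exact h

end mulRight

end Envel

namespace LieAlgebroid

/-! ### Jets as a module over the enveloping algebra. -/

section Nabla

variable {C : Type u} [SmallCategory C] {T : GrothendieckTopology C} {k : Type u} [Field k]
  {O : Sheaf T (CommAlgCat.{u} k)} {L : LieAlgebroid O}

namespace Jet

theorem nabla_add {U : C} (E : L.Env U) (α β : L.Jet U) :
    nabla E (α + β) = nabla E α + nabla E β := rfl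

theorem nabla_add_left {U : C} (D E : L.Env U) (α : L.Jet U) :
    nabla (D + E) α = nabla D α + nabla E α := ext fun V f F => by
  rw [eval_add, nabla_eval, nabla_eval, nabla_eval, map_add, mul_add, map_add]

theorem nabla_one {U : C} (α : L.Jet U) : nabla 1 α = α := ext fun V f F => by
  rw [nabla_eval, map_one, mul_one]

theorem nabla_mul_left {U : C} (D E : L.Env U) (α : L.Jet U) :
    nabla (D * E) α = nabla D (nabla E α) := ext fun V f F => by
  rw [nabla_eval, nabla_eval, nabla_eval, map_mul (L.envRes f), mul_assoc]

theorem res_nabla {U V : C} (f : V ⟶ U) (E : L.Env U) (α : L.Jet U) :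
    res f (nabla E α) = nabla (L.envRes f E) (res f α) := ext fun W g F => by
  rw [res_eval, nabla_eval, nabla_eval, res_eval, envRes_comp]

theorem eval_algebraMap_mul {U V : C} (a : fn O U) (α : L.Jet U) (f : V ⟶ U) (D : L.Env V) :
    (algebraMap (fn O U) (L.Jet U) a * α).eval f D = fnRes O f a * α.eval f D := by
  have h1 : (algebraMap (fn O U) (L.Jet U) a).eval f
      = fnRes O f a • (1 : L.Jet U).eval f := LinearMap.ext fun D => algebraMap_eval a f D
  have h2 := eval_mul (1 : L.Jet U) α f D
  rw [one_mul] at h2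
  rw [eval_mul, h1, TensorProduct.map_smul_left, LinearMap.smul_apply, map_smul, ← h2, smul_eq_mul]

theorem nabla_algebraMap_mul {U : C} (E : L.Env U) (a : fn O U) (α : L.Jet U) :
    nabla E (algebraMap (fn O U) (L.Jet U) a * α) = algebraMap (fn O U) (L.Jet U) a * nabla E α :=
  ext fun V f F => by
    rw [nabla_eval, eval_algebraMap_mul, eval_algebraMap_mul, nabla_eval]

/-- The action of an element of the enveloping algebra on jets, as a linear map. -/
def nablaLin {U : C} (E : L.Env U) : L.Jet U →ₗ[fn O U] L.Jet U where
  toFun := nabla E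
  map_add' := nabla_add E
  map_smul' a α := by
    rw [Algebra.smul_def, nabla_algebraMap_mul, ← Algebra.smul_def]; rfl

theorem nabla_mul_nabla_eval {U V : C} (F G : L.Env U) (β γ : L.Jet U) (f : V ⟶ U) (E : L.Env V) :
    (nabla F β * nabla G γ).eval f E = LinearMap.mul' (fn O V) (fn O V)
      (TensorProduct.map (β.eval f) (γ.eval f)
        (Envel.tensorAct k (fn O V) (L.sec V) E (L.envRes f F ⊗ₜ L.envRes f G))) := by
  rw [eval_mul, ← Envel.map_mulRight_comul]
  generalize Coalgebra.comul (R := fn O V) E = z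
  congr 1
  induction z with
  | zero => simp only [map_zero]
  | tmul D E => rfl
  | add z w hz hw => simp only [map_add, hz, hw]

/-- As `Δ(E a)` is the action of `E` on `a ⊗ 1`, the operator `²∇_a` is multiplication by the jet
`²∇_a 1`. This jet is in general different from the image of `a` under the unit. -/
theorem nabla_incl {U : C} (a : fn O U) (γ : L.Jet U) :
    nabla (Envel.incl k _ _ a) γ = nabla (Envel.incl k _ _ a) 1 * γ := ext fun V f E => by
  have h := nabla_mul_nabla_eval (Envel.incl k (fn O U) (L.sec U) a) 1 1 γ f E
  have h' := eval_mul (1 : L.Jet U) γ f (E * L.envRes f (Envel.incl k (fn O U) (L.sec U) a))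
  rw [nabla_one] at h
  rw [one_mul] at h'
  rw [h, nabla_eval, h', Envel.comul_mul, map_one, envRes, Envel.map_incl, Envel.comul_incl]

variable (L) in
/-- The second structure of `O`-algebra on jets, `a ↦ ²∇_a 1`. -/
def tgt (U : C) : fn O U →+* L.Jet U where
  toFun a := nabla (Envel.incl k _ _ a) 1
  map_one' := by rw [map_one, nabla_one]
  map_zero' := ext fun V f E => by rw [nabla_eval, map_zero, map_zero, mul_zero, map_zero]; rfl
  map_add' a b := by rw [map_add, nabla_add_left]
  map_mul' a b := by rw [map_mul, nabla_mul_left, nabla_incl]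

theorem tgt_mul {U : C} (a : fn O U) (γ : L.Jet U) :
    tgt L U a * γ = nabla (Envel.incl k _ _ a) γ := (nabla_incl a γ).symm

theorem nabla_smul_left {U : C} (a : fn O U) (D : L.Env U) (γ : L.Jet U) :
    nabla (a • D) γ = tgt L U a * nabla D γ := by
  rw [Envel.smul_def, nabla_mul_left, tgt_mul]

theorem res_tgt {U V : C} (f : V ⟶ U) (a : fn O U) :
    res f (tgt L U a) = tgt L V (fnRes O f a) :=
  (res_nabla f _ _).trans (by rw [map_one, envRes, Envel.map_incl]; rfl)

/-- `F ⊗ G ↦ ²∇_F β · ²∇_G γ`. -/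
def nablaPair {U : C} (β γ : L.Jet U) : L.Env U ⊗[fn O U] L.Env U →+ L.Jet U :=
  TensorProduct.liftAddHom
    (AddMonoidHom.mk' (fun F => AddMonoidHom.mk' (fun G => nabla F β * nabla G γ)
      (fun G G' => by rw [nabla_add_left, mul_add]))
      (fun F F' => AddMonoidHom.ext fun G => by
        change nabla (F + F') β * _ = nabla F β * _ + nabla F' β * _
        rw [nabla_add_left, add_mul]))
    (fun a F G => by
      change nabla (a • F) β * nabla G γ = nabla F β * nabla (a • G) γ
      -- The pairing is balanced over `O` because a scalar on either factor acts as multiplication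
      -- by the same jet `tgt L U a`.
      rw [nabla_smul_left, nabla_smul_left]; ring)

theorem nablaPair_tmul {U : C} (β γ : L.Jet U) (F G : L.Env U) :
    nablaPair β γ (F ⊗ₜ G) = nabla F β * nabla G γ := rfl

/-- Evaluated on `E`, the left side involves `Δ(E D)`, which is the action of `E` on `Δ D`. -/
theorem nabla_mul {U : C} (D : L.Env U) (β γ : L.Jet U) :
    nabla D (β * γ) = nablaPair β γ (Coalgebra.comul (R := fn O U) D) := ext fun V f E => by
  have h : ∀ w : L.Env U ⊗[fn O U] L.Env U, (nablaPair β γ w).eval f E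
      = LinearMap.mul' (fn O V) (fn O V) (TensorProduct.map (β.eval f) (γ.eval f)
        (Envel.tensorAct k (fn O V) (L.sec V) E
          (TensorProduct.map (L.envResₛₗ f) (L.envResₛₗ f) w))) := by
    intro w
    induction w with
    | zero => simp only [map_zero]; rfl
    | tmul F G => rw [nablaPair_tmul, nabla_mul_nabla_eval, TensorProduct.map_tmul]; rfl
    | add w w' hw hw' => rw [map_add, eval_add, hw, hw']; simp only [map_add]
  rw [h, nabla_eval, eval_mul, Envel.comul_mul, ← Envel.comul_map]
  rfl

theorem nabla_lie_mul {U : C} (x : L.sec U) (β γ : L.Jet U) :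
    nabla (Envel.lie k _ _ x) (β * γ)
      = nabla (Envel.lie k _ _ x) β * γ + β * nabla (Envel.lie k _ _ x) γ := by
  rw [nabla_mul, Envel.comul_lie, map_add, nablaPair_tmul, nablaPair_tmul, nabla_one, nabla_one]

/-- Sections of `L` act as derivations, hence lower the adic filtration by at most one step. It
follows that every `²∇_D` is continuous. -/
theorem nabla_lie_mem {U : C} (x : L.sec U) (m : ℕ) {α : L.Jet U}
    (h : α ∈ augIdeal L U ^ (m + 1)) : nabla (Envel.lie k _ _ x) α ∈ augIdeal L U ^ m := by
  induction m generalizing α with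
  | zero => rw [pow_zero, Ideal.one_eq_top]; trivial
  | succ m ih =>
    rw [pow_succ'] at h
    refine Submodule.mul_induction_on h (fun β hβ γ hγ => ?_) (fun β γ hβ hγ => ?_)
    · rw [nabla_lie_mul]
      refine add_mem (Ideal.mul_mem_left _ _ hγ) ?_
      rw [pow_succ']
      exact Ideal.mul_mem_mul hβ (ih hγ)
    · rw [nabla_add]; exact add_mem hβ hγ

/-- An element of the enveloping algebra has finite order, uniformly under restriction. -/
theorem exists_order {U : C} (D : L.Env U) : ∃ N, ∀ ⦃V : C⦄ (f : V ⟶ U) (m : ℕ) (α : L.Jet V),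
    α ∈ augIdeal L V ^ (m + N) → nabla (L.envRes f D) α ∈ augIdeal L V ^ m := by
  induction D using Envel.induction_left with
  | one => exact ⟨0, fun V f m α h => by rw [map_one, nabla_one]; exact h⟩
  | add D E hD hE =>
    obtain ⟨M, hM⟩ := hD
    obtain ⟨N, hN⟩ := hE
    refine ⟨M + N, fun V f m α h => ?_⟩
    rw [map_add, nabla_add_left]
    exact add_mem (hM f m α (Ideal.pow_le_pow_right (by omega) h))
      (hN f m α (Ideal.pow_le_pow_right (by omega) h))
  | incl_mul a D hD =>
    obtain ⟨N, hN⟩ := hD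
    refine ⟨N, fun V f m α h => ?_⟩
    rw [map_mul, nabla_mul_left, envRes, Envel.map_incl, nabla_incl]
    exact Ideal.mul_mem_left _ _ (hN f m α h)
  | lie_mul x D hD =>
    obtain ⟨N, hN⟩ := hD
    refine ⟨N + 1, fun V f m α h => ?_⟩
    rw [map_mul, nabla_mul_left, envRes, Envel.map_lie]
    exact nabla_lie_mem _ m (hN f (m + 1) α (by rwa [add_right_comm, add_assoc]))

end Jet

end Nabla

/-! ### The cap product with one section of the enveloping algebra. -/

section Cap

variable {C : Type u} [SmallCategory C] {T : GrothendieckTopology C} {k : Type u} [Field k]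
  {O : Sheaf T (CommAlgCat.{u} k)} {L : LieAlgebroid O}

theorem actFirst_consT {R A : Type*} [CommRing R] [CommRing A] [Algebra R A] (n : ℕ) (j a : A)
    (y : TPow R A n) : actFirst R n j (consT R n a y) = consT R n (j * a) y := by
  induction y using PiTensorProduct.induction_on with
  | smul_tprod r m =>
    rw [map_smul, map_smul, map_smul, consT_tprod, consT_tprod, actFirst_tprod]
    congr 2
    funext i
    refine Fin.cases ?_ (fun i => ?_) i
    · simp
    · simp
  | add x y hx hy => simp only [map_add, hx, hy]

theorem barFace_zero_consT {R A : Type*} [CommRing R] [CommRing A] [Algebra R A] (n : ℕ) (a : A)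
    (y : TPow R A (n + 1)) : barFace R n 0 (consT R (n + 1) a y) = actFirst R n a y := by
  induction y using tens_induction with
  | tprod m =>
    rw [consT_tprod, barFace_tprod, actFirst_tprod, Fin.prod_univ_succ]
    congr 2
    exact Finset.univ_prod_mulSingle m
  | add x y hx hy => simp only [map_add, hx, hy]

theorem tensMap_consT {R R' M M' : Type*} [CommRing R] [CommRing R'] [AddCommGroup M] [Module R M]
    [AddCommGroup M'] [Module R' M'] {σ : R →+* R'} (g : M →ₛₗ[σ] M') (n : ℕ) (a : M)
    (y : TPow R M n) : tensMap g (consT R n a y) = consT R' n (g a) (tensMap g y) := by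
  induction y using PiTensorProduct.induction_on with
  | smul_tprod r m =>
    simp only [map_smul, LinearMap.map_smulₛₗ, consT_tprod, tensMap_tprod]
    congr 2
    funext i
    refine Fin.cases ?_ (fun i => ?_) i <;> simp
  | add x y hx hy => simp only [map_add, hx, hy]

/-- Induction on tensors, with `a ⊗ y` and sums. -/
theorem consT_induction {R A : Type*} [CommRing R] [AddCommGroup A] [Module R A] {n : ℕ}
    {P : TPow R A (n + 1) → Prop} (cons : ∀ a y, P (consT R n a y))
    (add : ∀ x y, P x → P y → P (x + y)) (x : TPow R A (n + 1)) : P x := by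
  induction x using PiTensorProduct.induction_on with
  | smul_tprod r m => rw [tprod_eq_consT, ← map_smul]; exact cons _ _
  | add x y hx hy => exact add x y hx hy

/-- The action of `²∇_D` on the first factor of tensors of jets. -/
def nablaFirst {V : C} (D : L.Env V) (n : ℕ) :
    TPow (fn O V) (L.Jet V) (n + 1) →ₗ[fn O V] TPow (fn O V) (L.Jet V) (n + 1) :=
  PiTensorProduct.map (Fin.cons (α := fun _ => L.Jet V →ₗ[fn O V] L.Jet V) (Jet.nablaLin D)
    fun _ => LinearMap.id)

theorem nablaFirst_consT {V : C} (D : L.Env V) (n : ℕ) (a : L.Jet V)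
    (y : TPow (fn O V) (L.Jet V) n) :
    nablaFirst D n (consT _ n a y) = consT _ n (Jet.nabla D a) y := by
  induction y using PiTensorProduct.induction_on with
  | smul_tprod r m =>
    simp only [map_smul, consT_tprod]
    rw [nablaFirst, PiTensorProduct.map_tprod]
    congr 2
    funext i
    refine Fin.cases ?_ (fun i => ?_) i
    · rfl
    · rfl
  | add x y hx hy => simp only [map_add, hx, hy]

/-- `α₀ ⊗ α₁ ⊗ ⋯ ↦ α₀ ²∇_D α₁ ⊗ ⋯` on tensors of jets. -/
def capAlg {V : C} (D : L.Env V) (n : ℕ) :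
    TPow (fn O V) (L.Jet V) (n + 2) →ₗ[fn O V] TPow (fn O V) (L.Jet V) (n + 1) :=
  (barFace (fn O V) n 0).comp (PiTensorProduct.map
    (Fin.cons (α := fun _ => L.Jet V →ₗ[fn O V] L.Jet V) LinearMap.id
      (Fin.cons (α := fun _ => L.Jet V →ₗ[fn O V] L.Jet V) (Jet.nablaLin D) fun _ => LinearMap.id)))

theorem capAlg_consT {V : C} (D : L.Env V) (n : ℕ) (a : L.Jet V)
    (y : TPow (fn O V) (L.Jet V) (n + 1)) :
    capAlg D n (consT _ (n + 1) a y) = actFirst _ n a (nablaFirst D n y) := by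
  induction y using tens_induction with
  | tprod m =>
    rw [capAlg, LinearMap.comp_apply, consT_tprod, PiTensorProduct.map_tprod, ← barFace_zero_consT,
      nablaFirst, PiTensorProduct.map_tprod, consT_tprod]
    congr 2
    funext i
    refine Fin.cases ?_ (fun i => ?_) i
    · rfl
    · rfl
  | add x y hx hy => simp only [map_add, hx, hy]

theorem capAlg_consT_consT {V : C} (D : L.Env V) (n : ℕ) (a b : L.Jet V)
    (y : TPow (fn O V) (L.Jet V) n) :
    capAlg D n (consT _ (n + 1) a (consT _ n b y)) = consT _ n (a * Jet.nabla D b) y := by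
  rw [capAlg_consT, nablaFirst_consT, actFirst_consT]

theorem capAlg_tprod {V : C} (D : L.Env V) (n : ℕ) (α : Fin (n + 2) → L.Jet V) :
    capAlg D n (PiTensorProduct.tprod _ α) = PiTensorProduct.tprod _
      (Fin.cons (α 0 * Jet.nabla D (α 1)) (Fin.tail (Fin.tail α))) := by
  rw [tprod_eq_consT, tprod_eq_consT, capAlg_consT_consT, consT_tprod]
  rfl

theorem capAlg_actFirst {V : C} (D : L.Env V) (n : ℕ) (j : L.Jet V)
    (t : TPow (fn O V) (L.Jet V) (n + 2)) :
    capAlg D n (actFirst _ (n + 1) j t) = actFirst _ n j (capAlg D n t) := by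
  induction t using consT_induction with
  | cons a y =>
    rw [actFirst_consT, capAlg_consT, capAlg_consT, map_mul]; rfl
  | add x y hx hy => simp only [map_add, hx, hy]

theorem jetTensRes_capAlg {V W : C} (g : W ⟶ V) (D : L.Env V) (n : ℕ)
    (t : TPow (fn O V) (L.Jet V) (n + 2)) :
    jetTensRes L n g (capAlg D n t) = capAlg (L.envRes g D) n (jetTensRes L (n + 1) g t) := by
  induction t using consT_induction with
  | cons a y =>
    induction y using consT_induction with
    | cons b y =>
      rw [capAlg_consT_consT]
      simp only [tensMap_consT]
      rw [capAlg_consT_consT]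
      have h : Jet.res g (a * Jet.nabla D b)
          = Jet.res g a * Jet.nabla (L.envRes g D) (Jet.res g b) := by rw [map_mul, Jet.res_nabla]
      exact congr_arg (fun z => consT _ n z _) h
    | add x y hx hy => simp only [map_add, hx, hy]
  | add x y hx hy => simp only [map_add, hx, hy]

theorem ofTens_tprod_val_eq_zero {n r : ℕ} {V : C} {α : Fin (n + 1) → L.Jet V} (i : Fin (n + 1))
    (h : α i ∈ Jet.augIdeal L V ^ (r + 1)) :
    (Bar.ofTens n V (PiTensorProduct.tprod _ α)).1 r = 0 := by
  rw [Bar.ofTens_val, tensMap_tprod]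
  refine (congr_arg (L.toLevel n r V) ((PiTensorProduct.tprod (fn O V)).map_coord_zero
    (m := fun j => (Ideal.Quotient.mk (Jet.augIdeal L V ^ (r + 1)) (α j) : L.JetQ r V)) i
    (Ideal.Quotient.eq_zero_iff_mem.2 h))).trans (map_zero _)

/-- The cap product with a section of the enveloping algebra, on tensors of jets. -/
def capFam {U : C} (D : L.Env U) (n : ℕ) : TensFam L (n + 1) n U where
  map {V} f := (Bar.ofTens n V).comp (capAlg (L.envRes f D) n).toAddMonoidHom
  res_map f g t := by
    change Bar.res g (Bar.ofTens n _ (capAlg _ n t)) = Bar.ofTens n _ (capAlg _ n _)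
    rw [Bar.res_ofTens, jetTensRes_capAlg, ← envRes_comp]
  map_act f j t := by
    change Bar.ofTens n _ (capAlg _ n _) = Bar.act j (Bar.ofTens n _ (capAlg _ n t))
    rw [capAlg_actFirst, Bar.act_ofTens]
  cont r := by
    obtain ⟨N, hN⟩ := Jet.exists_order (L := L) (U := U) D
    -- Only the factor `α 1` is differentiated, which costs at most `N` powers of the augmentation
    -- ideal; `N` is uniform under restriction, so no refinement is needed.
    refine ⟨⊤, T.top_mem U, fun V f _ => ⟨r + N, fun W g α i hα => ?_⟩⟩
    change (Bar.ofTens n W (capAlg (L := L) (L.envRes (g ≫ f) D) n (PiTensorProduct.tprod _ α))).1 r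
      = 0
    rw [capAlg_tprod]
    have hle : Jet.augIdeal L W ^ (r + N + 1) ≤ Jet.augIdeal L W ^ (r + 1) :=
      Ideal.pow_le_pow_right (by omega)
    refine Fin.cases (fun h0 => ?_) (fun i => Fin.cases (fun h1 => ?_) (fun i hi => ?_) i) i hα
    · exact ofTens_tprod_val_eq_zero 0 (Ideal.mul_mem_right _ _ (hle h0))
    · refine ofTens_tprod_val_eq_zero 0 (Ideal.mul_mem_left _ _ (hN _ (r + 1) _ ?_))
      rwa [add_right_comm]
    · exact ofTens_tprod_val_eq_zero i.succ (hle hi)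

/-- The cap product with a section of the enveloping algebra. -/
def capOne {U : C} (D : L.Env U) (n : ℕ) : L.HomCont (n + 1) n U := (capFam D n).toHomCont

theorem capOne_ofTens {U V : C} (D : L.Env U) (n : ℕ) (f : V ⟶ U) (t) :
    (capOne D n).app f (Bar.ofTens (n + 1) V t) = Bar.ofTens n V (capAlg (L.envRes f D) n t) :=
  (capFam D n).toHomCont_ofTens f t

theorem capOne_pure {U V : C} (D : L.Env U) (n : ℕ) (f : V ⟶ U) (α : Fin (n + 2) → L.Jet V) :
    (capOne D n).app f (Bar.pure α) = Bar.pure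
      (Fin.cons (α 0 * Jet.nabla (L.envRes f D) (α 1)) (Fin.tail (Fin.tail α))) := by
  rw [← Bar.ofTens_tprod, capOne_ofTens, capAlg_tprod, Bar.ofTens_tprod]

end Cap

end LieAlgebroid

namespace LieAlgebroid

/-! ### Cap products with tensors: linearity and composition. -/

section CapHom

variable {C : Type u} [SmallCategory C] {T : GrothendieckTopology C} {k : Type u} [Field k]
  {O : Sheaf T (CommAlgCat.{u} k)} {L : LieAlgebroid O}

namespace HomCont

/-- The action of jets on continuous maps. -/
def jetAct {n m : ℕ} {U : C} (j : L.Jet U) (φ : L.HomCont n m U) : L.HomCont n m U :=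
  ⟨fun _ f => (Bar.act (Jet.res f j)).comp (φ.app f),
    fun V W f g x => by
      change Bar.res g (Bar.act _ _) = Bar.act _ (φ.app _ _)
      rw [Bar.res_act, res_app, Jet.res_comp],
    fun V f j' x => by
      change Bar.act _ (φ.app _ _) = Bar.act _ (Bar.act _ (φ.app _ _))
      rw [app_act, ← Bar.act_mul, mul_comm, Bar.act_mul],
    fun r => T.superset_covering (by
      rintro V f ⟨q, hq⟩
      exact ⟨q, fun W g x hx =>
        (congr_arg (L.levelAct m r W _) (hq g x hx)).trans (map_zero _)⟩) (φ.contSieve_mem r)⟩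

instance (n m : ℕ) (U : C) : Module (L.Jet U) (L.HomCont n m U) where
  smul := jetAct
  one_smul φ := ext fun V f x => by
    change Bar.act (Jet.res f 1) (φ.app f x) = _
    rw [map_one, Bar.act_one]
  mul_smul j j' φ := ext fun V f x => by
    change Bar.act (Jet.res f (j * j')) (φ.app f x) = Bar.act _ (Bar.act _ (φ.app f x))
    rw [map_mul, Bar.act_mul]
  smul_zero j := ext fun V f x => map_zero (Bar.act (Jet.res f j))
  smul_add j φ ψ := ext fun V f x => map_add (Bar.act (Jet.res f j)) _ _
  add_smul j j' φ := ext fun V f x => by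
    change Bar.act (Jet.res f (j + j')) (φ.app f x) = Bar.act _ (φ.app f x) + Bar.act _ (φ.app f x)
    rw [map_add, Bar.act_add]
  zero_smul φ := ext fun V f x => by
    change Bar.act (Jet.res f 0) (φ.app f x) = 0
    rw [map_zero, ← Bar.smul_eq_act, zero_smul]

theorem jet_smul_app {n m : ℕ} {U V : C} (j : L.Jet U) (φ : L.HomCont n m U) (f : V ⟶ U)
    (x : L.Bar n V) : (j • φ).app f x = Bar.act (Jet.res f j) (φ.app f x) := rfl

/-- Continuous maps are a module over functions, which act through `a ↦ ²∇_a 1`. -/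
instance (n m : ℕ) (U : C) : Module (fn O U) (L.HomCont n m U) :=
  Module.compHom _ (Jet.tgt L U)

theorem smul_def {n m : ℕ} {U : C} (a : fn O U) (φ : L.HomCont n m U) :
    a • φ = Jet.tgt L U a • φ := rfl

theorem smul_app {n m : ℕ} {U V : C} (a : fn O U) (φ : L.HomCont n m U) (f : V ⟶ U)
    (x : L.Bar n V) : (a • φ).app f x = Bar.act (Jet.tgt L V (fnRes O f a)) (φ.app f x) := by
  rw [smul_def, jet_smul_app, Jet.res_tgt]

theorem res_smul {n m : ℕ} {U V : C} (f : V ⟶ U) (a : fn O U) (φ : L.HomCont n m U) :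
    res f (a • φ) = fnRes O f a • res f φ := ext fun W g x => by
  rw [app_res, smul_app, smul_app, fnRes_comp, app_res]

theorem smul_comp {n m l : ℕ} {U : C} (a : fn O U) (φ : L.HomCont m l U) (ψ : L.HomCont n m U) :
    (a • φ).comp ψ = a • φ.comp ψ := rfl

/-- Functions act through jets, and continuous maps are `J`-linear. This makes composition bilinear,
as needed to define cap products on tensor powers over `O`. -/
theorem comp_smul {n m l : ℕ} {U : C} (a : fn O U) (φ : L.HomCont m l U) (ψ : L.HomCont n m U) :
    φ.comp (a • ψ) = a • φ.comp ψ := ext fun V f x => by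
  rw [comp_app, smul_app, smul_app, app_act, comp_app]

/-- Composition of continuous maps, which is bilinear over functions. -/
def compLin (n m l : ℕ) (U : C) :
    L.HomCont n m U →ₗ[fn O U] L.HomCont m l U →ₗ[fn O U] L.HomCont n l U :=
  LinearMap.mk₂ (fn O U) (fun ψ φ => φ.comp ψ) (fun ψ ψ' φ => comp_add φ ψ ψ')
    (fun a ψ φ => comp_smul a φ ψ) (fun _ _ _ => rfl) (fun _ _ _ => rfl)

end HomCont

theorem capAlg_add {V : C} (D E : L.Env V) (n : ℕ) (t : TPow (fn O V) (L.Jet V) (n + 2)) :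
    capAlg (L := L) (D + E) n t = capAlg (L := L) D n t + capAlg (L := L) E n t := by
  induction t using consT_induction with
  | cons a y =>
    induction y using consT_induction with
    | cons b y =>
      simp only [capAlg_consT_consT]
      rw [Jet.nabla_add_left, mul_add, map_add, LinearMap.add_apply]
    | add x y hx hy => simp only [map_add, hx, hy]; abel
  | add x y hx hy => simp only [map_add, hx, hy]; abel

/-- The left `O`-structure of the enveloping algebra turns into multiplication by `Jet.tgt`, not by
the image of the unit; this dictates the `O`-module structure put on `HomCont`. -/
theorem capAlg_smul {V : C} (c : fn O V) (D : L.Env V) (n : ℕ)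
    (t : TPow (fn O V) (L.Jet V) (n + 2)) :
    capAlg (L := L) (c • D) n t = actFirst _ n (Jet.tgt L V c) (capAlg (L := L) D n t) := by
  induction t using consT_induction with
  | cons a y =>
    induction y using consT_induction with
    | cons b y =>
      simp only [capAlg_consT_consT]
      rw [Jet.nabla_smul_left, actFirst_consT, mul_left_comm]
    | add x y hx hy => simp only [map_add, hx, hy]
  | add x y hx hy => simp only [map_add, hx, hy]

theorem capOne_add {U : C} (D E : L.Env U) (n : ℕ) :
    capOne (L := L) (D + E) n = capOne (L := L) D n + capOne (L := L) E n :=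
  HomCont.ext_ofTens fun V f t => by
    rw [HomCont.add_app, capOne_ofTens, capOne_ofTens, capOne_ofTens, map_add, capAlg_add, map_add]

theorem capOne_smul {U : C} (a : fn O U) (D : L.Env U) (n : ℕ) :
    capOne (L := L) (a • D) n = a • capOne (L := L) D n :=
  HomCont.ext_ofTens fun V f t => by
    rw [HomCont.smul_app, capOne_ofTens, capOne_ofTens, Bar.act_ofTens, ← capAlg_smul]
    exact congr_arg (fun E => Bar.ofTens n V (capAlg (L := L) E n t))
      ((L.envResₛₗ f).map_smulₛₗ a D)

variable (L) in
/-- The cap product with sections of the enveloping algebra. -/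
def capHom (n : ℕ) (U : C) : L.Env U →ₗ[fn O U] L.HomCont (n + 1) n U where
  toFun D := capOne D n
  map_add' D E := capOne_add D E n
  map_smul' a D := capOne_smul a D n

variable (L) in
/-- The cap product with `p` sections of the enveloping algebra. -/
def capMul (U : C) (m : ℕ) :
    (p : ℕ) → MultilinearMap (fn O U) (fun _ : Fin p => L.Env U) (L.HomCont (m + p) m U)
  | 0 => MultilinearMap.constOfIsEmpty _ _ (HomCont.id m U)
  | p + 1 => LinearMap.uncurryLeft (M := fun _ : Fin (p + 1) => L.Env U)
      { toFun := fun D => (HomCont.compLin (m + p + 1) (m + p) m U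
          (capHom L (m + p) U D)).compMultilinearMap (capMul U m p)
        map_add' := fun D E => by
          rw [map_add, map_add]; rfl
        map_smul' := fun a D => by
          rw [map_smul, map_smul]; rfl }

variable (L) in
/-- The cap product with tensors of sections of the enveloping algebra. -/
def capN (U : C) (p n m : ℕ) (h : n = m + p) :
    TPow (fn O U) (L.Env U) p →ₗ[fn O U] L.HomCont n m U := by
  subst h
  exact PiTensorProduct.lift (capMul L U m p)

theorem capN_zero {U : C} (m : ℕ) (h) (D : Fin 0 → L.Env U) :
    capN L U 0 m m h (PiTensorProduct.tprod (fn O U) D) = HomCont.id m U :=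
  PiTensorProduct.lift.tprod D

/-- The first factor acts first, hence stands on the right of the composition; this is the origin of
the opposite algebra. -/
theorem capN_consT {U : C} (p n m : ℕ) (h : n + 1 = m + (p + 1)) (D : L.Env U)
    (t : TPow (fn O U) (L.Env U) p) :
    capN L U (p + 1) (n + 1) m h (consT _ p D t)
      = (capN L U p n m (by omega) t).comp (capOne D n) := by
  obtain rfl : n = m + p := by omega
  induction t using PiTensorProduct.induction_on with
  | smul_tprod r E =>
    rw [map_smul, map_smul, map_smul, HomCont.smul_comp, consT_tprod]
    congr 1
  | add x y hx hy =>
    rw [map_add, map_add, map_add, HomCont.add_comp, hx, hy]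

theorem capN_tprod_pure {U V : C} (p n m : ℕ) (h : n = m + p) (D : Fin p → L.Env U) (f : V ⟶ U)
    (α : Fin (n + 1) → L.Jet V) :
    (capN L U p n m h (PiTensorProduct.tprod _ D)).app f (Bar.pure α)
      = Bar.pure (L.capTens (by exact_mod_cast h) (fun i => L.envRes f (D i)) α) := by
  induction p generalizing n with
  | zero =>
    obtain rfl : n = m := h
    rw [capN_zero]
    change Bar.pure α = _
    congr 1
    funext i
    refine Fin.cases ?_ (fun i => ?_) i
    · simp [capTens]
    · simp only [capTens, Fin.cons_succ]
      congr 1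
      ext
      simp
  | succ p ih =>
    obtain ⟨n, rfl⟩ : ∃ n', n = n' + 1 := ⟨m + p, h⟩
    rw [tprod_eq_consT, capN_consT, HomCont.comp_app, capOne_pure, ih]
    congr 1
    simp only [capTens]
    congr 1
    · rw [Fin.prod_univ_succ, Fin.cons_zero, ← mul_assoc]
      rfl
    · funext j
      have h1 : (⟨p + j + 1, by omega⟩ : Fin (n + 1)) = Fin.succ ⟨p + j, by omega⟩ := rfl
      rw [h1, Fin.cons_succ]
      change α _ = α _
      congr 1
      ext
      simp
      omega

theorem res_capN {U V : C} (f : V ⟶ U) (p n m : ℕ) (h : n = m + p)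
    (t : TPow (fn O U) (L.Env U) p) :
    HomCont.res f (capN L U p n m h t) = capN L V p n m h (tensMap (L.envResₛₗ f) t) := by
  induction t using PiTensorProduct.induction_on with
  | smul_tprod r D =>
    rw [LinearMap.map_smul, LinearMap.map_smulₛₗ, LinearMap.map_smul, HomCont.res_smul,
      tensMap_tprod]
    congr 1
    refine HomCont.ext_pure fun W g α => ?_
    rw [HomCont.app_res, capN_tprod_pure, capN_tprod_pure]
    congr 2
    funext i
    exact L.envRes_comp f g (D i)
  | add x y hx hy => simp only [map_add, hx, hy]

theorem capN_smul_tprod_pure {U V : C} (n : ℕ) (h : n = n + 0) (a : fn O U) (f : V ⟶ U)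
    (α : Fin (n + 1) → L.Jet V) :
    (capN L U 0 n n h (a • PiTensorProduct.tprod _ Fin.elim0)).app f (Bar.pure α)
      = Bar.pure (Function.update α 0
          (Jet.nabla (Envel.incl k (fn O V) (L.sec V) (fnRes O f a)) (α 0))) := by
  rw [map_smul, capN_zero, HomCont.smul_app]
  change Bar.act _ (Bar.pure α) = _
  rw [Bar.act_pure, ← Jet.tgt_mul]
  congr 1
  funext i
  refine Fin.cases ?_ (fun i => ?_) i
  · simp
  · simp

/-- The tensor `y` absorbs the factors `α₁, …, α_q` and `x` the next `p` factors. Both absorb them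
into the factor `α₀`, so the products of jets agree. -/
theorem capN_mul {U : C} (p q n m l : ℕ) (h : n = l + (q + p)) (hm : m = l + p) (hn : n = m + q)
    (x : TPow (fn O U) (L.Env U) p) (y : TPow (fn O U) (L.Env U) q) :
    capN L U (q + p) n l h (TensorPower.mulEquiv (y ⊗ₜ x))
      = (capN L U p m l hm x).comp (capN L U q n m hn y) := by
  induction y using PiTensorProduct.induction_on with
  | smul_tprod b E =>
    induction x using PiTensorProduct.induction_on with
    | smul_tprod a D =>
      have h₁ := TensorPower.tprod_mul_tprod (fn O U) E D
      rw [TensorPower.gMul_def] at h₁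
      simp only [← smul_tmul', tmul_smul, map_smul, h₁, HomCont.smul_comp, HomCont.comp_smul]
      rw [smul_comm]
      congr 2
      refine HomCont.ext_pure fun V f α => ?_
      rw [HomCont.comp_app, capN_tprod_pure, capN_tprod_pure, capN_tprod_pure]
      congr 1
      simp only [capTens]
      congr 1
      · rw [Fin.prod_univ_add, Fin.cons_zero, ← mul_assoc]
        simp only [Fin.append_left, Fin.append_right]
        congr 1
      · funext j
        have h1 : (⟨p + j + 1, by omega⟩ : Fin (m + 1)) = Fin.succ ⟨p + j, by omega⟩ := rfl
        rw [h1, Fin.cons_succ]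
        congr 1
        ext
        simp
        omega
    | add x x' hx hx' =>
      simp only [tmul_add, map_add, hx, hx', HomCont.add_comp]
  | add y y' hy hy' => simp only [add_tmul, map_add, hy, hy', HomCont.comp_add]

/-! ### Compatibility of the cap product with the differentials. -/

variable (L) in
/-- `D ⊗ E` acts by the cap product with `D`, then by the cap product with `E`. -/
def capTwo (n : ℕ) (U : C) : L.Env U ⊗[fn O U] L.Env U →ₗ[fn O U] L.HomCont (n + 2) n U :=
  TensorProduct.lift (LinearMap.mk₂ (fn O U) (fun D E => (capOne E n).comp (capOne D (n + 1)))
    (fun D D' E => by rw [capOne_add, HomCont.comp_add])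
    (fun a D E => by rw [capOne_smul, HomCont.comp_smul])
    (fun D E E' => by rw [capOne_add, HomCont.add_comp])
    (fun a D E => by rw [capOne_smul, HomCont.smul_comp]))

theorem capTwo_tmul {n : ℕ} {U : C} (D E : L.Env U) :
    capTwo L n U (D ⊗ₜ E) = (capOne E n).comp (capOne D (n + 1)) := rfl

theorem capN_consTwo {U : C} (p n m : ℕ) (h : n + 2 = m + (p + 2))
    (z : L.Env U ⊗[fn O U] L.Env U) (t : TPow (fn O U) (L.Env U) p) :
    capN L U (p + 2) (n + 2) m h (consTwo _ p z t)
      = (capN L U p n m (by omega) t).comp (capTwo L n U z) := by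
  induction z with
  | zero =>
    rw [map_zero, map_zero, LinearMap.zero_apply, map_zero]
    exact ((HomCont.compLin (n + 2) n m U).map_zero₂ _).symm
  | tmul D E => rw [consTwo_tmul, capN_consT, capN_consT, capTwo_tmul]; rfl
  | add z w hz hw =>
    rw [map_add, LinearMap.add_apply, map_add, hz, hw, map_add, HomCont.comp_add]

theorem capTwo_ofTens {n : ℕ} {U V : C} (z : L.Env U ⊗[fn O U] L.Env U) (f : V ⟶ U)
    (a b c : L.Jet V) (y : TPow (fn O V) (L.Jet V) n) :
    (capTwo L n U z).app f (Bar.ofTens (n + 2) V (consT _ _ a (consT _ _ b (consT _ _ c y))))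
      = Bar.ofTens n V (consT _ n (a * Jet.nablaPair b c
        (TensorProduct.map (L.envResₛₗ f) (L.envResₛₗ f) z)) y) := by
  induction z with
  | zero =>
    simp only [map_zero, mul_zero, LinearMap.zero_apply]
    rfl
  | tmul D E =>
    rw [capTwo_tmul, HomCont.comp_app, capOne_ofTens, capAlg_consT_consT, capOne_ofTens,
      capAlg_consT_consT, TensorProduct.map_tmul, Jet.nablaPair_tmul, mul_assoc]
    rfl
  | add z w hz hw =>
    rw [map_add, HomCont.add_app, hz, hw, map_add, map_add, mul_add, map_add, LinearMap.add_apply,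
      map_add]

theorem barD_zero_consT_consT {R A : Type*} [CommRing R] [CommRing A] [Algebra R A] (ε : A →ₐ[R] R)
    (a c : A) (y : TPow R A 0) : barD R ε 0 (consT R 1 a (consT R 0 c y))
      = consT R 0 (a * (c - algebraMap R A (ε c))) y := by
  induction y using PiTensorProduct.induction_on with
  | smul_tprod r m =>
    rw [map_smul, map_smul, map_smul, map_smul, consT_tprod, barD_zero_consT, consT_tprod]
    congr 2
    funext i
    rw [Fin.fin_one_eq_zero i]
    rfl
  | add x y hx hy => simp only [map_add, hx, hy]

theorem nablaPair_coOne {V : C} (D : L.Env V) (b c : L.Jet V) :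
    Jet.nablaPair b c (coOne (fn O V) D)
      = Jet.nabla D b * c - Jet.nabla D (b * c) + b * Jet.nabla D c := by
  have h : coOne (fn O V) D
      = D ⊗ₜ 1 - Coalgebra.comul (R := fn O V) D + 1 ⊗ₜ D := rfl
  rw [h, map_add, map_sub, Jet.nablaPair_tmul, Jet.nablaPair_tmul, ← Jet.nabla_mul, Jet.nabla_one,
    Jet.nabla_one]

theorem map_coOne {U V : C} (f : V ⟶ U) (D : L.Env U) :
    TensorProduct.map (L.envResₛₗ f) (L.envResₛₗ f) (coOne (fn O U) D)
      = coOne (fn O V) (L.envRes f D) := by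
  have h : ∀ {V : C} (D : L.Env V), coOne (fn O V) D
      = D ⊗ₜ 1 - Coalgebra.comul (R := fn O V) D + 1 ⊗ₜ D := fun _ => rfl
  rw [h, h, map_add, map_sub, TensorProduct.map_tmul, TensorProduct.map_tmul, envRes,
    Envel.comul_map]
  simp only [Envel.mapₛₗ_apply, map_one]

/-- On `a ⊗ b ⊗ c ⊗ y` the terms in which `b'` acts beyond `b` cancel. The remaining ones are `a`
times `²∇_D b · c - ²∇_D(bc) + b · ²∇_D c`, which is the action of `coOne D` on `b` and `c` by the
product rule. -/
theorem capTwo_coOne {U : C} (n : ℕ) (D : L.Env U) :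
    capTwo L n U (coOne (fn O U) D) = (HomCont.bar n U).comp (capOne D (n + 1))
      + (capOne D n).comp (HomCont.bar (n + 1) U) := by
  refine HomCont.ext_ofTens fun V f t => ?_
  induction t using consT_induction with
  | add x y hx hy => rw [map_add, map_add, map_add, hx, hy]
  | cons a t =>
    induction t using consT_induction with
    | add x y hx hy => rw [map_add, map_add, map_add, map_add, hx, hy]
    | cons b t =>
      induction t using consT_induction with
      | add x y hx hy => simp only [map_add, hx, hy]
      | cons c y =>
        rw [capTwo_ofTens, map_coOne, nablaPair_coOne, HomCont.add_app, HomCont.comp_app,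
          HomCont.comp_app, capOne_ofTens, capAlg_consT_consT]
        change _ = Bar.d n V (Bar.ofTens (n + 1) V _)
          + (capOne D n).app f (Bar.d (n + 1) V (Bar.ofTens (n + 2) V _))
        rw [Bar.d_ofTens, Bar.d_ofTens, capOne_ofTens, barD_consT, actFirst_consT, map_sub,
          capAlg_consT_consT, ← map_add]
        congr 1
        cases n with
        | zero =>
          -- When no factor follows `c`, the bar differential ends with `ε(c)`. This scalar passes
          -- through `²∇_D`, which acts by right multiplication on the argument and so is linear for
          -- the unit of jets.
          have h (e : fn O V) : Jet.nabla (L.envRes f D) (b * (c - algebraMap _ _ e))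
              = Jet.nabla (L.envRes f D) (b * c) - Jet.nabla (L.envRes f D) b * algebraMap _ _ e := by
            rw [mul_sub, mul_comm b (algebraMap _ _ _), mul_comm _ (algebraMap _ _ _),
              ← Jet.nabla_algebraMap_mul]
            exact map_sub (Jet.nablaLin (L.envRes f D)) _ _
          rw [barD_zero_consT_consT, barD_zero_consT_consT, capAlg_consT_consT, h]
          simp only [mul_add, mul_sub, map_add, map_sub, LinearMap.add_apply, LinearMap.sub_apply,
            mul_assoc]
          abel
        | succ n =>
          rw [barD_consT, barD_consT, actFirst_consT, actFirst_consT, map_sub, map_sub,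
            capAlg_consT_consT, capAlg_consT_consT]
          simp only [mul_add, mul_sub, map_add, map_sub, LinearMap.add_apply, LinearMap.sub_apply,
            mul_assoc]
          abel

theorem neg_one_pow_smul_eq {R M : Type*} [CommRing R] [AddCommGroup M] [Module R M] (p : ℕ)
    (x : M) : (-1 : R) ^ p • x = (p : ℤ).negOnePow • x := by
  rcases Nat.even_or_odd p with h | h
  · rw [h.neg_one_pow, Int.negOnePow_even _ (by exact_mod_cast h), one_smul, one_smul]
  · rw [h.neg_one_pow, Int.negOnePow_odd _ (by exact_mod_cast h), neg_smul, Units.neg_smul,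
      one_smul, one_smul]

/-- Induction through `coHoch_consT`: the term `D ⊗ d t` is covered by the induction hypothesis and
the term `coOne D ⊗ t` by `capTwo_coOne`. Both produce the cap product with `t` after `b'` after the
cap product with `D`, with opposite signs. -/
theorem capN_coHoch {U : C} (p n m : ℕ) (h : n = m + p) (t : TPow (fn O U) (L.Env U) p) :
    capN L U (p + 1) (n + 1) m (by omega) (coHoch (fn O U) p t)
      = (HomCont.bar m U).comp (capN L U p (n + 1) (m + 1) (by omega) t)
        - (p : ℤ).negOnePow • (capN L U p n m h t).comp (HomCont.bar n U) := by
  induction p generalizing n with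
  | zero =>
    obtain rfl : n = m := h
    rw [Nat.cast_zero, Int.negOnePow_zero, one_smul, eq_comm]
    change _ = capN L U (0 + 1) (n + 1) n _ 0
    rw [map_zero, sub_eq_zero]
    -- In degree `0` the Hochschild differential vanishes, so the claim is that `b'` commutes with
    -- functions; these act through jets on the first factor, over which `b'` is linear.
    induction t using PiTensorProduct.induction_on with
    | smul_tprod r D =>
      rw [map_smul, map_smul, capN_zero, capN_zero, HomCont.comp_smul]
      rfl
    | add x y hx hy => rw [map_add, map_add, HomCont.comp_add, HomCont.add_comp, hx, hy]
  | succ p ih =>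
    obtain ⟨n, rfl⟩ : ∃ n', n = n' + 1 := ⟨m + p, h⟩
    have hs (χ : L.HomCont (n + 2) m U) : ((p + 1 : ℕ) : ℤ).negOnePow • χ
        = -((p : ℤ).negOnePow • χ) := by
      rw [Nat.cast_succ, Int.negOnePow_succ, Units.neg_smul]
    have hz (c : ℤˣ) (χ : L.HomCont (n + 1) m U) (ψ : L.HomCont (n + 2) (n + 1) U) :
        (c • χ).comp ψ = c • χ.comp ψ := rfl
    have hsub (χ χ' : L.HomCont (n + 1) m U) (ψ : L.HomCont (n + 2) (n + 1) U) :
        (χ - χ').comp ψ = χ.comp ψ - χ'.comp ψ := rfl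
    induction t using consT_induction with
    | cons D t =>
      rw [coHoch_consT, map_add, map_smul, neg_one_pow_smul_eq, capN_consT, ih n (by omega) t,
        capN_consTwo, capTwo_coOne, capN_consT, capN_consT, hs, hsub, hz, HomCont.comp_add,
        smul_add, sub_neg_eq_add]
      simp only [sub_add_eq_add_sub]
      change (HomCont.bar m U).comp ((capN L U p (n + 1) (m + 1) _ t).comp (capOne D (n + 1))) + (
        (p : ℤ).negOnePow • (capN L U p n m _ t).comp ((HomCont.bar n U).comp (capOne D (n + 1)))
          + _) - (p : ℤ).negOnePow • (capN L U p n m _ t).comp ((HomCont.bar n U).comp _) = _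
      rw [← add_assoc, add_sub_right_comm, add_sub_cancel_right]
      rfl
    | add x y hx hy =>
      rw [map_add, map_add, hx, hy, map_add, map_add, HomCont.comp_add, HomCont.add_comp, smul_add]
      abel

/-! ### The cap product as a morphism of complexes of sheaves, and its multiplicativity. -/

variable (L) in
/-- The cap product with tensors of sections of the enveloping algebra, in all degrees. -/
def capDeg (p : ℕ) (U : C) : TPow (fn O U) (L.Env U) p →+ L.HomDeg p U :=
  AddMonoidHom.mk' (fun t i => capN L U p i.1.1 i.1.2 (by exact_mod_cast i.2) t)
    (fun _ _ => funext fun _ => map_add _ _ _)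

theorem homD_capDeg {p : ℕ} {U : C} (t : TPow (fn O U) (L.Env U) p) :
    L.homD p (capDeg L p U t) = capDeg L (p + 1) U (coHoch (fn O U) p t) := by
  funext ⟨⟨n, m⟩, h⟩
  cases n with
  | zero => exact absurd h (by push_cast; omega)
  | succ n =>
    exact (L.homD_succ p _ n m h).trans (capN_coHoch p n m (by push_cast at h; omega) t).symm

variable (L) in
/-- The cap product, as a map of presheaves. -/
def capPre (p : ℕ) : L.hochPre p ⟶ L.homPre p where
  app U := AddCommGrpCat.ofHom (capDeg L p U.unop)
  naturality U V f := by
    ext t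
    exact funext fun i => (res_capN f.unop p i.1.1 i.1.2 _ t).symm

variable (L) in
/-- The cap product, as a map of sheaves. -/
def capShf (p : ℕ) : L.hochSheaf p ⟶ L.homSheaf p :=
  ⟨sheafifyLift T (capPre L p) (L.homPre_isSheaf p)⟩

theorem capShf_toHoch {p : ℕ} {U : C} (t : TPow (fn O U) (L.Env U) p) :
    ((capShf L p).hom.app (op U)).hom (L.toHoch p U t) = capDeg L p U t :=
  ConcreteCategory.congr_hom (NatTrans.congr_app
    (toSheafify_sheafifyLift T (capPre L p) (L.homPre_isSheaf p)) (op U)) t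

/-- Maps out of the sheafification agree if they agree on sections of the presheaf. -/
theorem shf_hom_ext {P : Cᵒᵖ ⥤ AddCommGrpCat.{u}} {F : Sheaf T AddCommGrpCat.{u}}
    {φ ψ : shf T P ⟶ F} (h : ∀ U a, (φ.hom.app (op U)).hom (toShf T P U a)
      = (ψ.hom.app (op U)).hom (toShf T P U a)) : φ = ψ :=
  Sheaf.hom_ext (sheafify_hom_ext T _ _ F.property (by
    ext U a
    exact h U.unop a))

theorem capShf_d (p : ℕ) : (presheafToSheaf T AddCommGrpCat.{u}).map (L.hochDPre p)
    ≫ capShf L (p + 1) = capShf L p ≫ L.homSheafD p := shf_hom_ext fun U t => by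
  change ((capShf L (p + 1)).hom.app (op U)).hom
    ((((presheafToSheaf T AddCommGrpCat.{u}).map (L.hochDPre p)).hom.app (op U)).hom
      (toShf T (L.hochPre p) U t))
    = L.homD p (((capShf L p).hom.app (op U)).hom (L.toHoch p U t))
  rw [shf_map_toShf]
  exact (capShf_toHoch _).trans ((homD_capDeg t).symm.trans
    (congr_arg (L.homD p) (capShf_toHoch t).symm))

theorem hom_comp_eq_comp_inv {D : Type*} [Category D] {X Y X' Y' A B : D} (a : X' ≅ X) (b : Y' ≅ Y)
    {d : X ⟶ Y} {δ : A ⟶ B} {φ : X ⟶ A} {ψ : Y ⟶ B} (h : d ≫ ψ = φ ≫ δ) :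
    (a.hom ≫ φ) ≫ δ = (a.hom ≫ d ≫ b.inv) ≫ b.hom ≫ ψ := by
  simp [h]

variable (L) in
/-- The components of the cap product. -/
def capZ : (i : ℤ) → (L.hochComplexZ.X i ⟶ L.homComplex.X i)
  | (p : ℕ) => (L.hochComplex.extendXIso ComplexShape.embeddingUpNat (i := p) rfl).hom ≫ capShf L p
  | Int.negSucc _ => 0

variable (L) in
/-- The cap product, as a morphism of complexes of sheaves. -/
def capMap : L.hochComplexZ ⟶ L.homComplex where
  f := capZ L
  comm' i j hij := by
    obtain rfl : i + 1 = j := hij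
    match i with
    | (p : ℕ) =>
      change capZ L (p : ℤ) ≫ _ = _ ≫ capZ L ((p + 1 : ℕ) : ℤ)
      have h1 : L.hochComplexZ.d (p : ℤ) ((p + 1 : ℕ) : ℤ) = _ :=
        L.hochComplex.extend_d_eq ComplexShape.embeddingUpNat (i := p) (j := p + 1) rfl rfl
      have h2 : L.hochComplex.d p (p + 1)
          = (presheafToSheaf T AddCommGrpCat.{u}).map (L.hochDPre p) :=
        CochainComplex.of_d L.hochSheaf (fun p => (presheafToSheaf T AddCommGrpCat.{u}).map (L.hochDPre p)) p
      have h3 : L.homComplex.d (p : ℤ) (p + 1) = L.homSheafD p := CochainComplex.of_d ..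
      rw [h2] at h1
      refine Eq.trans ?_ (congr_arg (fun z => z ≫ capZ L ((p + 1 : ℕ) : ℤ)) h1.symm)
      refine (congr_arg (fun z => capZ L (p : ℤ) ≫ z) h3).trans ?_
      exact hom_comp_eq_comp_inv (L.hochComplex.extendXIso ComplexShape.embeddingUpNat (i := p) rfl)
        (L.hochComplex.extendXIso ComplexShape.embeddingUpNat (i := p + 1) rfl) (capShf_d p)
    | Int.negSucc n =>
      exact (L.hochComplex.isZero_extend_X ComplexShape.embeddingUpNat (Int.negSucc n)
        (fun j hj => by simp at hj)).eq_of_src _ _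

theorem evalDeg_capMap {p : ℕ} {U : C} (x : (L.hochSheaf p).obj.obj (op U)) :
    evalDeg (capMap L) p x = ((capShf L p).hom.app (op U)).hom x := by
  have h : (L.hochComplex.extendXIso ComplexShape.embeddingUpNat (i := p) (i' := (p : ℤ)) rfl).inv
      ≫ (capMap L).f (p : ℤ) = capShf L p := by
    exact Iso.inv_hom_id_assoc _ _
  exact congr_arg (fun φ => (φ.hom.app (op U)).hom x) h

theorem evalDeg_toHoch {p : ℕ} {U : C} (t : TPow (fn O U) (L.Env U) p) :
    evalDeg (capMap L) p (L.toHoch p U t) = capDeg L p U t := by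
  rw [evalDeg_capMap, capShf_toHoch]

/-- For `p ≥ 0` the intermediate index `l + p` is never negative, so the zero branch of `homMul`
does not occur. -/
theorem homMul_comp {p : ℕ} {q r : ℤ} (hr : p + q = r) {U : C} (φ : L.HomDeg p U)
    (ψ : L.HomDeg q U) (n l : ℕ) (h) : (L.homMul hr φ ψ).comp n l h
      = (φ.comp (l + p) l (by push_cast; rfl)).comp (ψ.comp n (l + p) (by push_cast; omega)) := by
  have key : ∀ m, m = l + p → ∀ h₁ h₂, (φ.comp m l h₁).comp (ψ.comp n m h₂)
      = (φ.comp (l + p) l (by push_cast; rfl)).comp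
        (ψ.comp n (l + p) (by push_cast; omega)) := by
    rintro _ rfl _ _
    rfl
  have hm : 0 ≤ (l : ℤ) + p := by positivity
  have e : (L.homMul hr φ ψ).comp n l h = dite (0 ≤ (l : ℤ) + p)
      (fun _ => (φ.comp ((l : ℤ) + p).toNat l (by omega)).comp
        (ψ.comp n ((l : ℤ) + p).toNat (by omega))) fun _ => 0 := rfl
  rw [e, dif_pos hm]
  exact key ((l : ℤ) + p).toNat (by omega) _ _

theorem homMul_capDeg {p q : ℕ} (h : (p : ℤ) + q = (q + p : ℕ)) {U : C}
    (x : TPow (fn O U) (L.Env U) p) (y : TPow (fn O U) (L.Env U) q) :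
    L.homMul h (capDeg L p U x) (capDeg L q U y)
      = capDeg L (q + p) U (TensorPower.mulEquiv (y ⊗ₜ x)) := by
  funext ⟨⟨n, l⟩, hn⟩
  exact (homMul_comp h _ _ n l hn).trans (capN_mul p q n (l + p) l (by exact_mod_cast hn) rfl
    (by push_cast at hn; omega) x y).symm

theorem rs_homMul {p q : ℕ} (h : (p : ℤ) + q = (q + p : ℕ)) {U V : C} (f : V ⟶ U)
    (φ : L.HomDeg p U) (ψ : L.HomDeg q U) :
    rs (L.homPre (q + p : ℕ)) f (L.homMul h φ ψ)
      = L.homMul h (rs (L.homPre p) f φ) (rs (L.homPre q) f ψ) := by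
  funext ⟨⟨n, l⟩, hn⟩
  refine (congr_arg (HomCont.res f) (homMul_comp h φ ψ n l hn)).trans ?_
  exact (homMul_comp h (rs (L.homPre p) f φ) (rs (L.homPre q) f ψ) n l hn).symm

theorem capShf_cup {p q : ℕ} {U : C} (h : (p : ℤ) + q = (q + p : ℕ))
    (x : (L.hochSheaf p).obj.obj (op U)) (y : (L.hochSheaf q).obj.obj (op U)) :
    ((capShf L (q + p)).hom.app (op U)).hom ((-1 : ℤ) ^ (p * q) • L.cup y x)
      = L.homMul h (((capShf L p).hom.app (op U)).hom x)
        (((capShf L q).hom.app (op U)).hom y) := by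
  obtain ⟨S, hS, hx⟩ := toShf_locally (L.hochPre p) x
  obtain ⟨S', hS', hy⟩ := toShf_locally (L.hochPre q) y
  refine sep (L.homSheaf (q + p : ℕ)) (T.intersection_covering hS hS') fun V f hf => ?_
  obtain ⟨a, ha⟩ := hx f hf.1
  obtain ⟨b, hb⟩ := hy f hf.2
  have h1 : rs (L.hochSheaf (q + p)).obj f (L.cup y x) = L.cupPre q p V b a :=
    biext_spec (P := L.hochPre q) (Q := L.hochPre p) (F := L.hochSheaf (q + p)) (L.cupPre q p)
      (L.rs_cupPre q p) f y x hb ha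
  -- The sign of the opposite product cancels the sign of the cup product, leaving the plain tensor
  -- `b ⊗ a`.
  have h2 : (-1 : ℤ) ^ (p * q) • L.cupPre q p V b a
      = L.toHoch (q + p) V (TensorPower.mulEquiv (b ⊗ₜ a)) := by
    change (-1 : ℤ) ^ (p * q) • ((-1 : ℤ) ^ (q * p) • L.toHoch (q + p) V _) = _
    rw [smul_smul, mul_comm q p, ← mul_pow, neg_one_mul, neg_neg, one_pow, one_smul]
  rw [rs_nat, map_zsmul, h1, h2]
  refine (capShf_toHoch _).trans ((homMul_capDeg h a b).symm.trans ?_)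
  refine Eq.trans ?_ (rs_homMul h f _ _).symm
  have h3 := capShf_toHoch a
  have h4 := capShf_toHoch b
  rw [← h3, ← h4]
  congr 1
  · exact (congr_arg _ ha).trans (rs_nat (capShf L p).hom f x).symm
  · exact (congr_arg _ hb).trans (rs_nat (capShf L q).hom f y).symm

end CapHom

end LieAlgebroid

/-! ### The contracting homotopy -/

/-- The counit on the first tensor power. -/
def epsT (R : Type*) {A : Type*} [CommRing R] [CommRing A] [Algebra R A] (ε : A →ₐ[R] R) :
    TPow R A 1 →ₗ[R] R :=
  PiTensorProduct.lift ((MultilinearMap.mkPiAlgebra R (Fin 1) R).compLinearMap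
    fun _ => ε.toLinearMap)

theorem epsT_tprod (R : Type*) {A : Type*} [CommRing R] [CommRing A] [Algebra R A] (ε : A →ₐ[R] R)
    (m : Fin 1 → A) : epsT R ε (PiTensorProduct.tprod R m) = ε (m 0) := by
  rw [epsT, PiTensorProduct.lift.tprod]
  simp

/-- In degree `0` the contraction `t ↦ 1 ⊗ t` fails to invert `b'` precisely by the counit. -/
theorem barD_zero_one {R A : Type*} [CommRing R] [CommRing A] [Algebra R A] (ε : A →ₐ[R] R)
    (t : TPow R A 1) : barD R ε 0 (consT R 1 1 t)
      = t - epsT R ε t • PiTensorProduct.tprod R fun _ => 1 := by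
  induction t using tens_induction with
  | tprod m =>
    have h := (PiTensorProduct.tprod R (s := fun _ : Fin 1 => A)).map_update_sub m 0 (m 0)
      (ε (m 0) • 1)
    have h' := (PiTensorProduct.tprod R (s := fun _ : Fin 1 => A)).map_update_smul m 0 (ε (m 0)) 1
    have hu : ∀ x, Function.update m 0 x = fun _ => x := fun x => funext fun i => by
      rw [Fin.fin_one_eq_zero i, Function.update_self]
    rw [Function.update_eq_self, h', hu, hu] at h
    rw [barD_zero_consT, epsT_tprod, ← h, one_mul, Algebra.algebraMap_eq_smul_one]
  | add x y hx hy => rw [map_add, map_add, hx, hy, map_add, add_smul]; abel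

namespace LieAlgebroid

section Homotopy

variable {C : Type u} [SmallCategory C] {T : GrothendieckTopology C} {k : Type u} [Field k]
  {O : Sheaf T (CommAlgCat.{u} k)} {L : LieAlgebroid O}

variable (L) in
/-- `α₀ ⊗ ⋯ ⊗ αₘ ↦ 1 ⊗ α₀ ⊗ ⋯ ⊗ αₘ` on the level `q`. -/
def barSPre (m q : ℕ) : L.barPre m q ⟶ L.barPre (m + 1) q where
  app U := AddCommGrpCat.ofHom (consT (fn O U.unop) (m + 1) (1 : L.JetQ q U.unop)).toAddMonoidHom
  naturality U V f := by
    ext x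
    have h := tensMap_consT (semilin (L.jetQRes q f.unop) (L.jetQRes_algebraMap q f.unop)) (m + 1)
      (1 : L.JetQ q U.unop) x
    rw [semilin_apply, map_one (L.jetQRes q f.unop)] at h
    exact h.symm

variable (L) in
/-- `α₀ ⊗ ⋯ ⊗ αₘ ↦ 1 ⊗ α₀ ⊗ ⋯ ⊗ αₘ` on sections of the level `q`. -/
def levelS (m q : ℕ) (U : C) :
    (L.barLevel m q).obj.obj (op U) →+ (L.barLevel (m + 1) q).obj.obj (op U) :=
  (((presheafToSheaf T AddCommGrpCat.{u}).map (L.barSPre m q)).hom.app (op U)).hom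

theorem levelS_toLevel (m q : ℕ) (U : C) (x : TPow (fn O U) (L.JetQ q U) (m + 1)) :
    L.levelS m q U (L.toLevel m q U x) = L.toLevel (m + 1) q U (consT _ (m + 1) 1 x) :=
  shf_map_toShf (L.barSPre m q) U x

theorem rs_levelS (m q : ℕ) {U V : C} (f : V ⟶ U) (x) :
    rs (L.barLevel (m + 1) q).obj f (L.levelS m q U x)
      = L.levelS m q V (rs (L.barLevel m q).obj f x) :=
  rs_nat ((presheafToSheaf T AddCommGrpCat.{u}).map (L.barSPre m q)).hom f x

theorem levelProj_levelS (m q : ℕ) (U : C) (x) :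
    L.levelProj (m + 1) q U (L.levelS m (q + 1) U x) = L.levelS m q U (L.levelProj m q U x) := by
  obtain ⟨S, hS, h⟩ := L.toLevel_locally m (q + 1) x
  refine sep _ hS fun V f hf => ?_
  obtain ⟨a, ha⟩ := h f hf
  rw [rs_levelProj, rs_levelS, rs_levelS, rs_levelProj, ← ha, levelS_toLevel, levelProj_toLevel,
    levelProj_toLevel, levelS_toLevel]
  congr 1
  exact tensMap_consT _ (m + 1) (1 : L.JetQ (q + 1) V) a

namespace Bar

/-- `α₀ ⊗ ⋯ ⊗ αₘ ↦ 1 ⊗ α₀ ⊗ ⋯ ⊗ αₘ`. -/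
def s (m : ℕ) (U : C) : L.Bar m U →+ L.Bar (m + 1) U :=
  AddMonoidHom.mk' (fun x => ⟨fun q => L.levelS m q U (x.1 q), fun q => by
      rw [levelProj_levelS, x.2 q]⟩)
    (fun x y => ext fun q => map_add _ _ _)

theorem res_s (m : ℕ) {U V : C} (f : V ⟶ U) (x : L.Bar m U) :
    res f (s m U x) = s m V (res f x) := ext fun _ => rs_levelS _ _ _ _

theorem s_val_eq {m : ℕ} {U : C} {x y : L.Bar m U} {q : ℕ} (h : x.1 q = y.1 q) :
    (s m U x).1 q = (s m U y).1 q := congr_arg (L.levelS m q U) h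

theorem d_val_eq {m : ℕ} {U : C} {x y : L.Bar (m + 1) U} {q : ℕ} (h : x.1 q = y.1 q) :
    (d m U x).1 q = (d m U y).1 q := congr_arg (L.levelD m q U) h

theorem s_ofTens {m : ℕ} {U : C} (t : TPow (fn O U) (L.Jet U) (m + 1)) :
    s m U (ofTens m U t) = ofTens (m + 1) U (consT _ (m + 1) 1 t) := ext fun q => by
  change L.levelS m q U (L.toLevel m q U _) = L.toLevel (m + 1) q U _
  rw [levelS_toLevel]
  congr 1
  have h := tensMap_consT (σ := RingHom.id (fn O U))
    (semilin (Ideal.Quotient.mk (Jet.augIdeal L U ^ (q + 1))) (fun _ => rfl)) (m + 1)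
    (1 : L.Jet U) t
  rw [semilin_apply, map_one (Ideal.Quotient.mk _)] at h
  exact h.symm

/-- Inserting a factor in front destroys `J`-linearity, but scalars from `O` move freely between the
factors. This much makes `sextBil` bilinear over `O`. -/
theorem s_act_algebraMap {m : ℕ} {U : C} (a : fn O U) (x : L.Bar m U) :
    s m U (act (algebraMap (fn O U) (L.Jet U) a) x)
      = act (algebraMap (fn O U) (L.Jet U) a) (s m U x) := by
  refine ext fun q => ?_
  obtain ⟨S, hS, h⟩ := ofTens_locally x q
  refine sep _ hS fun V f hf => ?_
  obtain ⟨t, ht⟩ := h f hf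
  have h1 : res f (s m U (act (algebraMap (fn O U) (L.Jet U) a) x))
      = s m V (act (algebraMap (fn O V) (L.Jet V) (fnRes O f a)) (res f x)) := by
    rw [res_s, res_act, Jet.res_algebraMap]
  have h2 : res f (act (algebraMap (fn O U) (L.Jet U) a) (s m U x))
      = act (algebraMap (fn O V) (L.Jet V) (fnRes O f a)) (s m V (res f x)) := by
    rw [res_act, res_s, Jet.res_algebraMap]
  have h3 : s m V (act (algebraMap (fn O V) (L.Jet V) (fnRes O f a)) (ofTens m V t))
      = act (algebraMap (fn O V) (L.Jet V) (fnRes O f a)) (s m V (ofTens m V t)) := by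
    rw [s_ofTens, act_ofTens, act_ofTens, actFirst_algebraMap, actFirst_algebraMap, s_ofTens,
      LinearMap.map_smul]
  have h4 := act_val_eq (algebraMap (fn O V) (L.Jet V) (fnRes O f a)) (s_val_eq ht)
  have h5 := s_val_eq (act_val_eq (algebraMap (fn O V) (L.Jet V) (fnRes O f a)) ht)
  change (res f (s m U _)).1 q = (res f (act _ _)).1 q
  rw [h1, h2, ← h4, ← h5, h3]

theorem d_s {m : ℕ} {U : C} (x : L.Bar (m + 1) U) :
    d (m + 1) U (s (m + 1) U x) = x - s m U (d m U x) := by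
  refine ext fun q => ?_
  obtain ⟨S, hS, h⟩ := ofTens_locally x q
  refine sep _ hS fun V f hf => ?_
  obtain ⟨t, ht⟩ := h f hf
  change (res f (d (m + 1) U (s (m + 1) U x))).1 q = (res f (x - s m U (d m U x))).1 q
  rw [res_d, map_sub, res_s, res_s, res_d]
  refine (d_val_eq (s_val_eq ht.symm)).trans
    (Eq.trans ?_ (congr_arg₂ _ ht (s_val_eq (d_val_eq ht))))
  rw [s_ofTens, d_ofTens, d_ofTens, s_ofTens, barD_consT, map_one, map_sub]
  rfl

/-- The value of the counit on a tensor of jets that vanishes on the level `0`. -/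
theorem epsT_eq_zero_locally {U : C} {t : TPow (fn O U) (L.Jet U) 1}
    (h : (ofTens 0 U t).1 0 = 0) : ∃ S ∈ T U, ∀ ⦃V : C⦄ (f : V ⟶ U), S f →
      epsT (fn O V) (Jet.counit V) (jetTensRes L 0 f t) = 0 := by
  obtain ⟨S, hS, h'⟩ := ofTens_eq_zero_locally h
  refine ⟨S, hS, fun V f hf => ?_⟩
  have h2 := h' f hf
  generalize jetTensRes L 0 f t = t' at h2 ⊢
  induction h2 using Submodule.span_induction with
  | mem x hx =>
    obtain ⟨α, i, hα, rfl⟩ := hx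
    rw [Fin.fin_one_eq_zero i, zero_add, pow_one] at hα
    rw [epsT_tprod]
    exact hα
  | zero => exact map_zero _
  | add x y _ _ hx hy => rw [map_add, hx, hy, add_zero]
  | smul a x _ hx => rw [map_smul, hx, smul_zero]

theorem d_s_zero {U : C} {x : L.Bar 0 U} (hx : x.1 0 = 0) : d 0 U (s 0 U x) = x := by
  refine ext fun q => ?_
  obtain ⟨S, hS, h⟩ := ofTens_locally x q
  -- The level `0` of `B_0` is the sheafification of `J / Jᶜ`, so the counit of an approximating
  -- tensor vanishes only after one more refinement.
  obtain ⟨S', hS', h'⟩ := cover_trans (P := fun V (f : V ⟶ U) => ∃ t,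
    (ofTens 0 V t).1 q = (res f x).1 q ∧ epsT (fn O V) (Jet.counit V) t = 0) hS (fun V f hf => by
      obtain ⟨t, ht⟩ := h f hf
      have h0 : (ofTens 0 V t).1 0 = 0 := by
        rw [val_eq_of_le (Nat.zero_le q) ht]
        exact (congr_arg (rs (L.barLevel 0 0).obj f) hx).trans (map_zero _)
      obtain ⟨S', hS', h'⟩ := epsT_eq_zero_locally h0
      refine ⟨S', hS', fun W g hg => ⟨jetTensRes L 0 g t, ?_, h' g hg⟩⟩
      rw [← res_ofTens, res_comp]
      exact congr_arg (rs (L.barLevel 0 q).obj g) ht)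
  refine sep _ hS' fun V f hf => ?_
  obtain ⟨t, ht, h0⟩ := h' f hf
  change (res f (d 0 U (s 0 U x))).1 q = (res f x).1 q
  rw [res_d, res_s, ← ht]
  refine (d_val_eq (s_val_eq ht.symm)).trans ?_
  rw [s_ofTens, d_ofTens, barD_zero_one, h0, zero_smul, sub_zero]

/-- The counit kills boundaries: `b'(a ⊗ c) = a (c - ε(c))` lies in `Jᶜ`, the kernel of the
projection to the level `0`. -/
theorem d_val_zero {U : C} (x : L.Bar 1 U) : (d 0 U x).1 0 = 0 := by
  obtain ⟨S, hS, h⟩ := ofTens_locally x 0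
  refine sep _ hS fun V f hf => ?_
  obtain ⟨t, ht⟩ := h f hf
  rw [map_zero]
  change (res f (d 0 U x)).1 0 = 0
  rw [res_d, d_val_eq ht.symm]
  clear ht
  induction t using tens_induction with
  | tprod m =>
    rw [d_ofTens, tprod_eq_consT, barD_zero_consT]
    refine ofTens_tprod_val_eq_zero 0 (Ideal.mul_mem_left _ _ ?_)
    rw [zero_add, pow_one]
    change Jet.counit V _ = 0
    rw [map_sub, AlgHom.commutes]
    exact sub_self _
  | add x y hx hy =>
    rw [map_add, map_add]
    exact (congr_arg₂ _ hx hy).trans (add_zero _)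

theorem act_val_eq_zero {m r : ℕ} {U : C} {j : L.Jet U} (h : j ∈ Jet.augIdeal L U ^ (r + 1))
    (x : L.Bar m U) : (act j x).1 r = 0 := by
  change L.levelAct m r U j (x.1 r) = 0
  obtain ⟨S, hS, hx⟩ := L.toLevel_locally m r (x.1 r)
  refine sep _ hS fun V f hf => ?_
  obtain ⟨t, ht⟩ := hx f hf
  have h0 : (Ideal.Quotient.mk _ (Jet.res f j) : L.JetQ r V) = 0 :=
    Ideal.Quotient.eq_zero_iff_mem.2 (L.augIdeal_pow_le f (r + 1) h)
  rw [rs_levelAct, ← ht, levelAct_toLevel, h0, map_zero, map_zero, LinearMap.zero_apply, map_zero]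

end Bar

/-! ### The `J`-linear extension of the contraction, and the homotopy. -/

/-- `a, y ↦ a · (1 ⊗ χ(1 ⊗ y))`. -/
def sextBil {n m : ℕ} {U V : C} (χ : L.HomCont n m U) (f : V ⟶ U) :
    L.Jet V →ₗ[fn O V] TPow (fn O V) (L.Jet V) n →ₗ[fn O V] L.Bar (m + 1) V :=
  LinearMap.mk₂ (fn O V)
    (fun a y => Bar.act a (Bar.s m V (χ.app f (Bar.ofTens n V (consT _ n 1 y)))))
    (fun a b y => Bar.act_add a b _)
    (fun c a y => by
      rw [Algebra.smul_def, Bar.act_mul]; rfl)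
    (fun a y z => by simp only [map_add])
    (fun c a y => by
      have h : ∀ z, χ.app f (c • z) = c • χ.app f z := fun z => χ.app_act f _ z
      rw [map_smul, Bar.ofTens_smul, h, Bar.smul_def, Bar.smul_eq_act, Bar.s_act_algebraMap,
        ← Bar.act_mul,
        mul_comm, Bar.act_mul]
      rfl)

theorem sextBil_apply {n m : ℕ} {U V : C} (χ : L.HomCont n m U) (f : V ⟶ U) (a y) :
    sextBil χ f a y = Bar.act a (Bar.s m V (χ.app f (Bar.ofTens n V (consT _ n 1 y)))) := rfl

/-- `a ⊗ y ↦ a · (1 ⊗ χ(1 ⊗ y))`. -/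
def sextTens {n m : ℕ} {U V : C} (χ : L.HomCont n m U) (f : V ⟶ U) :
    TPow (fn O V) (L.Jet V) (n + 1) →ₗ[fn O V] L.Bar (m + 1) V :=
  PiTensorProduct.lift (LinearMap.uncurryLeft (M := fun _ : Fin (n + 1) => L.Jet V)
    { toFun := fun a => (sextBil χ f a).compMultilinearMap (PiTensorProduct.tprod (fn O V))
      map_add' := fun a b => by rw [map_add]; rfl
      map_smul' := fun c a => by rw [map_smul]; rfl })

theorem sextTens_consT {n m : ℕ} {U V : C} (χ : L.HomCont n m U) (f : V ⟶ U) (a : L.Jet V)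
    (y : TPow (fn O V) (L.Jet V) n) : sextTens χ f (consT _ n a y)
      = Bar.act a (Bar.s m V (χ.app f (Bar.ofTens n V (consT _ n 1 y)))) := by
  rw [← sextBil_apply]
  induction y using PiTensorProduct.induction_on with
  | smul_tprod r α =>
    rw [map_smul, map_smul, map_smul, consT_tprod, sextTens, PiTensorProduct.lift.tprod]
    rfl
  | add x y hx hy => simp only [map_add, hx, hy]

/-- The family of maps `a ⊗ y ↦ a · (1 ⊗ χ(1 ⊗ y))`. -/
def sextFam {n m : ℕ} {U : C} (χ : L.HomCont n m U) : TensFam L n (m + 1) U where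
  map f := (sextTens χ f).toAddMonoidHom
  res_map f g t := by
    change Bar.res g (sextTens χ f t) = sextTens χ (g ≫ f) (jetTensRes L n g t)
    induction t using consT_induction with
    | cons a y =>
      have h := tensMap_consT (semilin (Jet.res g) (Jet.res_algebraMap g)) n a y
      have h' := tensMap_consT (semilin (Jet.res (L := L) g) (Jet.res_algebraMap g)) n 1 y
      rw [semilin_apply, map_one (Jet.res g)] at h'
      refine Eq.trans ?_ (congr_arg (sextTens χ (g ≫ f)) h).symm
      rw [sextTens_consT, sextTens_consT, Bar.res_act, Bar.res_s, HomCont.res_app, Bar.res_ofTens]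
      exact congr_arg (fun z => Bar.act (Jet.res g a) (Bar.s m _ (χ.app (g ≫ f)
        (Bar.ofTens n _ z)))) h'
    | add x y hx hy => simp only [map_add, hx, hy]
  map_act f j t := by
    change sextTens χ f _ = Bar.act j (sextTens χ f t)
    induction t using consT_induction with
    | cons a y => rw [actFirst_consT, sextTens_consT, sextTens_consT, Bar.act_mul]
    | add x y hx hy => simp only [map_add, hx, hy]
  cont r := by
    refine ⟨_, χ.contSieve_mem r, fun V f hf => ?_⟩
    obtain ⟨q, hq⟩ := hf
    -- If the first factor is small, multiplication by it kills the level `r`; if a later factor is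
    -- small, the bound `q` for `χ` makes `χ(1 ⊗ y)` vanish on the level `r`.
    refine ⟨max q r, fun W g α i hα => ?_⟩
    change (sextTens χ (g ≫ f) (PiTensorProduct.tprod _ α)).1 r = 0
    have hle : ∀ {i}, i ≤ max q r → Jet.augIdeal L W ^ (max q r + 1) ≤ Jet.augIdeal L W ^ (i + 1) :=
      fun h => Ideal.pow_le_pow_right (by omega)
    rw [tprod_eq_consT, sextTens_consT]
    refine Fin.cases (fun h0 => ?_) (fun i hi => ?_) i hα
    · exact Bar.act_val_eq_zero (hle (le_max_right _ _) h0) _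
    · have h : (Bar.s m W (χ.app (g ≫ f) (Bar.ofTens n W (consT _ n 1
          (PiTensorProduct.tprod (fn O W) (Fin.tail α)))))).1 r = 0 := by
        refine (Bar.s_val_eq (y := 0) (hq g _ ?_)).trans (by rw [map_zero]; rfl)
        rw [consT_tprod]
        exact ofTens_tprod_val_eq_zero i.succ (hle (le_max_left _ _) hi)
      exact (Bar.act_val_eq (y := 0) _ h).trans (by rw [map_zero]; rfl)

/-- The `J`-linear extension of `1 ⊗ y ↦ 1 ⊗ χ(1 ⊗ y)`. -/
def sext {n m : ℕ} {U : C} (χ : L.HomCont n m U) : L.HomCont n (m + 1) U := (sextFam χ).toHomCont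

theorem sext_app {n m : ℕ} {U V : C} (χ : L.HomCont n m U) (f : V ⟶ U) (a : L.Jet V)
    (y : TPow (fn O V) (L.Jet V) n) : (sext χ).app f (Bar.ofTens n V (consT _ n a y))
      = Bar.act a (Bar.s m V (χ.app f (Bar.ofTens n V (consT _ n 1 y)))) :=
  ((sextFam χ).toHomCont_ofTens f _).trans (sextTens_consT χ f a y)

theorem HomCont.ext_consT {n m : ℕ} {U : C} {φ ψ : L.HomCont n m U}
    (h : ∀ ⦃V : C⦄ (f : V ⟶ U) a y, φ.app f (Bar.ofTens n V (consT _ n a y))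
      = ψ.app f (Bar.ofTens n V (consT _ n a y))) : φ = ψ :=
  ext_ofTens fun V f t => by
    induction t using consT_induction with
    | cons a y => exact h f a y
    | add x y hx hy => simp only [map_add, hx, hy]

theorem sext_add {n m : ℕ} {U : C} (χ χ' : L.HomCont n m U) : sext (χ + χ') = sext χ + sext χ' :=
  HomCont.ext_consT fun V f a y => by
    rw [HomCont.add_app, sext_app, sext_app, sext_app, HomCont.add_app, map_add, map_add]

theorem res_sext {n m : ℕ} {U V : C} (f : V ⟶ U) (χ : L.HomCont n m U) :
    HomCont.res f (sext χ) = sext (HomCont.res f χ) :=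
  HomCont.ext_consT fun W g a y => by
    rw [HomCont.app_res, sext_app, sext_app, HomCont.app_res]

theorem act_app_consT {n m : ℕ} {U V : C} (χ : L.HomCont n m U) (f : V ⟶ U) (a : L.Jet V)
    (y : TPow (fn O V) (L.Jet V) n) :
    Bar.act a (χ.app f (Bar.ofTens n V (consT _ n 1 y)))
      = χ.app f (Bar.ofTens n V (consT _ n a y)) := by
  rw [← HomCont.app_act, Bar.act_ofTens, actFirst_consT, mul_one]

/-- By `J`-linearity this is a claim about `1 ⊗ y`, where `b's = 1 - sb'` and the last term dies on
cycles. -/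
theorem bar_sext {n m : ℕ} {U : C} {χ : L.HomCont n (m + 1) U}
    (h : (HomCont.bar m U).comp χ = 0) : (HomCont.bar (m + 1) U).comp (sext χ) = χ :=
  HomCont.ext_consT fun V f a y => by
    have h' : ∀ x, Bar.d m V (χ.app f x) = 0 := fun x => congr_arg (fun ψ => ψ.app f x) h
    change Bar.d (m + 1) V ((sext χ).app f _) = _
    rw [sext_app, Bar.d_act, Bar.d_s, h', map_zero, sub_zero, act_app_consT]

/-- For maps into `B_0` the cycle condition is replaced by the vanishing of the counit, as in
`Bar.d_s_zero`. -/
theorem bar_sext_zero {n : ℕ} {U : C} {χ : L.HomCont n 0 U}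
    (h : ∀ ⦃V : C⦄ (f : V ⟶ U) x, (χ.app f x).1 0 = 0) :
    (HomCont.bar 0 U).comp (sext χ) = χ :=
  HomCont.ext_consT fun V f a y => by
    change Bar.d 0 V ((sext χ).app f _) = _
    rw [sext_app, Bar.d_act, Bar.d_s_zero (h f _), act_app_consT]

/-- The components of the homotopy that corrects a cocycle with values in the augmentation
ideal. -/
def rhoAux {q : ℤ} {U : C} (φ : L.HomDeg (q + 1) U) :
    (m n : ℕ) → ((n : ℤ) = m + q) → L.HomCont n m U
  | 0, _, _ => 0
  | m + 1, 0, h => sext (φ.comp 0 m (by push_cast at h ⊢; omega))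
  -- The equation `dρ = φ` in the component `B_{n+1} → B_m` reads `b' ρ = φ + (-1)^q ρ b'`, where
  -- the `ρ` on the left has target `B_{m+1}` and the one on the right has target `B_m`; `sext`
  -- solves it for the former.
  | m + 1, n + 1, h => sext (φ.comp (n + 1) m (by push_cast at h ⊢; omega)
      + q.negOnePow • (rhoAux φ m n (by push_cast at h ⊢; omega)).comp (HomCont.bar n U))

/-- The homotopy that corrects a cocycle with values in the augmentation ideal. -/
def rho {q : ℤ} {U : C} (φ : L.HomDeg (q + 1) U) : L.HomDeg q U :=
  fun i => rhoAux φ i.1.2 i.1.1 i.2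

theorem rhoAux_add {q : ℤ} {U : C} (φ ψ : L.HomDeg (q + 1) U) (m n : ℕ) (h) :
    rhoAux (φ + ψ) m n h = rhoAux φ m n h + rhoAux ψ m n h := by
  induction m generalizing n with
  | zero => exact (add_zero _).symm
  | succ m ih =>
    cases n with
    | zero => exact sext_add _ _
    | succ n =>
      rw [rhoAux, rhoAux, rhoAux, ih, HomCont.add_comp, smul_add, ← sext_add]
      congr 1
      exact add_add_add_comm _ _ _ _

theorem res_rhoAux {q : ℤ} {U V : C} (f : V ⟶ U) (φ : L.HomDeg (q + 1) U) (m n : ℕ) (h) :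
    HomCont.res f (rhoAux φ m n h) = rhoAux (fun i => HomCont.res f (φ i)) m n h := by
  induction m generalizing n with
  | zero => rfl
  | succ m ih =>
    cases n with
    | zero => exact res_sext f _
    | succ n =>
      rw [rhoAux, rhoAux, res_sext, map_add, ← ih]
      rfl

variable (L) in
/-- The homotopy, as a map of sheaves. -/
def rhoShf (q : ℤ) : L.homSheaf (q + 1) ⟶ L.homSheaf q where
  hom :=
    { app := fun _ => AddCommGrpCat.ofHom (AddMonoidHom.mk' (rho (L := L) (q := q))
        fun φ ψ => funext fun i => rhoAux_add φ ψ i.1.2 i.1.1 i.2)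
      naturality := fun _ _ f => by
        ext φ
        exact funext fun i => (res_rhoAux f.unop φ i.1.2 i.1.1 i.2).symm }

variable (L) in
/-- The families of maps with values in the augmentation ideal of `B_0`. -/
def augSub (p : ℤ) (U : C) : AddSubgroup (L.HomDeg p U) where
  carrier := {φ | ∀ (n : ℕ) (h : (n : ℤ) = (0 : ℕ) + p) ⦃V : C⦄ (f : V ⟶ U) (x : L.Bar n V),
    ((φ.comp n 0 h).app f x).1 0 = 0}
  zero_mem' _ _ _ _ _ := rfl
  add_mem' hφ hψ n h _ f x := (congr_arg₂ _ (hφ n h f x) (hψ n h f x)).trans (add_zero _)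
  neg_mem' hφ n h _ f x := (congr_arg _ (hφ n h f x)).trans neg_zero

/-- Values of `b'` in `B_0` have zero counit by `Bar.d_val_zero`, and precomposition with `b'` does
not enlarge the image. So `augSub` is a subcomplex. -/
theorem homD_mem_augSub {p : ℤ} {U : C} {φ : L.HomDeg p U} (hφ : φ ∈ augSub L p U) :
    L.homD p φ ∈ augSub L (p + 1) U := by
  intro n h V f x
  cases n with
  | zero => exact Bar.d_val_zero _
  | succ n =>
    have h1 : (((φ.comp n 0 (by push_cast at h ⊢; omega)).comp (HomCont.bar n U)).app f x).1 0
        = 0 := hφ n _ f _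
    have h2 : (((p.negOnePow • (φ.comp n 0 (by push_cast at h ⊢; omega)).comp
        (HomCont.bar n U)).app f x)).1 0 = 0 := by
      rcases Int.units_eq_one_or p.negOnePow with hp | hp
      · rw [hp, one_smul]; exact h1
      · rw [hp, Units.neg_smul, one_smul]; exact (congr_arg _ h1).trans neg_zero
    rw [L.homD_succ]
    exact (congr_arg₂ _ (Bar.d_val_zero _) h2).trans (sub_zero _)

/-- Induction on the degree of the target. The hypotheses ensure that the map to which `sext` was
applied can be recovered by `b'`: it has zero counit when the target is `B_0`, and is a `b'`-cycle
otherwise. -/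
theorem homD_rho {q : ℤ} {U : C} {φ : L.HomDeg (q + 1) U} (h₀ : φ ∈ augSub L (q + 1) U)
    (h₁ : L.homD (q + 1) φ = 0) : L.homD q (rho φ) = φ := by
  have h₁' : ∀ n m h, (L.homD (q + 1) φ).comp n m h = 0 := fun n m h => by rw [h₁]; rfl
  have key : ∀ (m n : ℕ) (h : (n : ℤ) = m + (q + 1)),
      (L.homD q (rho φ)).comp n m h = φ.comp n m h := by
    intro m
    induction m with
    | zero =>
      intro n h
      cases n with
      | zero => exact bar_sext_zero (h₀ 0 h)
      | succ n =>
        rw [homD_succ]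
        have h2 : (rho φ).comp n 0 (by push_cast at h ⊢; omega) = 0 := rfl
        have h3 : (rho φ).comp (n + 1) (0 + 1) (by push_cast at h ⊢; omega)
            = sext (φ.comp (n + 1) 0 h) := by
          change sext (_ + q.negOnePow • (0 : L.HomCont n 0 U).comp (HomCont.bar n U)) = _
          have h4 : (0 : L.HomCont n 0 U).comp (HomCont.bar n U) = 0 := rfl
          rw [h4, smul_zero, add_zero]
        have h4 : (0 : L.HomCont n 0 U).comp (HomCont.bar n U) = 0 := rfl
        rw [h2, h3, h4, smul_zero, sub_zero]
        exact bar_sext_zero (h₀ (n + 1) h)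
    | succ m ih =>
      intro n h
      cases n with
      | zero => exact bar_sext (h₁' 0 m (by push_cast at h ⊢; omega))
      | succ n =>
        -- The induction hypothesis for the target `B_m`, composed with `b'` on the right; the
        -- remaining term contains `b' b' = 0`.
        have hc : ((HomCont.bar m U).comp ((rho φ).comp n (m + 1)
              (by push_cast at h ⊢; omega))).comp (HomCont.bar n U)
            = (φ.comp n m (by push_cast at h ⊢; omega)).comp (HomCont.bar n U) := by
          have h2 := ih n (by push_cast at h ⊢; omega)
          cases n with
          | zero => rw [← h2]; rfl
          | succ n =>
            rw [← h2, homD_succ]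
            have h3 : (((rho φ).comp n m (by push_cast at h ⊢; omega)).comp
                (HomCont.bar n U)).comp (HomCont.bar (n + 1) U) = 0 :=
              HomCont.ext fun V f x =>
                (congr_arg (((rho φ).comp n m (by push_cast at h ⊢; omega)).app f)
                  (Bar.d_d n x)).trans (map_zero _)
            have h4 : ∀ (χ χ' : L.HomCont (n + 1) m U) (ψ : L.HomCont (n + 2) (n + 1) U),
                (χ - q.negOnePow • χ').comp ψ = χ.comp ψ - q.negOnePow • χ'.comp ψ :=
              fun _ _ _ => rfl
            rw [h4, h3, smul_zero, sub_zero]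
        -- By `hc` the cycle condition becomes the cocycle condition for `φ` in the component
        -- `B_{n+1} → B_m`.
        have hb : (HomCont.bar m U).comp (φ.comp (n + 1) (m + 1) h + q.negOnePow •
            ((rho φ).comp n (m + 1) (by push_cast at h ⊢; omega)).comp (HomCont.bar n U)) = 0 := by
          have h3 : ∀ χ : L.HomCont (n + 1) (m + 1) U, (HomCont.bar m U).comp (q.negOnePow • χ)
              = q.negOnePow • (HomCont.bar m U).comp χ := fun χ =>
            HomCont.ext fun V _ _ => map_zsmul (Bar.d m V) (q.negOnePow : ℤ) _
          have h4 := h₁' (n + 1) m (by push_cast at h ⊢; omega)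
          rw [homD_succ, Int.negOnePow_succ, Units.neg_smul, sub_neg_eq_add, ← hc] at h4
          rw [HomCont.comp_add, h3]
          exact h4
        rw [homD_succ]
        exact sub_eq_of_eq_add (bar_sext hb)
  exact funext fun ⟨⟨n, m⟩, h⟩ => key m n h

end Homotopy

end LieAlgebroid

/-! ### Continuous maps are cap products modulo the augmentation ideal -/

theorem exists_finset_card_lt {ι : Type*} [Fintype ι] [DecidableEq ι] (q : ℕ) :
    ∃ s : Finset (Multiset ι), ∀ M : Multiset ι, M.card < q → M ∈ s :=
  ⟨(Finset.range q).biUnion fun n => (Finset.univ : Finset (Sym ι n)).image fun z => z.1,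
    fun M hM => Finset.mem_biUnion.2 ⟨M.card, Finset.mem_range.2 hM,
      Finset.mem_image.2 ⟨(⟨M, rfl⟩ : Sym ι M.card), Finset.mem_univ _, rfl⟩⟩⟩

theorem cover_finset {C : Type u} [SmallCategory C] {T : GrothendieckTopology C} {V : C}
    {κ : Type*} (s : Finset κ) {P : κ → ∀ ⦃W : C⦄, (W ⟶ V) → Prop}
    (h : ∀ i, ∃ S ∈ T V, ∀ ⦃W : C⦄ (g : W ⟶ V), S g → P i g) :
    ∃ S ∈ T V, ∀ ⦃W : C⦄ (g : W ⟶ V), S g → ∀ i ∈ s, P i g := by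
  classical
  induction s using Finset.induction_on with
  | empty => exact ⟨⊤, T.top_mem V, by simp⟩
  | insert a s _ ih =>
    obtain ⟨S, hS, hs⟩ := ih
    obtain ⟨S', hS', hs'⟩ := h a
    refine ⟨_, T.intersection_covering hS hS', fun W g hg i hi => ?_⟩
    rcases Finset.mem_insert.1 hi with rfl | hi
    · exact hs' g hg.2
    · exact hs g hg.1 i hi

namespace LieAlgebroid

section Local

variable {C : Type u} [SmallCategory C] {T : GrothendieckTopology C} {k : Type u} [Field k]
  {O : Sheaf T (CommAlgCat.{u} k)} {L : LieAlgebroid O}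

namespace Bar

variable (L) in
/-- Functions as sections of `B_0`. -/
def const (U : C) : fn O U →+ L.Bar 0 U :=
  AddMonoidHom.mk' (fun a => ofTens 0 U (a • PiTensorProduct.tprod (fn O U) fun _ => 1))
    fun a b => by rw [add_smul, map_add]

theorem const_apply {U : C} (a : fn O U) :
    const L U a = ofTens 0 U (a • PiTensorProduct.tprod (fn O U) fun _ => 1) := rfl

/-- The difference `t - ε(t) · 1` is the boundary of `1 ⊗ t`, hence vanishes on the level `0`. With
the lemmas that follow, this identifies the level `0` of `B_0` with `O`, locally. -/
theorem ofTens_val_zero {U : C} (t : TPow (fn O U) (L.Jet U) 1) :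
    (ofTens 0 U t).1 0 = (const L U (epsT (fn O U) (Jet.counit U) t)).1 0 := by
  have h := d_val_zero (ofTens 1 U (consT _ 1 1 t))
  rw [d_ofTens, barD_zero_one, map_sub] at h
  exact sub_eq_zero.1 h

theorem res_const {U V : C} (f : V ⟶ U) (a : fn O U) :
    res f (const L U a) = const L V (fnRes O f a) := by
  rw [const_apply, const_apply, res_ofTens, LinearMap.map_smulₛₗ, tensMap_tprod]
  exact congr_arg (ofTens 0 V) (congr_arg (fnRes O f a • ·)
    (congr_arg _ (funext fun _ => map_one (Jet.res f))))

theorem act_const {U : C} (a b : fn O U) :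
    act (algebraMap (fn O U) (L.Jet U) a) (const L U b) = const L U (a * b) := by
  rw [const_apply, const_apply, act_ofTens, actFirst_algebraMap, mul_smul]

theorem const_locally {U : C} (z : L.Bar 0 U) : ∃ S ∈ T U, ∀ ⦃V : C⦄ (f : V ⟶ U), S f →
    ∃ a, (res f z).1 0 = (const L V a).1 0 := by
  obtain ⟨S, hS, h⟩ := ofTens_locally z 0
  refine ⟨S, hS, fun V f hf => ?_⟩
  obtain ⟨t, ht⟩ := h f hf
  exact ⟨_, ht.symm.trans (ofTens_val_zero t)⟩

theorem const_eq_zero_locally {U : C} {a : fn O U} (h : (const L U a).1 0 = 0) :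
    ∃ S ∈ T U, ∀ ⦃V : C⦄ (f : V ⟶ U), S f → fnRes O f a = 0 := by
  obtain ⟨S, hS, h'⟩ := epsT_eq_zero_locally h
  refine ⟨S, hS, fun V f hf => ?_⟩
  have h2 := h' f hf
  rw [LinearMap.map_smulₛₗ, tensMap_tprod, LinearMap.map_smul, epsT_tprod] at h2
  refine Eq.trans ?_ h2
  refine (mul_one _).symm.trans (congr_arg (fnRes O f a * ·) ?_)
  exact ((congr_arg (Jet.counit V) (map_one (Jet.res f))).trans (map_one _)).symm

end Bar

/-- The pairing of tensors with jets. -/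
def pairN {p : ℕ} {V : C} (α : Fin p → L.Jet V) : TPow (fn O V) (L.Env V) p →ₗ[fn O V] fn O V :=
  PiTensorProduct.lift ((MultilinearMap.mkPiAlgebra (fn O V) (Fin p) (fn O V)).compLinearMap
    fun i => (α i).eval (𝟙 V))

theorem pairN_tprod {p : ℕ} {V : C} (α : Fin p → L.Jet V) (D : Fin p → L.Env V) :
    pairN α (PiTensorProduct.tprod (fn O V) D) = ∏ i, (α i).eval (𝟙 V) (D i) := by
  rw [pairN, PiTensorProduct.lift.tprod]
  rfl

theorem Jet.counit_nabla {V : C} (D : L.Env V) (α : L.Jet V) :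
    counit V (nabla D α) = α.eval (𝟙 V) D := by
  have h : counit V (nabla D α) = α.eval (𝟙 V) (1 * L.envRes (𝟙 V) D) := rfl
  rw [h, one_mul, envRes_id]

theorem Jet.counit_tgt {V : C} (a : fn O V) : counit V (tgt L V a) = a := by
  have h : counit V (tgt L V a) = (1 : L.Jet V).eval (𝟙 V) (Envel.incl k _ _ a) :=
    counit_nabla _ _
  have h' := Envel.counit_incl_mul (k := k) (L := L.sec V) a 1
  rw [mul_one, Envel.counit_one, mul_one] at h'
  rw [h, eval_one, h']

/-- Since `ε(²∇_D α) = α(D)` and `ε` is multiplicative, the cap product modulo the augmentation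
ideal is the duality pairing of tensors with jets. Both halves of the decomposition rest on this. -/
theorem capN_val_zero {U V : C} (p : ℕ) (h : p = 0 + p) (t : TPow (fn O U) (L.Env U) p) (f : V ⟶ U)
    (α : Fin p → L.Jet V) :
    ((capN L U p p 0 h t).app f (Bar.pure (Fin.cons 1 α))).1 0
      = (Bar.const L V (pairN α (tensMap (L.envResₛₗ f) t))).1 0 := by
  induction t using PiTensorProduct.induction_on with
  | smul_tprod r D =>
    rw [LinearMap.map_smul, LinearMap.map_smulₛₗ, LinearMap.map_smul, HomCont.smul_app,
      capN_tprod_pure, ← Bar.ofTens_tprod, Bar.act_ofTens, actFirst_tprod, Bar.ofTens_val_zero,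
      epsT_tprod, tensMap_tprod, pairN_tprod, Pi.mul_apply, map_mul, Pi.mulSingle_eq_same,
      Jet.counit_tgt, capTens, Fin.cons_zero, Fin.cons_zero, one_mul]
    have h1 : Jet.counit V (∏ i, Jet.nabla (L.envRes f (D i)) (α i))
        = ∏ i, (α i).eval (𝟙 V) (L.envRes f (D i)) :=
      (map_prod (Jet.counit V) _ _).trans (Finset.prod_congr rfl fun i _ => Jet.counit_nabla _ _)
    refine congr_arg (fun z => (Bar.const L V z).1 0) (congr_arg (fnRes O f r * ·) ?_)
    exact h1
  | add x y hx hy =>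
    simp only [map_add]
    exact congr_arg₂ _ hx hy

theorem pure_eq_act {p : ℕ} {V : C} (α : Fin (p + 1) → L.Jet V) :
    (Bar.pure α : L.Bar p V) = Bar.act (α 0) (Bar.pure (Fin.cons 1 (Fin.tail α))) := by
  rw [Bar.act_pure]
  congr 1
  funext i
  refine Fin.cases ?_ (fun i => ?_) i
  · simp
  · simp [Fin.tail]

/-- Maps that agree modulo the augmentation ideal on `1 ⊗ α₁ ⊗ ⋯ ⊗ αₙ` agree modulo the
augmentation ideal. -/
theorem HomCont.app_level_eq_of_cons {n m r : ℕ} {U : C} {φ ψ : L.HomCont n m U}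
    (h : ∀ ⦃V : C⦄ (f : V ⟶ U) (α : Fin n → L.Jet V), (φ.app f (Bar.pure (Fin.cons 1 α))).1 r
      = (ψ.app f (Bar.pure (Fin.cons 1 α))).1 r) {V : C} (f : V ⟶ U) (x : L.Bar n V) :
    (φ.app f x).1 r = (ψ.app f x).1 r := by
  refine sub_eq_zero.1 (app_level_eq (φ := φ - ψ) (fun V f α => ?_) f x)
  rw [sub_app, pure_eq_act, app_act, app_act]
  exact sub_eq_zero.2 (Bar.act_val_eq _ (h f _))

variable {d : ℕ} {V : C} {e : Fin d → L.sec V}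

theorem prod_sum_smul {R A N : Type*} [CommRing R] [AddCommGroup A] [Module R A] [AddCommGroup N]
    [Module R N] {p : ℕ} {κ : Type*} [DecidableEq κ] (F : MultilinearMap R (fun _ : Fin p => A) N)
    (s : Finset κ) (c : Fin p → κ → R) (b : κ → A) :
    F (fun i => ∑ M ∈ s, c i M • b M)
      = ∑ I ∈ Fintype.piFinset fun _ : Fin p => s, (∏ i, c i (I i)) • F fun i => b (I i) := by
  rw [F.map_sum_finset]
  exact Finset.sum_congr rfl fun I _ => F.map_smul_univ _ _

theorem span_tprod_eq_top {R A κ : Type*} [CommRing R] [AddCommGroup A] [Module R A] {p : ℕ}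
    (b : κ → A) (hb : Submodule.span R (Set.range b) = ⊤) :
    Submodule.span R (Set.range fun I : Fin p → κ => PiTensorProduct.tprod R fun i => b (I i))
      = ⊤ := by
  classical
  rw [eq_top_iff, ← PiTensorProduct.span_tprod_eq_top, Submodule.span_le]
  rintro _ ⟨D, rfl⟩
  have h : ∀ i, ∃ c : κ →₀ R, (c.sum fun M a => a • b M) = D i := fun i =>
    Finsupp.mem_span_range_iff_exists_finsupp.1 (hb ▸ Submodule.mem_top)
  choose c hc using h
  have h' : D = fun i => ∑ M ∈ Finset.univ.biUnion fun i => (c i).support, c i M • b M := by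
    funext i
    rw [← hc i]
    exact Finsupp.sum_of_support_subset _
      (Finset.subset_biUnion_of_mem (fun i => (c i).support) (Finset.mem_univ i)) _
      fun M _ => zero_smul _ _
  rw [h', prod_sum_smul]
  exact Submodule.sum_mem _ fun I _ => Submodule.smul_mem _ _ (Submodule.subset_span ⟨I, rfl⟩)

theorem IsFrame.pairN_dual (he : IsFrame e) {p : ℕ} {W : C} (g : W ⟶ V)
    (I J : Fin p → Multiset (Fin d)) : pairN (fun i => he.dual g (I i))
      (PiTensorProduct.tprod (fn O W) fun i => frameMonom e g (J i)) = if J = I then 1 else 0 := by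
  rw [pairN_tprod]
  have h : ∀ i, (he.dual g (I i)).eval (𝟙 W) (frameMonom e g (J i))
      = if J i = I i then 1 else 0 := fun i => he.jetCoeff_dual g (I i) (J i)
  simp only [h]
  rw [Finset.prod_ite_zero]
  simp [funext_iff]

/-- Pairing with the dual jets reads off the coefficients of `t` on tensors of monomials. Each
vanishes only locally, which suffices because the conclusion is about a section of a sheaf. -/
theorem IsFrame.toHoch_eq_zero (he : IsFrame e) {p : ℕ} {t : TPow (fn O V) (L.Env V) p}
    (h : ∀ α : Fin p → L.Jet V, (Bar.const L V (pairN α t)).1 0 = 0) : L.toHoch p V t = 0 := by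
  classical
  have ht : t ∈ Submodule.span (fn O V) (Set.range fun I : Fin p → Multiset (Fin d) =>
      PiTensorProduct.tprod (fn O V) fun i => (frameMonom e (𝟙 V) (I i) : L.Env V)) := by
    rw [span_tprod_eq_top _ (he.span_frameMonom (𝟙 V))]; trivial
  obtain ⟨c, rfl⟩ := Finsupp.mem_span_range_iff_exists_finsupp.1 ht
  have hc : ∀ I, (Bar.const L V (c I)).1 0 = 0 := by
    intro I
    have h1 := h fun i => he.dual (𝟙 V) (I i)
    rw [Finsupp.sum, map_sum] at h1
    simp only [LinearMap.map_smul, he.pairN_dual, smul_eq_mul, mul_ite, mul_one, mul_zero,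
      Finset.sum_ite_eq'] at h1
    split_ifs at h1 with hI
    · exact h1
    · rw [Finsupp.notMem_support_iff.1 hI, map_zero]; rfl
  rw [Finsupp.sum, map_sum]
  refine Finset.sum_eq_zero fun I _ => ?_
  obtain ⟨S, hS, h'⟩ := Bar.const_eq_zero_locally (hc I)
  refine sep (L.hochSheaf p) hS fun W f hf => ?_
  refine (rs_toShf (L.hochPre p) f _).trans ?_
  rw [map_zero]
  refine (congr_arg (L.toHoch p W) ?_).trans (map_zero _)
  refine (LinearMap.map_smulₛₗ (tensMap (ι := Fin p) (L.envResₛₗ f)) (c I) _).trans ?_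
  have h2 : (fnRes O f : fn O V →+* fn O W) (c I) = 0 := h' f hf
  rw [h2, zero_smul]

/-- By continuity the counit of `φ(1 ⊗ α₁ ⊗ ⋯ ⊗ αₚ)` depends only on the Taylor expansions of the
`αᵢ` up to order `q`. It is thus a finite sum of products of their coefficients `αᵢ(monomial)`,
which is the pairing with a tensor of monomials. -/
theorem IsFrame.exists_capN [CharZero k] (he : IsFrame e) {p : ℕ} (hp : p = 0 + p)
    (φ : L.HomCont p 0 V) (q : ℕ)
    (hq : ∀ ⦃W : C⦄ (g : W ⟶ V) x, x.1 q = 0 → (φ.app g x).1 0 = 0) :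
    ∃ S ∈ T V, ∀ ⦃W : C⦄ (g : W ⟶ V), S g → ∃ t : TPow (fn O W) (L.Env W) p,
      ∀ ⦃W' : C⦄ (h : W' ⟶ W) x, (φ.app (h ≫ g) x).1 0
        = ((capN L W p p 0 hp t).app h x).1 0 := by
  classical
  -- The level `q` is the quotient by the power `q + 1`, so the monomials of degree at most `q` are
  -- needed.
  obtain ⟨s, hs⟩ := exists_finset_card_lt (ι := Fin d) (q + 1)
  set s' := Fintype.piFinset fun _ : Fin p => s
  -- The coefficients of the tensor are the counits of the values of `φ` on dual jets. They are
  -- functions only locally, but finitely many of them need only one covering.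
  obtain ⟨S, hS, hc⟩ := cover_finset s' fun I : Fin p → Multiset (Fin d) => Bar.const_locally
    (φ.app (𝟙 V) (Bar.pure (Fin.cons 1 fun i => he.dual (𝟙 V) (I i))))
  refine ⟨S, hS, fun W g hg => ?_⟩
  have hc' := hc g hg
  choose! c hc' using hc'
  refine ⟨∑ I ∈ s', c I • PiTensorProduct.tprod (fn O W) fun i => frameMonom e g (I i),
    fun W' h x => ?_⟩
  refine HomCont.app_level_eq_of_cons (φ := HomCont.res g φ) (fun W' h α => ?_) h x
  rw [capN_val_zero, HomCont.app_res]
  have h1 : ∀ I ∈ s', (φ.app (h ≫ g) (Bar.pure (Fin.cons 1 fun i => he.dual (h ≫ g) (I i)))).1 0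
      = (Bar.const L W' (fnRes O h (c I))).1 0 := by
    intro I hI
    have h2 := congr_arg (rs (L.barLevel 0 0).obj h) (hc' I hI)
    change (Bar.res h (Bar.res g (φ.app (𝟙 V) _))).1 0 = (Bar.res h (Bar.const L W (c I))).1 0 at h2
    rw [Bar.res_const, ← Bar.res_comp, HomCont.res_app, Category.comp_id, Bar.res_pure] at h2
    have hα : (fun i => Jet.res (h ≫ g)
        ((Fin.cons 1 fun i => he.dual (𝟙 V) (I i) : Fin (p + 1) → L.Jet V) i))
          = Fin.cons 1 fun i => he.dual (h ≫ g) (I i) := by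
      funext i
      refine Fin.cases ?_ (fun i => ?_) i
      · exact map_one (Jet.res (h ≫ g))
      · exact (he.res_dual (𝟙 V) (h ≫ g) (I i)).trans (by rw [Category.comp_id]; rfl)
    rw [hα] at h2
    exact h2
  -- The Taylor expansion of each factor, multiplied out, holds on the level `q`.
  have h2 : (Bar.pure (Fin.cons 1 α) : L.Bar p W').1 q
      = (Bar.ofTens p W' (consT _ p 1 (∑ I ∈ s', (∏ i, jetCoeff e (h ≫ g) (α i) (I i)) •
        PiTensorProduct.tprod (fn O W') fun i => he.dual (h ≫ g) (I i)))).1 q := by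
    rw [← prod_sum_smul, consT_tprod, Bar.ofTens_tprod]
    change L.toLevel p q W' _ = L.toLevel p q W' _
    congr 2
    funext i
    refine Fin.cases rfl (fun i => ?_) i
    exact Ideal.Quotient.eq.2 (he.sub_sum_dual_mem (h ≫ g) (q + 1) s hs (α i))
  have h3 : ∀ x y : L.Bar p W', x.1 q = y.1 q →
      (φ.app (h ≫ g) x).1 0 = (φ.app (h ≫ g) y).1 0 := fun x y hxy => by
    have := hq (h ≫ g) (x - y) (sub_eq_zero.2 hxy)
    rw [map_sub] at this
    exact sub_eq_zero.1 this
  rw [h3 _ _ h2]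
  simp only [map_sum, LinearMap.map_smulₛₗ, tensMap_tprod, pairN_tprod]
  have h4 : ∀ (F : (Fin p → Multiset (Fin d)) → L.Bar 0 W'),
      (∑ I ∈ s', F I).1 0 = ∑ I ∈ s', (F I).1 0 := fun F => by
    rw [AddSubgroup.val_finsetSum, Finset.sum_apply]
  rw [h4, h4]
  refine Finset.sum_congr rfl fun I hI => ?_
  have h5 : ∀ i, (α i).eval (𝟙 W') (L.envResₛₗ h (frameMonom e g (I i)))
      = jetCoeff e (h ≫ g) (α i) (I i) := fun i => by
    rw [jetCoeff, ← envRes_frameMonom]; rfl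
  simp only [h5]
  rw [Bar.ofTens_smul, Bar.smul_def, Bar.smul_eq_act, HomCont.app_act, consT_tprod,
    Bar.ofTens_tprod]
  refine (Bar.act_val_eq _ (h1 I hI)).trans ?_
  rw [Bar.act_const, mul_comm]
  rfl

theorem augSub_res {p : ℤ} {U V : C} (f : V ⟶ U) {φ : L.HomDeg p U} (h : φ ∈ augSub L p U) :
    rs (L.homPre p) f φ ∈ augSub L p V := fun n hn _ g x => h n hn (g ≫ f) x

theorem augSub_local {p : ℤ} {U : C} {S : Sieve U} (hS : S ∈ T U) {φ : L.HomDeg p U}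
    (h : ∀ ⦃V : C⦄ (f : V ⟶ U), S f → rs (L.homPre p) f φ ∈ augSub L p V) :
    φ ∈ augSub L p U := by
  intro n hn V f x
  refine sep _ (T.pullback_stable f hS) fun W g hg => ?_
  rw [map_zero]
  change (Bar.res g ((φ.comp n 0 hn).app f x)).1 0 = 0
  rw [HomCont.res_app]
  have h2 := h (g ≫ f) hg n hn (𝟙 W) (Bar.res g x)
  change ((φ.comp n 0 hn).app (𝟙 W ≫ g ≫ f) (Bar.res g x)).1 0 = 0 at h2
  rwa [Category.id_comp] at h2


end Local

end LieAlgebroid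

/-! ### The retraction of the cap product -/

/-- A morphism of sheaves whose image is a complement of a family of subgroups has a retraction. -/
theorem exists_retraction {C : Type u} [SmallCategory C] {T : GrothendieckTopology C}
    {F G : Sheaf T AddCommGrpCat.{u}} (Φ : F ⟶ G) (A : ∀ U, AddSubgroup (G.obj.obj (op U)))
    (hres : ∀ ⦃U V : C⦄ (f : V ⟶ U) x, x ∈ A U → rs G.obj f x ∈ A V)
    (hex : ∀ U (y : G.obj.obj (op U)), ∃ x, y - (Φ.hom.app (op U)).hom x ∈ A U)
    (hinj : ∀ U (x : F.obj.obj (op U)), (Φ.hom.app (op U)).hom x ∈ A U → x = 0) :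
    ∃ Ψ : G ⟶ F, ∀ U (y : G.obj.obj (op U)),
      y - (Φ.hom.app (op U)).hom ((Ψ.hom.app (op U)).hom y) ∈ A U := by
  choose ψ hψ using hex
  -- The component in the image is unique, which forces the chosen `ψ` to be additive and natural.
  have huniq : ∀ U x y, y - (Φ.hom.app (op U)).hom x ∈ A U → ψ U y = x := fun U x y h => by
    have h1 := sub_mem h (hψ U y)
    rw [sub_sub_sub_cancel_left, ← map_sub] at h1
    exact sub_eq_zero.1 (hinj U _ h1)
  refine ⟨⟨{ app := fun U => AddCommGrpCat.ofHom (AddMonoidHom.mk' (ψ U.unop) fun a b =>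
      huniq _ _ _ ?_), naturality := fun U V f => ?_ }⟩, fun U y => hψ U y⟩
  · rw [map_add, add_sub_add_comm]
    exact add_mem (hψ _ a) (hψ _ b)
  · ext y
    refine huniq V.unop (rs F.obj f.unop (ψ U.unop y)) _ ?_
    have h := hres f.unop _ (hψ U.unop y)
    rw [map_sub] at h
    rwa [rs_nat] at h

namespace LieAlgebroid

section Local

variable {C : Type u} [SmallCategory C] {T : GrothendieckTopology C} {k : Type u} [Field k]
  {O : Sheaf T (CommAlgCat.{u} k)} {L : LieAlgebroid O} {d : ℕ}

variable (L) in
/-- The cap product, on sections. -/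
def capSec (p : ℕ) (U : C) : (L.hochSheaf p).obj.obj (op U) →+ L.HomDeg p U :=
  ((capShf L p).hom.app (op U)).hom

theorem capSec_toHoch {p : ℕ} {U : C} (t : TPow (fn O U) (L.Env U) p) :
    capSec L p U (L.toHoch p U t) = capDeg L p U t := capShf_toHoch t

theorem res_capSec {p : ℕ} {U V : C} (f : V ⟶ U) (x : (L.hochSheaf p).obj.obj (op U)) :
    rs (L.homPre p) f (capSec L p U x) = capSec L p V (rs (L.hochSheaf p).obj f x) :=
  rs_nat (capShf L p).hom f x

variable (L) in
/-- The restriction of families of maps. -/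
def homRes (p : ℤ) {U V : C} (f : V ⟶ U) : L.HomDeg p U →+ L.HomDeg p V := rs (L.homPre p) f

/-- Locally `x` is a tensor and there is a frame; by `capN_val_zero` the tensor pairs to zero with
all jets, so it defines the zero section. -/
theorem capSec_eq_zero [CharZero k] (hL : L.IsLocallyFreeOfRank d) {p : ℕ} {U : C}
    {x : (L.hochSheaf p).obj.obj (op U)} (h : capSec L p U x ∈ augSub L p U) : x = 0 := by
  obtain ⟨S, hS, h1⟩ := toShf_locally (L.hochPre p) x
  obtain ⟨S', hS', h2⟩ := hL U
  refine sep (L.hochSheaf p) (T.intersection_covering hS hS') fun V f hf => ?_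
  obtain ⟨t, ht⟩ := h1 f hf.1
  obtain ⟨e, he⟩ := h2 f hf.2
  rw [map_zero]
  refine ht.symm.trans (IsFrame.toHoch_eq_zero (e := e) he fun α => ?_)
  have h3 := capN_val_zero p (zero_add p).symm t (𝟙 V) α
  have h4 : tensMap (L.envResₛₗ (𝟙 V)) t = t := rs_id (L.hochPre p) V t
  rw [h4] at h3
  refine h3.symm.trans ?_
  have h5 : homRes L p f (capSec L p U x) ∈ augSub L p V := augSub_res f h
  have h6 : homRes L p f (capSec L p U x) = capDeg L p V t :=
    (res_capSec f x).trans ((congr_arg (capSec L p V) ht.symm).trans (capSec_toHoch t))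
  rw [h6] at h5
  exact h5 p (by simp) (𝟙 V) _

theorem exists_sub_capSec_mem [CharZero k] (hL : L.IsLocallyFreeOfRank d) {p : ℕ} {U : C}
    (φ : L.HomDeg p U) : ∃ x, φ - capSec L p U x ∈ augSub L p U := by
  have hloc : ∃ S ∈ T U, ∀ ⦃V : C⦄ (f : V ⟶ U), S f →
      ∃ x, homRes L p f φ - capSec L p V x ∈ augSub L p V := by
    obtain ⟨S', hS', h2⟩ := hL U
    have hp : (p : ℤ) = (0 : ℕ) + (p : ℤ) := by simp
    refine cover_trans (T.intersection_covering hS' ((φ.comp p 0 hp).contSieve_mem 0)) ?_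
    rintro V f ⟨hf, q, hq⟩
    obtain ⟨e, he⟩ := h2 f hf
    obtain ⟨S, hS, h⟩ := IsFrame.exists_capN (e := e) he (zero_add p).symm
      (HomCont.res f (φ.comp p 0 hp)) q hq
    refine ⟨S, hS, fun W g hg => ?_⟩
    obtain ⟨t, ht⟩ := h g hg
    refine ⟨L.toHoch p W t, ?_⟩
    rw [capSec_toHoch]
    intro n hn W' f' x
    obtain rfl : n = p := by simpa using hn
    refine sub_eq_zero.2 (Eq.trans ?_ (ht f' x))
    change ((φ.comp n 0 _).app (f' ≫ g ≫ f) x).1 0 = ((φ.comp n 0 _).app ((f' ≫ g) ≫ f) x).1 0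
    rw [Category.assoc]
  obtain ⟨S, hS, h⟩ := hloc
  choose! x hx using h
  -- Two local solutions differ by a section whose cap product lies in `augSub`, so they agree by
  -- `capSec_eq_zero`.
  obtain ⟨z, hz⟩ := exists_glue (L.hochSheaf p) hS (fun V f _ => x f) fun V W f hf g => by
    have h1 : homRes L p g (homRes L p f φ - capSec L p V (x f)) ∈ augSub L p W :=
      augSub_res g (hx f hf)
    have h2 : homRes L p (g ≫ f) φ = homRes L p g (homRes L p f φ) :=
      rs_comp (L.homPre p) f g φ
    have h3 : homRes L p g (capSec L p V (x f)) = capSec L p W (rs (L.hochSheaf p).obj g (x f)) :=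
      res_capSec g _
    have h4 := sub_mem h1 (hx (g ≫ f) (S.downward_closed hf g))
    rw [map_sub, h2, h3, sub_sub_sub_cancel_left, ← map_sub] at h4
    exact sub_eq_zero.1 (capSec_eq_zero hL h4)
  refine ⟨z, augSub_local hS fun V f hf => ?_⟩
  change homRes L p f (φ - capSec L p U z) ∈ augSub L p V
  have h3 : homRes L p f (capSec L p U z) = capSec L p V (rs (L.hochSheaf p).obj f z) :=
    res_capSec f _
  rw [map_sub, h3, hz f hf]
  exact hx f hf

variable (L) in
/-- The cap product in degree `i`, on sections. -/
def capZSec (i : ℤ) (U : C) : (L.hochComplexZ.X i).obj.obj (op U) →+ L.HomDeg i U :=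
  ((capZ L i).hom.app (op U)).hom

theorem capZSec_eq_zero [CharZero k] (hL : L.IsLocallyFreeOfRank d) {i : ℤ} {U : C}
    {x : (L.hochComplexZ.X i).obj.obj (op U)} (h : capZSec L i U x ∈ augSub L i U) : x = 0 := by
  match i, x, h with
  | (p : ℕ), x, h =>
    have h1 := capSec_eq_zero hL (p := p) (x := ((L.hochComplex.extendXIso
      ComplexShape.embeddingUpNat (i := p) (i' := (p : ℤ)) rfl).hom.hom.app (op U)).hom x) h
    have h2 := congr_arg (((L.hochComplex.extendXIso
      ComplexShape.embeddingUpNat (i := p) (i' := (p : ℤ)) rfl).inv.hom.app (op U)).hom) h1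
    refine Eq.trans ?_ (h2.trans (map_zero _))
    exact (congr_arg (fun φ => (φ.hom.app (op U)).hom x) (Iso.hom_inv_id (L.hochComplex.extendXIso
      ComplexShape.embeddingUpNat (i := p) (i' := (p : ℤ)) rfl))).symm
  | Int.negSucc n, x, _ =>
    exact congr_arg (fun φ => (φ.hom.app (op U)).hom x)
      ((L.hochComplex.isZero_extend_X ComplexShape.embeddingUpNat (Int.negSucc n)
        (fun j hj => by simp at hj)).eq_of_src (𝟙 _) 0)

theorem exists_sub_capZSec_mem [CharZero k] (hL : L.IsLocallyFreeOfRank d) {i : ℤ} {U : C}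
    (φ : L.HomDeg i U) : ∃ x, φ - capZSec L i U x ∈ augSub L i U := by
  match i, φ with
  | (p : ℕ), φ =>
    obtain ⟨x, hx⟩ := exists_sub_capSec_mem hL φ
    refine ⟨((L.hochComplex.extendXIso
      ComplexShape.embeddingUpNat (i := p) (i' := (p : ℤ)) rfl).inv.hom.app (op U)).hom x, ?_⟩
    have h : capZSec L p U (((L.hochComplex.extendXIso
      ComplexShape.embeddingUpNat (i := p) (i' := (p : ℤ)) rfl).inv.hom.app (op U)).hom x)
        = capSec L p U x := evalDeg_capMap x
    rw [h]
    exact hx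
  -- In negative degree no component ends in `B_0`, so the condition that defines `augSub` is empty.
  | Int.negSucc n, φ => exact ⟨0, fun m h => by omega⟩

end Local

end LieAlgebroid

/-! ### Quasi-isomorphisms with a retraction -/

-- On homology `1 - ΨΦ` is zero, so the retraction is a two-sided inverse. The condition on `ρ` is
-- stated for generalized elements killed by the differential, since `ρ` is not a homotopy on all
-- cochains.
open CategoryTheory.Limits HomologicalComplex in
theorem quasiIso_of_retraction {D : Type*} [Category D] [Abelian D] {K A : CochainComplex D ℤ}
    (Φ : K ⟶ A) (Ψ : A ⟶ K) (h : Φ ≫ Ψ = 𝟙 K) (ρ : ∀ q : ℤ, A.X (q + 1) ⟶ A.X q)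
    (hρ : ∀ (q : ℤ) ⦃Z : D⦄ (z : Z ⟶ A.X (q + 1)), z ≫ A.d (q + 1) (q + 1 + 1) = 0 →
      (z ≫ (𝟙 A - Ψ ≫ Φ).f (q + 1) ≫ ρ q) ≫ A.d q (q + 1) = z ≫ (𝟙 A - Ψ ≫ Φ).f (q + 1)) :
    QuasiIso Φ := by
  refine (quasiIso_iff Φ).2 fun i => (quasiIsoAt_iff_isIso_homologyMap Φ i).2 ?_
  obtain ⟨q, rfl⟩ : ∃ q, i = q + 1 := ⟨i - 1, by ring⟩
  have h0 : homologyMap (𝟙 A - Ψ ≫ Φ) (q + 1) = 0 := by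
    rw [← cancel_epi (A.homologyπ (q + 1)), homologyπ_naturality, comp_zero]
    -- The hypothesis is applied to the universal cocycle, the inclusion of the cycles.
    have h1 : cyclesMap (𝟙 A - Ψ ≫ Φ) (q + 1)
        = (A.iCycles (q + 1) ≫ (𝟙 A - Ψ ≫ Φ).f (q + 1) ≫ ρ q) ≫ A.toCycles q (q + 1) := by
      rw [← cancel_mono (A.iCycles (q + 1)), cyclesMap_i, Category.assoc _ (A.toCycles q (q + 1)),
        toCycles_i]
      exact (hρ q _ (A.iCycles_d _ _)).symm
    rw [h1, Category.assoc, toCycles_comp_homologyπ, comp_zero]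
  refine ⟨homologyMap Ψ (q + 1), ?_, ?_⟩
  · rw [← homologyMap_comp, h, homologyMap_id]
  · rw [homologyMap_sub, homologyMap_id, sub_eq_zero] at h0
    rw [← homologyMap_comp, ← h0]

namespace LieAlgebroid

section Local

variable {C : Type u} [SmallCategory C] {T : GrothendieckTopology C} {k : Type u} [Field k]
  {O : Sheaf T (CommAlgCat.{u} k)} {L : LieAlgebroid O} {d : ℕ}

variable (L) in
/-- The differential of `homComplex`, on sections. -/
theorem homComplex_d (i : ℤ) {U : C} (φ : L.HomDeg i U) :
    ((L.homComplex.d i (i + 1)).hom.app (op U)).hom φ = L.homD i φ :=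
  congr_arg (fun δ : L.homSheaf i ⟶ L.homSheaf (i + 1) => (δ.hom.app (op U)).hom φ)
    (CochainComplex.of_d ..)

variable (L) in
theorem capZSec_d (i : ℤ) {U : C} (x : (L.hochComplexZ.X i).obj.obj (op U)) :
    capZSec L (i + 1) U (((L.hochComplexZ.d i (i + 1)).hom.app (op U)).hom x)
      = L.homD i (capZSec L i U x) :=
  (congr_arg (fun δ : L.hochComplexZ.X i ⟶ L.homSheaf (i + 1) => (δ.hom.app (op U)).hom x)
    ((capMap L).comm i (i + 1))).symm.trans (homComplex_d L i _)

variable (L) in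
/-- The differential of the complex of continuous endomorphisms, as an additive map. -/
def homDAdd (i : ℤ) (U : C) : L.HomDeg i U →+ L.HomDeg (i + 1) U :=
  ((L.homSheafD i).hom.app (op U)).hom

/-- The projections in the various degrees commute with the differentials because `augSub` is a
subcomplex, the cap product is a morphism of complexes and the decomposition is unique. -/
theorem exists_retraction_capMap [CharZero k] (hL : L.IsLocallyFreeOfRank d) :
    ∃ Ψ : L.homComplex ⟶ L.hochComplexZ, capMap L ≫ Ψ = 𝟙 _ ∧ ∀ i U (φ : L.HomDeg i U),
      φ - capZSec L i U (((Ψ.f i).hom.app (op U)).hom φ) ∈ augSub L i U := by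
  have h : ∀ i, ∃ ψ : L.homSheaf i ⟶ L.hochComplexZ.X i, ∀ U (φ : L.HomDeg i U),
      φ - capZSec L i U ((ψ.hom.app (op U)).hom φ) ∈ augSub L i U := fun i =>
    exists_retraction (F := L.hochComplexZ.X i) (G := L.homSheaf i) (capZ L i)
      (fun U => augSub L i U) (fun U V f x hx => augSub_res f hx)
      (fun U y => exists_sub_capZSec_mem hL y) fun U x hx => capZSec_eq_zero hL hx
  choose ψ hψ using h
  have hinj : ∀ (i : ℤ) (U : C) (φ : L.HomDeg i U) (x y : (L.hochComplexZ.X i).obj.obj (op U)),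
      φ - capZSec L i U x ∈ augSub L i U → φ - capZSec L i U y ∈ augSub L i U → x = y := by
    intro i U φ x y hx hy
    have h1 := sub_mem hy hx
    rw [sub_sub_sub_cancel_left, ← map_sub] at h1
    exact sub_eq_zero.1 (capZSec_eq_zero hL h1)
  refine ⟨⟨ψ, ?_⟩, ?_, hψ⟩
  · rintro i _ rfl
    have key : ∀ U (φ : L.HomDeg i U), ((L.hochComplexZ.d i (i + 1)).hom.app (op U)).hom
        (((ψ i).hom.app (op U)).hom φ) = ((ψ (i + 1)).hom.app (op U)).hom (L.homD i φ) := by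
      intro U φ
      refine hinj (i + 1) U (L.homD i φ) _ _ ?_ (hψ (i + 1) U (L.homD i φ))
      rw [capZSec_d]
      have h2 : homDAdd L i U (φ - capZSec L i U (((ψ i).hom.app (op U)).hom φ))
          ∈ augSub L (i + 1) U := homD_mem_augSub (hψ i U φ)
      rwa [map_sub] at h2
    ext U φ
    exact (key U.unop φ).trans (congr_arg ((ψ (i + 1)).hom.app U).hom (homComplex_d L i φ)).symm
  · ext i U x
    refine hinj i U.unop (capZSec L i U.unop x) _ _ (hψ i U.unop (capZSec L i U.unop x)) ?_
    have h1 : capZSec L i U.unop x - capZSec L i U.unop x ∈ augSub L i U.unop := by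
      rw [sub_self]; exact zero_mem _
    exact h1

/-- The map `1 - ΨΦ` sends a cocycle to a cocycle in `augSub`, and there `homD_rho` exhibits `rho`
as a primitive. -/
theorem quasiIso_capMap [CharZero k] (hL : L.IsLocallyFreeOfRank d) : QuasiIso (capMap L) := by
  obtain ⟨Ψ, h, hΨ⟩ := exists_retraction_capMap hL
  refine quasiIso_of_retraction (capMap L) Ψ h (fun q => rhoShf L q) fun q Z z hz => ?_
  ext U w
  set y : L.HomDeg (q + 1) U.unop := ((z.hom.app U).hom w) with hy
  have hd : L.homD (q + 1) y = 0 := (homComplex_d L (q + 1) y).symm.trans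
    (congr_arg (fun δ : Z ⟶ L.homSheaf (q + 1 + 1) => (δ.hom.app U).hom w) hz)
  set e := y - capZSec L (q + 1) U.unop (((Ψ.f (q + 1)).hom.app (op U.unop)).hom y) with he
  have h1 : e ∈ augSub L (q + 1) U.unop := hΨ (q + 1) U.unop y
  -- The subtracted part is a cocycle too, since both `Ψ` and the cap product commute with the
  -- differentials.
  have h2 : L.homD (q + 1) e = 0 := by
    have h3 : homDAdd L (q + 1) U.unop e = L.homD (q + 1) y - L.homD (q + 1)
      (capZSec L (q + 1) U.unop (((Ψ.f (q + 1)).hom.app (op U.unop)).hom y)) := map_sub _ _ _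
    refine h3.trans ?_
    rw [hd, ← capZSec_d, zero_sub, neg_eq_zero]
    have h4 : ((L.hochComplexZ.d (q + 1) (q + 1 + 1)).hom.app (op U.unop)).hom
        (((Ψ.f (q + 1)).hom.app (op U.unop)).hom y)
        = ((Ψ.f (q + 1 + 1)).hom.app (op U.unop)).hom (L.homD (q + 1) y) := by
      refine (congr_arg (fun δ : L.homSheaf (q + 1) ⟶ L.hochComplexZ.X (q + 1 + 1) =>
        (δ.hom.app (op U.unop)).hom y) (Ψ.comm (q + 1) (q + 1 + 1))).trans ?_
      exact congr_arg _ (homComplex_d L (q + 1) y)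
    rw [h4, hd]
    refine (congr_arg (capZSec L (q + 1 + 1) U.unop)
      (map_zero ((Ψ.f (q + 1 + 1)).hom.app (op U.unop)).hom)).trans (map_zero _)
  exact (homComplex_d L q (rho e)).trans (homD_rho h1 h2)

end Local

end LieAlgebroid

end LieAlgd

end

theorem mainTheorem5 {C : Type u} [SmallCategory C] {T : GrothendieckTopology C}
    {k : Type u} [Field k] [CharZero k] (O : Sheaf T (CommAlgCat.{u} k))
    (L : LieAlgebroid O) (d : ℕ) (hL : L.IsLocallyFreeOfRank d) :
    ∃ Φ : L.hochComplexZ ⟶ L.homComplex,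
      -- on pure tensors, `Φ` is given by the cap product
      (∀ (p : ℕ) (U V : C) (f : V ⟶ U) (D : Fin p → L.Env U) (n m : ℕ) (h : (n : ℤ) = m + p)
        (α : Fin (n + 1) → L.Jet V),
        (evalDeg Φ p (L.toHoch p U (PiTensorProduct.tprod (fn O U) D))).app f h (Bar.pure α)
          = Bar.pure (L.capTens h (fun i => L.envRes f (D i)) α)) ∧
      -- the cap product with a function, a section of `HC⁰ = O`
      (∀ (U V : C) (f : V ⟶ U) (a : fn O U) (n : ℕ) (α : Fin (n + 1) → L.Jet V),
        (evalDeg Φ 0 (L.toHoch 0 U (a • PiTensorProduct.tprod (fn O U) Fin.elim0))).app f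
            (n := n) (m := n) (by simp) (Bar.pure α)
          = Bar.pure (Function.update α 0
              (Jet.nabla (Envel.incl k (fn O V) (L.sec V) (fnRes O f a)) (α 0)))) ∧
      -- `Φ` is unital
      (∀ (U V : C) (f : V ⟶ U) (n : ℕ) (x : L.Bar n V),
        (evalDeg Φ 0 (L.toHoch 0 U (PiTensorProduct.tprod (fn O U) Fin.elim0))).app f
            (n := n) (m := n) (by simp) x = x) ∧
      -- `Φ` sends the opposite of the cup product to the composition
      (∀ (p q : ℕ) (U : C) (x : (L.hochSheaf p).obj.obj (op U))
        (y : (L.hochSheaf q).obj.obj (op U)),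
        evalDeg Φ (q + p) ((-1 : ℤ) ^ (p * q) • L.cup y x)
          = L.homMul (by push_cast; ring) (evalDeg Φ p x) (evalDeg Φ q y)) ∧
      QuasiIso Φ := by
  refine ⟨capMap L, fun p U V f D n m h α => ?_, fun U V f a n α => ?_, fun U V f n x => ?_,
    fun p q U x y => ?_, quasiIso_capMap hL⟩
  · rw [evalDeg_toHoch]
    exact capN_tprod_pure ..
  · rw [evalDeg_toHoch]
    exact capN_smul_tprod_pure n rfl a f α
  · rw [evalDeg_toHoch]
    exact congr_arg (fun φ : L.HomCont n n U => φ.app f x) (capN_zero n rfl Fin.elim0)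
  · rw [evalDeg_capMap, evalDeg_capMap, evalDeg_capMap]
    exact capShf_cup _ x y
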